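/- Let $E$ be the elliptic curve $y^2+y=x^3+x$ over $\mathbb{F}_2$ with function field $\mathbb{F}_2(E)=\mathbb{F}_2(x,y)$, and put $$f_1=\frac{(x^5+x)y+x^2+x}{x^7+x+1},\quad f_2=\frac{(x^5+x^4+x^3+x)y+x^6+x^4}{x^7+x+1},\quad f_3=\frac{(x^6+x^5)y+x^{10}+x^6+x^2+x}{x^{14}+x^2+1}$$ and $S=\mathbb{F}_2f_1+\mathbb{F}_2f_2+\mathbb{F}_2f_3\subset\mathbb{F}_2(E)$. Fix an algebraic closure of $\mathbb{F}_2(E)$. For $j\in\{1,2,3\}$ let $w_j$ be a zero of $T^2+T+f_j$ in it, and let $X_j$, $X_{12}$, $X_{123}$ be the smooth complete curves over $\mathbb{F}_2$ with function fields $\mathbb{F}_2(E)(w_j)$, $\mathbb{F}_2(E)(w_1,w_2)$, $\mathbb{F}_2(E)(w_1,w_2,w_3)$, respectively. For an $\mathbb{F}_2$-linear subspace $R\subseteq S$ let $X_R$ be the smooth complete curve whose function field $\mathbb{F}_2(X_R)$ is obtained from $\mathbb{F}_2(E)$ by adjoining the zeros of $T^2+T+r$ for all $r\in R$. Then: 1.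 $R\mapsto\mathbb{F}_2(X_R)$ is a bijection from the set of $\mathbb{F}_2$-subspaces of $S$ onto the set of fields $F$ with $\mathbb{F}_2(E)\subseteq F\subseteq\mathbb{F}_2(X_{123})$, and $R\subseteq R'$ if and only if $\mathbb{F}_2(X_R)\subseteq\mathbb{F}_2(X_{R'})$. Moreover $\mathbb{F}_2(X_{\{0\}})=\mathbb{F}_2(E)$ and $\mathbb{F}_2(X_S)=\mathbb{F}_2(X_{123})$. 2. If $R\subseteq R'\subseteq S$ are subspaces, then $[\mathbb{F}_2(X_{R'}):\mathbb{F}_2(X_R)]=\#(R'/R)$. 3. For every subspace $R\subseteq S$ the curve $X_R$ is absolutely irreducible, has genus $g(X_R)=1+7(\#R-1)$, and has $\#X_R(\mathbb{F}_2)=5\cdot\#R$ rational points. 4. In particular $X_1,X_2,X_3$ have genus $8$ and $10$ rational points over $\mathbb{F}_2$, and $X_{12}$ has genus $22$ and $20$ rational points over $\mathbb{F}_2$. -/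

import Mathlib

open scoped TensorProduct

noncomputable section

namespace FunctionFieldCurve

/-! The smooth complete curve attached to a function field `F` in one variable over `k`:
its closed points are the places of `F / k`. -/

/-- A place of `F / k`: a valuation ring of `F`, different from `F`, that contains `k`. -/
structure Place (k F : Type*) [Field k] [Field F] [Algebra k F] where
  /-- The local ring of the curve at the place. -/
  ring : ValuationSubring F
  algebraMap_mem : ∀ c : k, algebraMap k F c ∈ ring
  ne_top : ring ≠ ⊤

/-- A place is rational if its residue field is `k`: every element of the local ring is
congruent to a constant modulo the maximal ideal. -/
def Place.IsRational {k F : Type*} [Field k] [Field F] [Algebra k F] (P : Place k F) : Prop :=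
  ∀ a ∈ P.ring, ∃ c : k, P.ring.valuation (a - algebraMap k F c) < 1

/-- The number of `k`-rational points of the smooth complete curve with function field `F`. -/
def numRationalPoints (k F : Type*) [Field k] [Field F] [Algebra k F] : ℕ :=
  Nat.card {P : Place k F // P.IsRational}

/-- The differentials of `F / k` that are regular at `P`: the module generated over the local
ring by the differentials of its elements. -/
def Place.regularDifferentials {k F : Type*} [Field k] [Field F] [Algebra k F]
    (P : Place k F) : Submodule k (Ω[F⁄k]) :=
  Submodule.span k
    {ω | ∃ a ∈ P.ring, ∃ b ∈ P.ring, ω = a • KaehlerDifferential.D k F b}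

/-- The genus of the smooth complete curve with function field `F` over `k`:
the dimension of the space of everywhere regular differentials. -/
def genus (k F : Type*) [Field k] [Field F] [Algebra k F] : ℕ :=
  Module.finrank k (⨅ P : Place k F, P.regularDifferentials : Submodule k (Ω[F⁄k]))

/-- Absolute irreducibility of the curve: `k̄ ⊗ F` is a domain. -/
def IsAbsolutelyIrreducible (k F : Type*) [Field k] [Field F] [Algebra k F] : Prop :=
  IsDomain (AlgebraicClosure k ⊗[k] F)

end FunctionFieldCurve

namespace SerreCurve

open FunctionFieldCurve

/-- The elliptic curve `y² + y = x³ + x` over `𝔽₂`. -/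
def E : WeierstrassCurve.Affine (ZMod 2) where
  a₁ := 0
  a₂ := 0
  a₃ := 1
  a₄ := 1
  a₆ := 0

/-- The function field `𝔽₂(E)`. -/
abbrev K : Type := E.FunctionField

/-- The coordinate function `x` on `E`. -/
def x : K := algebraMap E.CoordinateRing K
  (WeierstrassCurve.Affine.CoordinateRing.mk E (Polynomial.C Polynomial.X))

/-- The coordinate function `y` on `E`. -/
def y : K := algebraMap E.CoordinateRing K
  (WeierstrassCurve.Affine.CoordinateRing.mk E Polynomial.X)

def f₁ : K := ((x ^ 5 + x) * y + (x ^ 2 + x)) / (x ^ 7 + x + 1)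

def f₂ : K := ((x ^ 5 + x ^ 4 + x ^ 3 + x) * y + (x ^ 6 + x ^ 4)) / (x ^ 7 + x + 1)

def f₃ : K := ((x ^ 6 + x ^ 5) * y + (x ^ 10 + x ^ 6 + x ^ 2 + x)) / (x ^ 14 + x ^ 2 + 1)

/-- The space `S = 𝔽₂ f₁ + 𝔽₂ f₂ + 𝔽₂ f₃`. -/
def S : Submodule (ZMod 2) K := Submodule.span (ZMod 2) {f₁, f₂, f₃}

/-- The extension of `𝔽₂(E)`, inside a fixed algebraic closure, obtained by adjoining all zeros
of the polynomials `T² + T + r` with `r ∈ A`. -/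
def adjoinRoots (A : Set K) : IntermediateField K (AlgebraicClosure K) :=
  IntermediateField.adjoin K
    {w | ∃ r ∈ A, w ^ 2 + w + algebraMap K (AlgebraicClosure K) r = 0}

/-- The function field `𝔽₂(X_{123})`. -/
def FX₁₂₃ : IntermediateField K (AlgebraicClosure K) := adjoinRoots {f₁, f₂, f₃}

/-- The function field `𝔽₂(X_{12})`. -/
def FX₁₂ : IntermediateField K (AlgebraicClosure K) := adjoinRoots {f₁, f₂}

/-- The function field `𝔽₂(X_R)` for a subspace `R`. -/
def FX (R : Submodule (ZMod 2) K) : IntermediateField K (AlgebraicClosure K) :=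
  adjoinRoots (R : Set K)

end SerreCurve

end

/-!
The extension attached to `R` is a tower of Artin–Schreier extensions `T ^ 2 + T = f` over `𝔽₂(E)`.
Modulo elements of the form `h ^ 2 + h`, every nonzero `f ∈ S` has a simple pole at the place of
degree `7` over `x ^ 7 + x + 1` and is regular elsewhere. So each step is totally ramified at the
single place above it, unramified elsewhere, and again turns the remaining elements of `S` into
functions with a simple pole there. In particular no nonzero `r ∈ S` becomes of the form
`w ^ 2 + w` before it is adjoined, which gives the correspondence between subspaces and subfields
and the degrees.

The differential `dx` has neither zeros nor poles on `E`, and its pullback has all its zeros at the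
ramified place. The regular differentials are therefore the multiples of `dx` by functions with a
pole of bounded order at that place and no other pole, and these spaces can be counted step by step
without the theorem of Riemann–Roch. All elements of `S` vanish at the five rational points of `E`,
so every rational place splits in each step. Its existence also shows that the curve is absolutely
irreducible.
-/

namespace FunctionFieldCurve

open WithZero Polynomial

/-! ### Valuation rings and places -/

section ValuationSubring

variable {F L : Type*} [Field F] [Field L]

lemma mem_of_valuation_lt_one {V : ValuationSubring F} {z : F} (hz : V.valuation z < 1) : z ∈ V :=
  (V.valuation_le_one_iff z).1 hz.le

lemma mul_mem_iff_of_valuation_eq_one {V : ValuationSubring F} {u z : F} (hu : V.valuation u = 1) :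
    z * u ∈ V ↔ z ∈ V := by
  rw [← V.valuation_le_one_iff, ← V.valuation_le_one_iff, map_mul, hu, mul_one]

lemma valuation_comap_lt_one_iff (φ : F →+* L) (V : ValuationSubring L) (z : F) :
    (V.comap φ).valuation z < 1 ↔ V.valuation (φ z) < 1 := by
  rw [← ValuationSubring.mem_nonunits_iff, ← ValuationSubring.mem_nonunits_iff,
    ValuationSubring.mem_nonunits_iff_or, ValuationSubring.mem_nonunits_iff_or,
    ValuationSubring.mem_comap, map_inv₀, map_eq_zero]

lemma valuation_comap_eq_one_iff (φ : F →+* L) (V : ValuationSubring L) (z : F) :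
    (V.comap φ).valuation z = 1 ↔ V.valuation (φ z) = 1 := by
  rw [eq_iff_le_not_lt, eq_iff_le_not_lt, valuation_comap_lt_one_iff,
    ValuationSubring.valuation_le_one_iff, ValuationSubring.valuation_le_one_iff,
    ValuationSubring.mem_comap]

lemma valuation_sq_add_self {Γ : Type*} [LinearOrderedCommGroupWithZero Γ] (v : Valuation F Γ)
    {w : F} (hw : 1 < v w) : v (w ^ 2 + w) = v w ^ 2 := by
  rw [Valuation.map_add_eq_of_lt_left, map_pow]
  rw [map_pow, sq]
  exact lt_mul_of_one_lt_left (zero_lt_one.trans hw) hw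

lemma valuation_sq_add_self_le_one_iff {Γ : Type*} [LinearOrderedCommGroupWithZero Γ]
    (v : Valuation F Γ) {w : F} : v (w ^ 2 + w) ≤ 1 ↔ v w ≤ 1 := by
  refine ⟨fun h => ?_, fun h => v.map_add_le (by rw [map_pow]; exact pow_le_one' h 2) h⟩
  by_contra! hw
  exact (one_lt_pow₀ hw two_ne_zero).not_ge (valuation_sq_add_self v hw ▸ h)

lemma mem_of_sq_eq_mul_add {V : ValuationSubring F} {z b c : F} (hb : b ∈ V) (hc : c ∈ V)
    (hz : z ^ 2 = b * z + c) : z ∈ V := by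
  rcases V.mem_or_inv_mem z with h | h
  · exact h
  · rcases eq_or_ne z 0 with rfl | h0
    · exact V.zero_mem
    · rw [show z = b + c * z⁻¹ by field_simp; linear_combination hz]
      exact add_mem hb (V.mul_mem _ _ hc h)

lemma sq_add_self_mem_iff {V : ValuationSubring F} {w : F} : w ^ 2 + w ∈ V ↔ w ∈ V := by
  rw [← V.valuation_le_one_iff, ← V.valuation_le_one_iff, valuation_sq_add_self_le_one_iff]

lemma exists_comap_algebraMap_eq (V : ValuationSubring F) (L : Type*) [Field L] [Algebra F L] :
    ∃ V' : ValuationSubring L, V'.comap (algebraMap F L) = V := by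
  obtain ⟨A, hA, hloc⟩ := IsLocalRing.exists_factor_valuationRing
    ((algebraMap F L).comp V.subtype)
  refine ⟨A, ?_⟩
  ext z
  rw [ValuationSubring.mem_comap]
  refine ⟨fun hz => ?_, fun hz => hA ⟨z, hz⟩⟩
  by_contra hzV
  have hz0 : z ≠ 0 := by rintro rfl; exact hzV V.zero_mem
  have hzi : z⁻¹ ∈ V := (V.mem_or_inv_mem z).resolve_left hzV
  have hunit : IsUnit (⟨z⁻¹, hzi⟩ : V) := by
    refine hloc.map_nonunit _ (IsUnit.of_mul_eq_one (⟨algebraMap F L z, hz⟩ : A.toSubring) ?_)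
    apply Subtype.ext
    change algebraMap F L z⁻¹ * algebraMap F L z = 1
    rw [← map_mul, inv_mul_cancel₀ hz0, map_one]
  obtain ⟨t, ht⟩ := hunit.exists_right_inv
  have htz : (t : F) = z := by
    rw [← inv_inv z, inv_eq_of_mul_eq_one_right (by simpa using congrArg Subtype.val ht)]
  exact hzV (htz ▸ t.2)

lemma comap_algebraMap_ne_top [Algebra F L] [Algebra.IsAlgebraic F L] {V : ValuationSubring L}
    (hV : V ≠ ⊤) : V.comap (algebraMap F L) ≠ ⊤ := by
  contrapose hV
  have hF (a : F) : algebraMap F L a ∈ V := by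
    rw [← ValuationSubring.mem_comap, hV]; exact ValuationSubring.mem_top a
  refine eq_top_iff.2 fun z _ => ?_
  have hz : IsIntegral V z := (Algebra.IsIntegral.isIntegral (R := F) z).map_of_comp_eq
    ((algebraMap F L).codRestrict V.toSubring hF) (RingHom.id L) rfl
  obtain ⟨t, rfl⟩ := IsIntegrallyClosed.isIntegral_iff.1 hz
  exact t.2

end ValuationSubring

namespace Place

variable {k F L : Type*} [Field k] [Field F] [Field L] [Algebra k F] [Algebra k L]

lemma ext_ring {P Q : Place k F} (h : P.ring = Q.ring) : P = Q := by
  cases P; cases Q; congr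

variable [Algebra F L] [IsScalarTower k F L] [Algebra.IsAlgebraic F L]

/-- The place of `F` below a place of an algebraic extension `L` of `F`. -/
def comap (F : Type*) [Field F] [Algebra k F] [Algebra F L] [IsScalarTower k F L]
    [Algebra.IsAlgebraic F L] (P : Place k L) : Place k F where
  ring := P.ring.comap (algebraMap F L)
  algebraMap_mem c := by
    rw [ValuationSubring.mem_comap, ← IsScalarTower.algebraMap_apply]
    exact P.algebraMap_mem c
  ne_top := comap_algebraMap_ne_top P.ne_top

lemma mem_comap_ring {P : Place k L} {z : F} : z ∈ (P.comap F).ring ↔ algebraMap F L z ∈ P.ring :=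
  Iff.rfl

lemma valuation_comap_lt_one_iff {P : Place k L} {z : F} :
    (P.comap F).ring.valuation z < 1 ↔ P.ring.valuation (algebraMap F L z) < 1 :=
  FunctionFieldCurve.valuation_comap_lt_one_iff _ _ _

lemma exists_ring_eq {P : Place k F} {V : ValuationSubring L}
    (hV : V.comap (algebraMap F L) = P.ring) : ∃ Q : Place k L, Q.comap F = P ∧ Q.ring = V := by
  refine ⟨⟨V, fun c => ?_, ?_⟩, ext_ring hV, rfl⟩
  · rw [IsScalarTower.algebraMap_apply k F L, ← ValuationSubring.mem_comap, hV]
    exact P.algebraMap_mem c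
  · rintro rfl
    exact P.ne_top (hV.symm.trans (by ext; simp))

lemma exists_comap_eq (L : Type*) [Field L] [Algebra k L] [Algebra F L] [IsScalarTower k F L]
    [Algebra.IsAlgebraic F L] (P : Place k F) : ∃ Q : Place k L, Q.comap F = P := by
  obtain ⟨V, hV⟩ := exists_comap_algebraMap_eq P.ring L
  obtain ⟨Q, hQ, -⟩ := exists_ring_eq hV
  exact ⟨Q, hQ⟩

lemma IsRational.comap {P : Place k L} (hP : P.IsRational) : (P.comap F).IsRational := by
  intro a ha
  obtain ⟨c, hc⟩ := hP _ ha
  refine ⟨c, valuation_comap_lt_one_iff.2 ?_⟩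
  rwa [map_sub, ← IsScalarTower.algebraMap_apply]

end Place

/-! ### Artin–Schreier extensions -/

/-- `L = F(w)` is a quadratic extension of the field `F` of characteristic two, generated by a
root `w` of `T ^ 2 + T + f`. -/
structure IsArtinSchreier (F L : Type*) [Field F] [Field L] [Algebra F L] (w : L) (f : F) :
    Prop where
  two_eq_zero : (2 : F) = 0
  eq : w ^ 2 + w = algebraMap F L f
  exists_coords : ∀ z : L, ∃ a b : F, z = algebraMap F L a + algebraMap F L b * w
  ne_algebraMap : ∀ a : F, algebraMap F L a ≠ w

namespace IsArtinSchreier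

variable {F L : Type*} [Field F] [Field L] [Algebra F L] {w : L} {f : F}

lemma two_eq_zero_right (h : IsArtinSchreier F L w f) : (2 : L) = 0 := by
  rw [← map_ofNat (algebraMap F L) 2, h.two_eq_zero, map_zero]

lemma coords_unique (h : IsArtinSchreier F L w f) {a b c d : F}
    (e : algebraMap F L a + algebraMap F L b * w = algebraMap F L c + algebraMap F L d * w) :
    a = c ∧ b = d := by
  have hbd : b = d := by
    by_contra hne
    have h1 : algebraMap F L (b - d) ≠ 0 := by simpa [sub_eq_zero] using hne
    refine h.ne_algebraMap ((c - a) / (b - d)) ?_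
    rw [map_div₀, div_eq_iff h1, map_sub, map_sub]
    linear_combination -e
  subst hbd
  exact ⟨(algebraMap F L).injective (add_right_cancel e), rfl⟩

lemma translate (h : IsArtinSchreier F L w f) (c : F) :
    IsArtinSchreier F L (w + algebraMap F L c) (f + c ^ 2 + c) where
  two_eq_zero := h.two_eq_zero
  eq := by
    simp only [map_add, map_pow, ← h.eq]
    linear_combination w * algebraMap F L c * h.two_eq_zero_right
  exists_coords z := by
    obtain ⟨a, b, rfl⟩ := h.exists_coords z
    exact ⟨a - b * c, b, by simp only [map_sub, map_mul]; ring⟩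
  ne_algebraMap a ha := h.ne_algebraMap (a - c) (by rw [map_sub, ha]; ring)

lemma add_one (h : IsArtinSchreier F L w f) : IsArtinSchreier F L (w + 1) f := by
  have hf : f + 1 ^ 2 + 1 = f := by linear_combination h.two_eq_zero
  simpa only [hf, map_one] using h.translate 1

/-- The basis `1, w` of `L` over `F`. -/
noncomputable def basis (h : IsArtinSchreier F L w f) : Module.Basis (Fin 2) F L :=
  .mk (v := ![1, w])
    (LinearIndependent.pair_iff.2 fun a b e => h.coords_unique (by
      simpa [Algebra.smul_def] using e))
    (fun z _ => by
      obtain ⟨a, b, rfl⟩ := h.exists_coords z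
      rw [Matrix.range_cons, Matrix.range_cons, Matrix.range_empty, Set.union_empty,
        Set.singleton_union, Submodule.mem_span_pair]
      exact ⟨a, b, by simp [Algebra.smul_def]⟩)

lemma basis_zero (h : IsArtinSchreier F L w f) : h.basis 0 = 1 := by simp [basis]

lemma basis_one (h : IsArtinSchreier F L w f) : h.basis 1 = w := by simp [basis]

lemma finrank_eq_two (h : IsArtinSchreier F L w f) : Module.finrank F L = 2 := by
  simp [Module.finrank_eq_card_basis h.basis]

lemma isAlgebraic (h : IsArtinSchreier F L w f) : Algebra.IsAlgebraic F L :=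
  have := Module.Finite.of_basis h.basis
  inferInstance

lemma repr_coords (h : IsArtinSchreier F L w f) (a b : F) (i : Fin 2) :
    h.basis.repr (algebraMap F L a + algebraMap F L b * w) i = ![a, b] i := by
  have e : algebraMap F L a + algebraMap F L b * w = a • h.basis 0 + b • h.basis 1 := by
    simp only [h.basis_zero, h.basis_one, Algebra.smul_def, mul_one]
  rw [e, map_add, map_smul, map_smul, Module.Basis.repr_self, Module.Basis.repr_self]
  fin_cases i <;> simp

lemma norm_coords (h : IsArtinSchreier F L w f) (a b : F) :
    Algebra.norm F (algebraMap F L a + algebraMap F L b * w) = a ^ 2 + a * b + b ^ 2 * f := by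
  have hcol₀ : (algebraMap F L a + algebraMap F L b * w) * h.basis 0 =
      algebraMap F L a + algebraMap F L b * w := by rw [h.basis_zero, mul_one]
  have hcol₁ : (algebraMap F L a + algebraMap F L b * w) * h.basis 1 =
      algebraMap F L (b * f) + algebraMap F L (a - b) * w := by
    rw [h.basis_one, map_mul, map_sub, ← h.eq]; ring
  rw [Algebra.norm_eq_matrix_det h.basis, Matrix.det_fin_two]
  simp only [Algebra.leftMulMatrix_eq_repr_mul, hcol₀, hcol₁, h.repr_coords]
  simp only [Matrix.cons_val_zero, Matrix.cons_val_one]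
  linear_combination (-a * b - b ^ 2 * f) * h.two_eq_zero

/-- The nontrivial automorphism `w ↦ w + 1` of `L` over `F`. -/
noncomputable def conj (h : IsArtinSchreier F L w f) : L →ₐ[F] L :=
  AlgHom.ofLinearMap (LinearMap.id + Algebra.linearMap F L ∘ₗ h.basis.coord 1)
    (by simp [← h.basis_zero])
    (fun z z' => by
      obtain ⟨a, b, rfl⟩ := h.exists_coords z
      obtain ⟨c, d, rfl⟩ := h.exists_coords z'
      have e : (algebraMap F L a + algebraMap F L b * w) *
          (algebraMap F L c + algebraMap F L d * w) =
          algebraMap F L (a * c + b * d * f) + algebraMap F L (a * d + b * c + b * d) * w := by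
        simp only [map_add, map_mul, ← h.eq]
        linear_combination (-algebraMap F L b * algebraMap F L d * w) * h.two_eq_zero_right
      simp only [LinearMap.add_apply, LinearMap.id_apply, LinearMap.comp_apply,
        Module.Basis.coord_apply, e, h.repr_coords, Algebra.linearMap_apply, Matrix.cons_val_one,
        Matrix.cons_val_fin_one]
      simp only [map_add, map_mul, ← h.eq]
      ring)

lemma conj_coords (h : IsArtinSchreier F L w f) (a b : F) :
    h.conj (algebraMap F L a + algebraMap F L b * w) =
      algebraMap F L a + algebraMap F L b * w + algebraMap F L b :=
  congrArg (_ + algebraMap F L ·) (h.repr_coords a b 1)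

lemma conj_gen (h : IsArtinSchreier F L w f) : h.conj w = w + 1 := by
  simpa using h.conj_coords 0 1

lemma comap_comap_conj (h : IsArtinSchreier F L w f) (V : ValuationSubring L) :
    (V.comap (h.conj : L →+* L)).comap (algebraMap F L) = V.comap (algebraMap F L) := by
  ext z
  simp only [ValuationSubring.mem_comap, RingHom.coe_coe, AlgHom.commutes]

lemma gen_mem_iff (h : IsArtinSchreier F L w f) {V : ValuationSubring L} :
    w ∈ V ↔ algebraMap F L f ∈ V := by
  rw [← h.eq, sq_add_self_mem_iff]

/-- If `f` is integral at `V`, then so is the discriminant of `T ^ 2 + T + f` and its inverse: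
the integral closure of `V` is spanned by `1, w`. -/
lemma coords_mem (h : IsArtinSchreier F L w f) {V : ValuationSubring F} (hf : f ∈ V) {a b : F}
    (hz : ∀ V' : ValuationSubring L, V'.comap (algebraMap F L) = V →
      algebraMap F L a + algebraMap F L b * w ∈ V') : a ∈ V ∧ b ∈ V := by
  obtain ⟨V', rfl⟩ := exists_comap_algebraMap_eq V L
  simp only [ValuationSubring.mem_comap] at hf ⊢
  have hzV := hz V' rfl
  have hconj := hz (V'.comap (h.conj : L →+* L)) (h.comap_comap_conj V')
  rw [ValuationSubring.mem_comap, RingHom.coe_coe, h.conj_coords] at hconj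
  have hb : algebraMap F L b ∈ V' := by
    simpa only [add_sub_cancel_left] using sub_mem hconj hzV
  refine ⟨?_, hb⟩
  simpa only [add_sub_cancel_right] using
    sub_mem hzV (V'.mul_mem _ _ hb (h.gen_mem_iff.2 hf))

lemma exists_mul_eq_of_coord_notMem (h : IsArtinSchreier F L w f) {V : ValuationSubring L}
    (hw : w ∈ V) {a b : F} (hz : algebraMap F L a + algebraMap F L b * w ∈ V)
    (hb : algebraMap F L b ∉ V) :
    ∃ s c : F, algebraMap F L c ∈ V ∧ V.valuation (algebraMap F L c + w) = 1 ∧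
      (algebraMap F L a + algebraMap F L b * w) * (algebraMap F L c + w) = algebraMap F L s := by
  -- `a + b w = b (a / b + w)`, where `a / b + w` is in the maximal ideal and its conjugate
  -- `a / b + w + 1` is a unit.
  have hb0 : algebraMap F L b ≠ 0 := fun h0 => hb (h0 ▸ V.zero_mem)
  have hfactor : algebraMap F L a + algebraMap F L b * w =
      algebraMap F L b * (algebraMap F L (a / b) + w) := by
    rw [map_div₀]; field_simp
  have hlt : V.valuation (algebraMap F L (a / b) + w) < 1 := by
    have hb1 : 1 < V.valuation (algebraMap F L b) :=
      not_le.1 (mt (V.valuation_le_one_iff _).1 hb)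
    by_contra! hle
    rw [hfactor, ← V.valuation_le_one_iff, map_mul] at hz
    exact (one_lt_mul_of_lt_of_le hb1 hle).not_ge hz
  have hsum : algebraMap F L (a / b + 1) + w = 1 + (algebraMap F L (a / b) + w) := by
    rw [map_add, map_one]; ring
  have hunit : V.valuation (algebraMap F L (a / b + 1) + w) = 1 := by
    rw [hsum, V.valuation.map_one_add_of_lt hlt]
  refine ⟨b * ((a / b) ^ 2 + a / b + f), a / b + 1, ?_, hunit, ?_⟩
  · simpa only [add_sub_cancel_right] using
      sub_mem ((V.valuation_le_one_iff _).1 hunit.le) hw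
  · rw [hfactor, hsum]
    simp only [map_mul, map_add, map_pow, ← h.eq]
    linear_combination algebraMap F L b * algebraMap F L (a / b) * w * h.two_eq_zero_right

/-- If `w ∈ V`, then `V` is a localization of the ring generated by `w` over `V ∩ F`. -/
lemma exists_mul_eq_of_mem (h : IsArtinSchreier F L w f) {V : ValuationSubring L} (hw : w ∈ V)
    {z : L} (hz : z ∈ V) :
    ∃ a b c d : F, algebraMap F L a ∈ V ∧ algebraMap F L b ∈ V ∧ algebraMap F L c ∈ V ∧
      algebraMap F L d ∈ V ∧ V.valuation (algebraMap F L c + algebraMap F L d * w) = 1 ∧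
      z * (algebraMap F L c + algebraMap F L d * w) = algebraMap F L a + algebraMap F L b * w := by
  obtain ⟨a, b, rfl⟩ := h.exists_coords z
  by_cases hb : algebraMap F L b ∈ V
  · have ha : algebraMap F L a ∈ V := by
      simpa only [add_sub_cancel_right] using sub_mem hz (V.mul_mem _ _ hb hw)
    exact ⟨a, b, 1, 0, ha, hb, by simp [V.one_mem], by simp [V.zero_mem], by simp, by simp⟩
  · obtain ⟨s, c, hc, hunit, hs⟩ := h.exists_mul_eq_of_coord_notMem hw hz hb
    have hsV : algebraMap F L s ∈ V :=
      hs ▸ V.mul_mem _ _ hz ((V.valuation_le_one_iff _).1 hunit.le)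
    exact ⟨s, 0, c, 1, hsV, by simp [V.zero_mem], hc, by simp [V.one_mem], by simpa using hunit,
      by simpa using hs⟩

lemma valuation_mul_gen_lt_one {V : ValuationSubring L} (hw : V.valuation w < 1) {d : F}
    (hd : algebraMap F L d ∈ V) : V.valuation (algebraMap F L d * w) < 1 := by
  rw [map_mul]
  exact mul_lt_one_of_nonneg_of_lt_one_right ((V.valuation_le_one_iff _).2 hd) zero_le hw

lemma valuation_coords_eq_one_iff {V : ValuationSubring L} (hw : V.valuation w < 1) {c d : F}
    (hd : algebraMap F L d ∈ V) :
    V.valuation (algebraMap F L c + algebraMap F L d * w) = 1 ↔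
      V.valuation (algebraMap F L c) = 1 := by
  have hdw := valuation_mul_gen_lt_one hw hd
  constructor <;> intro hu
  · rw [← add_sub_cancel_right (algebraMap F L c) (algebraMap F L d * w), ← hu]
    exact Valuation.map_sub_eq_of_lt_left _ (hu ▸ hdw)
  · rw [← hu]
    exact Valuation.map_add_eq_of_lt_left _ (hu ▸ hdw)

lemma exists_valuation_sub_lt_one (h : IsArtinSchreier F L w f) {V : ValuationSubring L}
    (hw : V.valuation w < 1) {z : L} (hz : z ∈ V) :
    ∃ a : F, V.valuation (z - algebraMap F L a) < 1 := by
  obtain ⟨a, b, c, d, -, hb, -, hd, hunit, hmul⟩ :=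
    h.exists_mul_eq_of_mem (mem_of_valuation_lt_one hw) hz
  have hc1 := (valuation_coords_eq_one_iff hw hd).1 hunit
  have hc0 : algebraMap F L c ≠ 0 := fun h0 => by simp [h0] at hc1
  refine ⟨a / c, ?_⟩
  have hzc : (z - algebraMap F L (a / c)) * algebraMap F L c =
      algebraMap F L b * w - z * (algebraMap F L d * w) := by
    rw [map_div₀, sub_mul, div_mul_cancel₀ _ hc0]; linear_combination hmul
  rw [← mul_one (V.valuation _), ← hc1, ← map_mul, hzc]
  refine V.valuation.map_sub_lt (hc1.symm ▸ valuation_mul_gen_lt_one hw hb) ?_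
  rw [hc1, map_mul]
  exact mul_lt_one_of_nonneg_of_lt_one_right ((V.valuation_le_one_iff _).2 hz) zero_le
    (valuation_mul_gen_lt_one hw hd)

lemma le_of_comap_eq (h : IsArtinSchreier F L w f) {V V' : ValuationSubring L}
    (hV : V.comap (algebraMap F L) = V'.comap (algebraMap F L))
    (hw : V.valuation w < 1) (hw' : V'.valuation w < 1) : V ≤ V' := by
  have hmem (a : F) (ha : algebraMap F L a ∈ V) : algebraMap F L a ∈ V' := by
    rwa [← ValuationSubring.mem_comap, ← hV]
  intro z hz
  obtain ⟨a, b, c, d, ha, hb, -, hd, hunit, hmul⟩ :=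
    h.exists_mul_eq_of_mem (mem_of_valuation_lt_one hw) hz
  have hc1 : V'.valuation (algebraMap F L c) = 1 := by
    rw [← valuation_comap_eq_one_iff, ← hV, valuation_comap_eq_one_iff]
    exact (valuation_coords_eq_one_iff hw hd).1 hunit
  have hunit' := (valuation_coords_eq_one_iff hw' (hmem d hd)).2 hc1
  rw [← mul_mem_iff_of_valuation_eq_one hunit', hmul]
  exact add_mem (hmem a ha) (V'.mul_mem _ _ (hmem b hb) (mem_of_valuation_lt_one hw'))

lemma eq_of_comap_eq (h : IsArtinSchreier F L w f) {V V' : ValuationSubring L}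
    (hV : V.comap (algebraMap F L) = V'.comap (algebraMap F L))
    (hw : V.valuation w < 1) (hw' : V'.valuation w < 1) : V = V' :=
  le_antisymm (h.le_of_comap_eq hV hw hw') (h.le_of_comap_eq hV.symm hw' hw)

lemma valuation_gen_lt_one_or (h : IsArtinSchreier F L w f) {V : ValuationSubring L}
    (hf : V.valuation (algebraMap F L f) < 1) :
    V.valuation w < 1 ∨ V.valuation (w + 1) < 1 := by
  by_contra! hc
  rw [← h.eq, show w ^ 2 + w = w * (w + 1) by ring, map_mul] at hf
  exact (one_le_mul hc.1 hc.2).not_gt hf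

section Splitting

variable {k : Type*} [Field k] [Algebra k F] [Algebra k L] [IsScalarTower k F L]
  [Algebra.IsAlgebraic F L]

lemma exists_place_comap_eq_and_lt_one (h : IsArtinSchreier F L w f) {P : Place k F}
    (hf : P.ring.valuation f < 1) :
    ∃ Q : Place k L, Q.comap F = P ∧ Q.ring.valuation w < 1 := by
  obtain ⟨Q, rfl⟩ := P.exists_comap_eq L
  rw [Place.valuation_comap_lt_one_iff] at hf
  rcases h.valuation_gen_lt_one_or hf with hw | hw
  · exact ⟨Q, rfl, hw⟩
  · obtain ⟨Q', hQ', hring⟩ := Place.exists_ring_eq (P := Q.comap F) (h.comap_comap_conj Q.ring)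
    refine ⟨Q', hQ', ?_⟩
    rwa [hring, valuation_comap_lt_one_iff, RingHom.coe_coe, h.conj_gen]

lemma isRational_of_comap_of_gen_lt_one (h : IsArtinSchreier F L w f) {Q : Place k L}
    (hQ : (Q.comap F).IsRational) (hw : Q.ring.valuation w < 1) : Q.IsRational := by
  intro z hz
  obtain ⟨a, ha⟩ := h.exists_valuation_sub_lt_one hw hz
  have haQ : algebraMap F L a ∈ Q.ring := by
    simpa only [sub_sub_cancel] using sub_mem hz (mem_of_valuation_lt_one ha)
  obtain ⟨c, hc⟩ := hQ a haQ
  rw [Place.valuation_comap_lt_one_iff, map_sub, ← IsScalarTower.algebraMap_apply] at hc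
  refine ⟨c, ?_⟩
  rw [← sub_add_sub_cancel z (algebraMap F L a) (algebraMap k L c)]
  exact Q.ring.valuation.map_add_lt ha hc

lemma isRational_iff_comap (h : IsArtinSchreier F L w f) {Q : Place k L}
    (hf : (Q.comap F).ring.valuation f < 1) : Q.IsRational ↔ (Q.comap F).IsRational := by
  refine ⟨Place.IsRational.comap, fun hQ => ?_⟩
  rcases h.valuation_gen_lt_one_or (Place.valuation_comap_lt_one_iff.1 hf) with hw | hw
  · exact h.isRational_of_comap_of_gen_lt_one hQ hw
  · exact h.add_one.isRational_of_comap_of_gen_lt_one hQ hw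

/-- The places in `T` split: above each of them there is one place at which `w` vanishes and one at
which `w + 1` vanishes. -/
lemma card_comap_mem (h : IsArtinSchreier F L w f) {T : Set (Place k F)}
    (hf : ∀ P ∈ T, P.ring.valuation f < 1) :
    Nat.card {Q : Place k L // Q.comap F ∈ T} = 2 * Nat.card T := by
  classical
  let φ : {Q : Place k L // Q.comap F ∈ T} → Bool × T := fun Q =>
    (decide (Q.1.ring.valuation w < 1), ⟨Q.1.comap F, Q.2⟩)
  have hw_iff (Q : Place k L) (hQ : Q.comap F ∈ T) :
      ¬ Q.ring.valuation w < 1 ↔ Q.ring.valuation (w + 1) < 1 := by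
    refine ⟨(h.valuation_gen_lt_one_or
      (Place.valuation_comap_lt_one_iff.1 (hf _ hQ))).resolve_left, fun h1 h2 => ?_⟩
    have h3 := Q.ring.valuation.map_sub_lt h1 h2
    rw [add_sub_cancel_left, map_one] at h3
    exact lt_irrefl _ h3
  have hφ : Function.Bijective φ := by
    constructor
    · rintro ⟨Q, hQ⟩ ⟨Q', hQ'⟩ he
      have hw : Q.ring.valuation w < 1 ↔ Q'.ring.valuation w < 1 :=
        decide_eq_decide.1 (congrArg Prod.fst he)
      have hcomap : Q.ring.comap (algebraMap F L) = Q'.ring.comap (algebraMap F L) :=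
        congrArg (fun p => p.2.1.ring) he
      refine Subtype.ext (Place.ext_ring ?_)
      by_cases hQw : Q.ring.valuation w < 1
      · exact h.eq_of_comap_eq hcomap hQw (hw.1 hQw)
      · exact h.add_one.eq_of_comap_eq hcomap ((hw_iff Q hQ).1 hQw)
          ((hw_iff Q' hQ').1 (mt hw.2 hQw))
    · rintro ⟨i, P, hP⟩
      cases i
      · obtain ⟨Q, rfl, hQ⟩ := h.add_one.exists_place_comap_eq_and_lt_one (hf P hP)
        exact ⟨⟨Q, hP⟩, Prod.ext (decide_eq_false ((hw_iff Q hP).2 hQ)) rfl⟩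
      · obtain ⟨Q, rfl, hQ⟩ := h.exists_place_comap_eq_and_lt_one (hf P hP)
        exact ⟨⟨Q, hP⟩, Prod.ext (decide_eq_true hQ) rfl⟩
  rw [Nat.card_congr (Equiv.ofBijective φ hφ), Nat.card_prod]
  simp

lemma numRationalPoints_eq_two_mul (h : IsArtinSchreier F L w f)
    (hf : ∀ P : Place k F, P.IsRational → P.ring.valuation f < 1) :
    numRationalPoints k L = 2 * numRationalPoints k F := by
  rw [numRationalPoints, numRationalPoints]
  refine .trans (Nat.card_congr (Equiv.subtypeEquivRight fun Q => ?_))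
    (h.card_comap_mem (T := {P | P.IsRational}) hf)
  exact ⟨Place.IsRational.comap, fun hQ => (h.isRational_iff_comap (hf _ hQ)).2 hQ⟩

end Splitting

section Derivation

variable {k : Type*} [CommRing k] [Algebra k F] [Algebra k L] {D : Derivation k F F}
  {D' : Derivation k L L}

lemma derivation_gen (h : IsArtinSchreier F L w f)
    (hD : ∀ a, D' (algebraMap F L a) = algebraMap F L (D a)) : D' w = algebraMap F L (D f) := by
  rw [← hD, ← h.eq, map_add, Derivation.leibniz_pow]
  simp only [nsmul_eq_mul, smul_eq_mul]
  linear_combination (-(w * D' w)) * h.two_eq_zero_right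

lemma derivation_mem (h : IsArtinSchreier F L w f)
    (hD : ∀ a, D' (algebraMap F L a) = algebraMap F L (D a)) {V : ValuationSubring L}
    (hV : ∀ a : F, algebraMap F L a ∈ V → algebraMap F L (D a) ∈ V)
    (hf : algebraMap F L f ∈ V) {z : L} (hz : z ∈ V) : D' z ∈ V := by
  have hw : w ∈ V := h.gen_mem_iff.2 hf
  have hD_coords {a b : F} (ha : algebraMap F L a ∈ V) (hb : algebraMap F L b ∈ V) :
      D' (algebraMap F L a + algebraMap F L b * w) ∈ V := by
    rw [map_add, Derivation.leibniz, hD, hD, h.derivation_gen hD, smul_eq_mul, smul_eq_mul]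
    exact add_mem (hV _ ha) (add_mem (V.mul_mem _ _ hb (hV _ hf)) (V.mul_mem _ _ hw (hV _ hb)))
  obtain ⟨a, b, c, d, ha, hb, hc, hd, hunit, hmul⟩ := h.exists_mul_eq_of_mem hw hz
  set u := algebraMap F L c + algebraMap F L d * w
  have hleibniz : D' z * u = D' (algebraMap F L a + algebraMap F L b * w) - z * D' u := by
    rw [← hmul, Derivation.leibniz, smul_eq_mul, smul_eq_mul]; ring
  rw [← mul_mem_iff_of_valuation_eq_one hunit, hleibniz]
  exact sub_mem (hD_coords ha hb) (V.mul_mem _ _ hz (hD_coords hc hd))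

end Derivation

end IsArtinSchreier

section WithZeroInt

lemma exp_sq (n : ℤ) : (exp n : ℤᵐ⁰) ^ 2 = exp (2 * n) := by
  rw [← exp_nsmul]; simp

lemma sq_mul_exp_le_exp_iff {a : ℤᵐ⁰} {c n : ℤ} :
    a ^ 2 * exp c ≤ exp n ↔ a ≤ exp ((n - c) / 2) := by
  induction a using WithZero.expRecOn with
  | zero => simp
  | exp k => rw [exp_sq, ← exp_add, exp_le_exp, exp_le_exp]; omega

lemma sq_le_exp_iff {a : ℤᵐ⁰} {n : ℤ} : a ^ 2 ≤ exp n ↔ a ≤ exp (n / 2) := by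
  simpa using sq_mul_exp_le_exp_iff (a := a) (c := 0) (n := n)

lemma lt_one_iff_le_exp_neg_one {a : ℤᵐ⁰} : a < 1 ↔ a ≤ exp (-1) := by
  rw [← lt_mul_exp_iff_le exp_ne_zero, ← exp_add, neg_add_cancel, exp_zero]

variable {F : Type*} [Field F] {v : Valuation F ℤᵐ⁰}

lemma ne_zero_of_valuation_eq_exp {z : F} {c : ℤ} (h : v z = exp c) : z ≠ 0 :=
  v.ne_zero_iff.1 (h ▸ exp_ne_zero)

lemma valuation_le_one_of_sq_add_self_le {e : F} (he : v (e ^ 2 + e) ≤ exp 1) : v e ≤ 1 := by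
  by_contra! hc
  rw [valuation_sq_add_self v hc, sq_le_exp_iff] at he
  exact hc.not_ge (he.trans (by simp))

lemma valuation_sq_add_self_ne_exp_one (e : F) : v (e ^ 2 + e) ≠ exp 1 := by
  intro h
  have := (valuation_sq_add_self_le_one_iff v).2 (valuation_le_one_of_sq_add_self_le h.le)
  rw [h, ← exp_zero, exp_le_exp] at this
  omega

lemma valuationSubring_eq_of_le_of_ne_top {V : ValuationSubring F}
    (hle : v.valuationSubring ≤ V) (hV : V ≠ ⊤) : v.valuationSubring = V := by
  refine le_antisymm hle fun z hz => ?_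
  contrapose! hV
  rw [Valuation.mem_valuationSubring_iff, not_le] at hV
  -- A large power of `z` dominates any given `y`.
  refine eq_top_iff.2 fun y _ => ?_
  obtain ⟨n, hn⟩ : ∃ n : ℕ, v y ≤ v z ^ n := MulArchimedean.arch _ hV
  have hz0 : z ≠ 0 := by rintro rfl; simp at hV
  rw [show y = z ^ n * (y / z ^ n) by field_simp]
  refine V.mul_mem _ _ (pow_mem hz n) (hle ?_)
  rw [Valuation.mem_valuationSubring_iff, map_div₀, map_pow]
  exact div_le_one_of_le₀ hn zero_le

end WithZeroInt

namespace IsArtinSchreier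

variable {F L : Type*} [Field F] [Field L] [Algebra F L] {w : L} {f : F} {v : Valuation F ℤᵐ⁰}
  {c : ℤ}

/-- The three terms have distinct valuations unless the middle one is dominated, because the
valuations of the outer two have different parities. -/
lemma valuation_norm_form (hc : 0 < c) (hodd : Odd c) (hv : v f = exp c) (a b : F) :
    v (a ^ 2 + a * b + b ^ 2 * f) = max (v a ^ 2) (v b ^ 2 * exp c) := by
  obtain ⟨j, rfl⟩ := hodd
  rw [add_assoc, ← hv, ← map_pow, ← map_pow, ← map_mul]
  rcases eq_or_ne a 0 with rfl | ha
  · simp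
  rcases eq_or_ne b 0 with rfl | hb
  · simp
  have ha2 : v (a ^ 2) = exp (2 * log (v a)) := by
    rw [map_pow, ← exp_sq, exp_log (v.ne_zero_iff.2 ha)]
  have hab : v (a * b) = exp (log (v a) + log (v b)) := by
    rw [map_mul, exp_add, exp_log (v.ne_zero_iff.2 ha), exp_log (v.ne_zero_iff.2 hb)]
  have hb2 : v (b ^ 2 * f) = exp (2 * log (v b) + (2 * j + 1)) := by
    rw [map_mul, map_pow, hv, exp_add (2 * log (v b)), ← exp_sq, exp_log (v.ne_zero_iff.2 hb)]
  rcases lt_or_ge (log (v b) + j) (log (v a)) with h | h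
  · have hlt : v (a * b + b ^ 2 * f) < v (a ^ 2) := by
      refine v.map_add_lt ?_ ?_
      · rw [hab, ha2, exp_lt_exp]; omega
      · rw [hb2, ha2, exp_lt_exp]; omega
    rw [v.map_add_eq_of_lt_left hlt, eq_comm, max_eq_left_iff, ha2, hb2, exp_le_exp]
    omega
  · have hlt : v (a ^ 2 + a * b) < v (b ^ 2 * f) := by
      refine v.map_add_lt ?_ ?_
      · rw [ha2, hb2, exp_lt_exp]; omega
      · rw [hab, hb2, exp_lt_exp]; omega
    rw [← add_assoc, v.map_add_eq_of_lt_right hlt, eq_comm, max_eq_right_iff, ha2, hb2, exp_le_exp]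
    omega

lemma valuation_norm (h : IsArtinSchreier F L w f) (hc : 0 < c) (hodd : Odd c) (hv : v f = exp c)
    (a b : F) :
    v (Algebra.norm F (algebraMap F L a + algebraMap F L b * w)) =
      max (v a ^ 2) (v b ^ 2 * exp c) := by
  rw [h.norm_coords, valuation_norm_form hc hodd hv]

lemma norm_algebraMap (h : IsArtinSchreier F L w f) (a : F) :
    Algebra.norm F (algebraMap F L a) = a ^ 2 := by
  rw [Algebra.norm_algebraMap, h.finrank_eq_two]

/-- The extension to `L` of a discrete valuation at which `f` has a pole of odd order. It is the
valuation of the norm, hence normalized to be onto `ℤ` again. -/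
noncomputable def ramified (h : IsArtinSchreier F L w f) (hc : 0 < c) (hodd : Odd c)
    (hv : v f = exp c) : Valuation L ℤᵐ⁰ where
  toFun z := v (Algebra.norm F z)
  map_zero' := by
    rw [← map_zero (algebraMap F L), h.norm_algebraMap]; simp
  map_one' := by rw [map_one, map_one]
  map_mul' z z' := by rw [map_mul, map_mul]
  map_add_le_max' z z' := by
    obtain ⟨a, b, rfl⟩ := h.exists_coords z
    obtain ⟨a', b', rfl⟩ := h.exists_coords z'
    rw [add_add_add_comm, ← add_mul, ← map_add, ← map_add]
    simp only [h.valuation_norm hc hodd hv]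
    rw [max_max_max_comm]
    refine max_le_max ?_ ?_
    · rw [← (pow_left_mono 2).map_max]
      exact pow_le_pow_left₀ zero_le (v.map_add _ _) 2
    · rw [← (mul_left_mono (a := exp c)).map_max, ← (pow_left_mono 2).map_max]
      gcongr
      exact v.map_add _ _

variable (h : IsArtinSchreier F L w f) (hc : 0 < c) (hodd : Odd c) (hv : v f = exp c)

lemma ramified_coords (a b : F) :
    h.ramified hc hodd hv (algebraMap F L a + algebraMap F L b * w) =
      max (v a ^ 2) (v b ^ 2 * exp c) :=
  h.valuation_norm hc hodd hv a b

lemma ramified_le_exp_iff {a b : F} {n : ℤ} :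
    h.ramified hc hodd hv (algebraMap F L a + algebraMap F L b * w) ≤ exp n ↔
      v a ≤ exp (n / 2) ∧ v b ≤ exp ((n - c) / 2) := by
  rw [h.ramified_coords, max_le_iff, sq_le_exp_iff, sq_mul_exp_le_exp_iff]

lemma ramified_algebraMap (a : F) : h.ramified hc hodd hv (algebraMap F L a) = v a ^ 2 := by
  simpa using h.ramified_coords hc hodd hv a 0

lemma ramified_gen : h.ramified hc hodd hv w = exp c := by
  simpa using h.ramified_coords hc hodd hv 0 1

lemma comap_ramified :
    (h.ramified hc hodd hv).valuationSubring.comap (algebraMap F L) = v.valuationSubring := by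
  ext a
  rw [ValuationSubring.mem_comap, Valuation.mem_valuationSubring_iff,
    Valuation.mem_valuationSubring_iff, h.ramified_algebraMap, ← exp_zero, sq_le_exp_iff,
    Int.zero_ediv]

lemma eq_ramified {V : ValuationSubring L}
    (hV : V.comap (algebraMap F L) = v.valuationSubring) :
    V = (h.ramified hc hodd hv).valuationSubring := by
  have hmem (a : F) : algebraMap F L a ∈ V ↔ v a ≤ 1 := by
    rw [← ValuationSubring.mem_comap, hV, Valuation.mem_valuationSubring_iff]
  refine (valuationSubring_eq_of_le_of_ne_top (fun z hz => ?_) ?_).symm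
  · obtain ⟨a, b, rfl⟩ := h.exists_coords z
    have hab := hz
    rw [Valuation.mem_valuationSubring_iff, ← exp_zero, h.ramified_le_exp_iff] at hab
    have hb : v b ≤ 1 := hab.2.trans (by rw [← exp_zero, exp_le_exp]; omega)
    -- the trace and the norm of `a + b w` are integral
    refine mem_of_sq_eq_mul_add (V.neg_mem _ ((hmem b).2 hb)) ((hmem _).2 hz)
      (?_ : _ = _ + algebraMap F L (Algebra.norm F _))
    rw [h.norm_coords]
    simp only [map_add, map_mul, map_pow, ← h.eq]
    linear_combination (algebraMap F L a * algebraMap F L b * w) * h.two_eq_zero_right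
  · rintro rfl
    have hf := (hmem f).1 (ValuationSubring.mem_top _)
    rw [hv, ← exp_zero, exp_le_exp] at hf
    omega

end IsArtinSchreier

section SimplePole

variable {F : Type*} [Field F] {v : Valuation F ℤᵐ⁰}

lemma valuation_add_sq_add_self_eq_exp_one {t e : F} (ht : v t = exp 1)
    (he : v (e ^ 2 + e) ≤ exp 1) : v (t + (e ^ 2 + e)) = exp 1 := by
  rw [← ht]
  refine v.map_add_eq_of_lt_left ?_
  calc v (e ^ 2 + e) ≤ 1 :=
        (valuation_sq_add_self_le_one_iff v).2 (valuation_le_one_of_sq_add_self_le he)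
    _ < v t := by rw [ht, ← exp_zero, exp_lt_exp]; exact one_pos

lemma sq_add_self_ne_of_simple_pole (h2 : (2 : F) = 0) {f h : F}
    (hf : v (f + h ^ 2 + h) = exp 1) (a : F) : a ^ 2 + a ≠ f := by
  rintro rfl
  refine valuation_sq_add_self_ne_exp_one (v := v) (a + h) ?_
  rw [← hf]
  congr 1
  linear_combination (a * h) * h2

lemma valuation_add_eq_exp_one_of_simple_poles (h2 : (2 : F) = 0) {a b h₁ h₀ h₂ : F}
    (ha : v (a + h₁ ^ 2 + h₁) = exp 1) (hb : v (b + h₀ ^ 2 + h₀) = exp 1)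
    (hab : v (a + b + h₂ ^ 2 + h₂) = exp 1) :
    v (a + h₁ ^ 2 + h₁ + (b + h₀ ^ 2 + h₀)) = exp 1 := by
  have hsub : (h₀ + h₁ + h₂) ^ 2 + (h₀ + h₁ + h₂) =
      a + h₁ ^ 2 + h₁ + (b + h₀ ^ 2 + h₀) - (a + b + h₂ ^ 2 + h₂) := by
    linear_combination (h₀ * h₁ + h₀ * h₂ + h₁ * h₂ + h₂ ^ 2 + h₂) * h2
  have hle : v ((h₀ + h₁ + h₂) ^ 2 + (h₀ + h₁ + h₂)) ≤ exp 1 :=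
    hsub ▸ v.map_sub_le (v.map_add_le ha.le hb.le) hab.le
  rw [← valuation_add_sq_add_self_eq_exp_one hab hle, hsub]
  congr 1
  ring

lemma valuation_eq_one_of_sq_sub_lt_one {c γ : F} (hc : v c = 1) (hγ : v (γ ^ 2 - c) < 1) :
    v γ = 1 := by
  rw [← hc] at hγ
  rw [← pow_eq_one_iff_of_nonneg zero_le two_ne_zero, ← map_pow, v.map_eq_of_sub_lt hγ, hc]

/-- `γ` is a square root of `q / g` modulo the maximal ideal. -/
lemma exists_valuation_add_sq_mul_le_one (h2 : (2 : F) = 0)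
    (hperfect : ∀ c, v c ≤ 1 → ∃ γ, v (γ ^ 2 - c) < 1) {q g : F} (hq : v q = exp 1)
    (hg : v g = exp 1) (hqg : v (q + g) = exp 1) :
    ∃ γ, v γ = 1 ∧ v (γ + 1) = 1 ∧ v (q + γ ^ 2 * g) ≤ 1 := by
  have hg0 : g ≠ 0 := ne_zero_of_valuation_eq_exp hg
  have hdiv {z : F} (hz : v z = exp 1) : v (z / g) = 1 := by
    rw [map_div₀, hz, hg, div_self exp_ne_zero]
  obtain ⟨γ, hγ⟩ := hperfect (q / g) (hdiv hq).le
  refine ⟨γ, valuation_eq_one_of_sq_sub_lt_one (hdiv hq) hγ,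
    valuation_eq_one_of_sq_sub_lt_one (hdiv hqg) ?_, ?_⟩
  · have hadd : (γ + 1) ^ 2 - (q + g) / g = γ ^ 2 - q / g := by
      field_simp
      linear_combination (γ * g) * h2
    rwa [hadd]
  · have hmul : q + γ ^ 2 * g = (γ ^ 2 - q / g) * g := by
      field_simp
      linear_combination q * h2
    rw [hmul, map_mul, hg, ← exp_zero, show (0 : ℤ) = -1 + 1 by norm_num, exp_add]
    gcongr
    exact lt_one_iff_le_exp_neg_one.1 hγ

end SimplePole

/-! ### Poles and zeros of derivations -/

section Derivation

variable {k F : Type*} [CommRing k] [Field F] [Algebra k F] {D : Derivation k F F}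
  {v : Valuation F ℤᵐ⁰} {e : ℤ}

/-- The derivation `D` has a pole of order `e` at the place of `v`. If `ω` is the differential
with `D z = dz / ω`, this says that `ω` has a zero of order `e` there. -/
structure HasPoleOfOrder (D : Derivation k F F) (v : Valuation F ℤᵐ⁰) (e : ℤ) : Prop where
  map_le : ∀ z, v z ≤ 1 → v (D z) ≤ exp e
  exists_uniformizer : ∃ π, v π = exp (-1) ∧ v (D π) = exp e

/-- The derivation `D` has neither a zero nor a pole at the place with local ring `V`: it maps `V`
to itself, and not into the maximal ideal. -/
structure IsInvertibleAt (D : Derivation k F F) (V : ValuationSubring F) : Prop where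
  map_mem : ∀ z ∈ V, D z ∈ V
  exists_valuation_eq_one : ∃ b ∈ V, V.valuation (D b) = 1

lemma HasPoleOfOrder.uniformizer (hD : HasPoleOfOrder D v e) {t : F} (ht : v t = exp (-1)) :
    v (D t) = exp e := by
  obtain ⟨π, hπ, hDπ⟩ := hD.exists_uniformizer
  have hπ0 : π ≠ 0 := ne_zero_of_valuation_eq_exp hπ
  have hu : v (t / π) = 1 := by rw [map_div₀, ht, hπ, div_self exp_ne_zero]
  have hmain : v (t / π * D π) = exp e := by rw [map_mul, hu, one_mul, hDπ]
  have hDt : D t = t / π * D π + π * D (t / π) := by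
    rw [← smul_eq_mul, ← smul_eq_mul, ← Derivation.leibniz, div_mul_cancel₀ _ hπ0]
  rw [hDt, ← hmain]
  refine v.map_add_eq_of_lt_left ?_
  calc v (π * D (t / π)) ≤ exp (-1) * exp e := by
        rw [map_mul, hπ]; gcongr; exact hD.map_le _ hu.le
    _ < v (t / π * D π) := by rw [hmain, ← exp_add, exp_lt_exp]; omega

lemma HasPoleOfOrder.simple_pole (hD : HasPoleOfOrder D v e) {g : F} (hg : v g = exp 1) :
    v (D g) = exp (e + 2) := by
  have hg0 : g ≠ 0 := ne_zero_of_valuation_eq_exp hg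
  have hDg : D g = -(g ^ 2 * D g⁻¹) := by
    rw [Derivation.leibniz_inv, smul_eq_mul]; field_simp
  have hinv : v (D g⁻¹) = exp e := hD.uniformizer (by rw [map_inv₀, hg, exp_neg])
  rw [hDg, Valuation.map_neg, map_mul, hinv, map_pow, hg, exp_sq, ← exp_add, mul_one, add_comm]

end Derivation

section PoleSpace

variable {k F : Type*} [Field k] [Field F] [Algebra k F] {v : Valuation F ℤᵐ⁰}

/-- The functions without poles outside the place of `v`. -/
def regularAway (k : Type*) {F : Type*} [Field k] [Field F] [Algebra k F]
    (v : Valuation F ℤᵐ⁰) : Subalgebra k F where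
  carrier := {z | ∀ P : Place k F, P.ring ≠ v.valuationSubring → z ∈ P.ring}
  mul_mem' ha hb P hP := P.ring.mul_mem _ _ (ha P hP) (hb P hP)
  add_mem' ha hb P hP := P.ring.add_mem _ _ (ha P hP) (hb P hP)
  algebraMap_mem' c P _ := P.algebraMap_mem c

lemma mem_regularAway {z : F} :
    z ∈ regularAway k v ↔ ∀ P : Place k F, P.ring ≠ v.valuationSubring → z ∈ P.ring :=
  Iff.rfl

/-- The functions whose only pole is at the place of `v`, of order at most `c`. -/
def poleSpace (k : Type*) {F : Type*} [Field k] [Field F] [Algebra k F]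
    (v : Valuation F ℤᵐ⁰) (c : ℤ) : Set F :=
  {z | z ∈ regularAway k v ∧ v z ≤ exp c}

lemma mem_poleSpace {c : ℤ} {z : F} : z ∈ poleSpace k v c ↔ z ∈ regularAway k v ∧ v z ≤ exp c :=
  Iff.rfl

end PoleSpace

namespace IsArtinSchreier

variable {F L : Type*} [Field F] [Field L] [Algebra F L] {w : L} {f h₀ : F} {v : Valuation F ℤᵐ⁰}

/-- The extension to `L` of a discrete valuation at which `f + h₀² + h₀` has a simple pole. -/
noncomputable abbrev simplyRamified (h : IsArtinSchreier F L w f)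
    (hv : v (f + h₀ ^ 2 + h₀) = exp 1) : Valuation L ℤᵐ⁰ :=
  (h.translate h₀).ramified one_pos odd_one hv

section Valuation

variable (h : IsArtinSchreier F L w f) (hv : v (f + h₀ ^ 2 + h₀) = exp 1)

lemma simplyRamified_le_exp_iff {a b : F} {n : ℤ} :
    h.simplyRamified hv (algebraMap F L a + algebraMap F L b * w) ≤ exp n ↔
      v (a - b * h₀) ≤ exp (n / 2) ∧ v b ≤ exp ((n - 1) / 2) := by
  have hcoords : algebraMap F L a + algebraMap F L b * w =
      algebraMap F L (a - b * h₀) + algebraMap F L b * (w + algebraMap F L h₀) := by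
    simp only [map_sub, map_mul]; ring
  rw [hcoords, (h.translate h₀).ramified_le_exp_iff]

lemma exists_simplyRamified_sq_sub_lt_one (hperfect : ∀ c, v c ≤ 1 → ∃ γ, v (γ ^ 2 - c) < 1)
    {z : L} (hz : h.simplyRamified hv z ≤ 1) :
    ∃ γ, h.simplyRamified hv (γ ^ 2 - z) < 1 := by
  obtain ⟨a, b, rfl⟩ := (h.translate h₀).exists_coords z
  rw [← exp_zero, (h.translate h₀).ramified_le_exp_iff] at hz
  obtain ⟨γ, hγ⟩ := hperfect a hz.1
  refine ⟨algebraMap F L γ, ?_⟩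
  have hcoords : algebraMap F L γ ^ 2 -
      (algebraMap F L a + algebraMap F L b * (w + algebraMap F L h₀)) =
        algebraMap F L (γ ^ 2 - a) + algebraMap F L (-b) * (w + algebraMap F L h₀) := by
    simp only [map_sub, map_neg, map_pow]; ring
  rw [hcoords, lt_one_iff_le_exp_neg_one, (h.translate h₀).ramified_le_exp_iff, Valuation.map_neg]
  exact ⟨lt_one_iff_le_exp_neg_one.1 hγ, hz.2⟩

lemma exists_simple_pole_simplyRamified (hperfect : ∀ c, v c ≤ 1 → ∃ γ, v (γ ^ 2 - c) < 1)
    {r h₁ h₂ : F} (hr : v (r + h₁ ^ 2 + h₁) = exp 1) (hrf : v (r + f + h₂ ^ 2 + h₂) = exp 1) :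
    ∃ e, h.simplyRamified hv (algebraMap F L r + e ^ 2 + e) = exp 1 := by
  obtain ⟨γ, hγ, hγ1, hle⟩ := exists_valuation_add_sq_mul_le_one h.two_eq_zero hperfect hr hv
    (valuation_add_eq_exp_one_of_simple_poles h.two_eq_zero hr hv hrf)
  refine ⟨algebraMap F L h₁ + algebraMap F L γ * (w + algebraMap F L h₀), ?_⟩
  have hcoords : algebraMap F L r +
      (algebraMap F L h₁ + algebraMap F L γ * (w + algebraMap F L h₀)) ^ 2 +
      (algebraMap F L h₁ + algebraMap F L γ * (w + algebraMap F L h₀)) =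
      algebraMap F L (r + h₁ ^ 2 + h₁ + γ ^ 2 * (f + h₀ ^ 2 + h₀)) +
        algebraMap F L (γ * (γ + 1)) * (w + algebraMap F L h₀) := by
    have hroot := (h.translate h₀).eq
    simp only [map_add, map_mul, map_pow, map_one] at hroot ⊢
    linear_combination (algebraMap F L γ) ^ 2 * hroot +
      (algebraMap F L h₁ * (algebraMap F L γ * (w + algebraMap F L h₀)) -
        (algebraMap F L γ) ^ 2 * (w + algebraMap F L h₀)) * h.two_eq_zero_right
  rw [hcoords, (h.translate h₀).ramified_coords, map_mul, hγ, hγ1, mul_one, one_pow, one_mul,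
    max_eq_right_iff]
  exact (pow_le_one₀ zero_le hle).trans (by rw [← exp_zero, exp_le_exp]; exact zero_le_one)

end Valuation

section Derivation

variable {k : Type*} [CommRing k] [Algebra k F] [Algebra k L] {D : Derivation k F F}
  {D' : Derivation k L L} {e : ℤ}

lemma hasPoleOfOrder_ramified (h : IsArtinSchreier F L w f) (hv : v f = exp 1)
    (hD : HasPoleOfOrder D v e) (hD' : ∀ a, D' (algebraMap F L a) = algebraMap F L (D a)) :
    HasPoleOfOrder D' (h.ramified one_pos odd_one hv) (2 * e + 2) where
  map_le z hz := by
    obtain ⟨a, b, rfl⟩ := h.exists_coords z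
    rw [← exp_zero, h.ramified_le_exp_iff] at hz
    have ha : v (D a) ≤ exp e := hD.map_le a hz.1
    have hb : v (D b) ≤ exp e := hD.map_le b (hz.2.trans (by rw [← exp_zero, exp_le_exp]; simp))
    have hcoords : D' (algebraMap F L a + algebraMap F L b * w) =
        algebraMap F L (D a + b * D f) + algebraMap F L (D b) * w := by
      simp only [map_add, map_mul, Derivation.leibniz, hD', h.derivation_gen hD', smul_eq_mul]
      ring
    rw [hcoords, h.ramified_le_exp_iff]
    refine ⟨v.map_add_le (ha.trans (by rw [exp_le_exp]; omega)) ?_,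
      hb.trans (by rw [exp_le_exp]; omega)⟩
    calc v (b * D f) ≤ exp (-1) * exp (e + 2) := by
          rw [map_mul, hD.simple_pole hv]; gcongr; exact hz.2
      _ ≤ exp ((2 * e + 2) / 2) := by rw [← exp_add, exp_le_exp]; omega
  exists_uniformizer := by
    obtain ⟨π, hπ, hDπ⟩ := hD.exists_uniformizer
    refine ⟨algebraMap F L π * w, ?_, ?_⟩
    · rw [map_mul, h.ramified_gen, h.ramified_algebraMap, hπ, exp_sq, ← exp_add]; norm_num
    · have hcoords : D' (algebraMap F L π * w) =
          algebraMap F L (π * D f) + algebraMap F L (D π) * w := by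
        simp only [map_mul, Derivation.leibniz, hD', h.derivation_gen hD', smul_eq_mul]
        ring
      rw [hcoords, h.ramified_coords, map_mul, hπ, hDπ, hD.simple_pole hv, ← exp_add, exp_sq,
        exp_sq, ← exp_add, max_eq_left_iff.2 (by rw [exp_le_exp]; omega)]
      congr 1; ring

lemma isInvertibleAt_of_comap (h : IsArtinSchreier F L w f)
    (hD' : ∀ a, D' (algebraMap F L a) = algebraMap F L (D a)) {V : ValuationSubring L}
    (hf : algebraMap F L f ∈ V) (hD : IsInvertibleAt D (V.comap (algebraMap F L))) :
    IsInvertibleAt D' V where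
  map_mem _ hz := h.derivation_mem hD' hD.map_mem hf hz
  exists_valuation_eq_one := by
    obtain ⟨b, hb, hDb⟩ := hD.exists_valuation_eq_one
    exact ⟨algebraMap F L b, hb, by rw [hD', ← valuation_comap_eq_one_iff, hDb]⟩

end Derivation

section PoleSpace

variable {k : Type*} [Field k] [Algebra k F] [Algebra k L] [IsScalarTower k F L]

lemma comap_ring_ne [Algebra.IsAlgebraic F L] (h : IsArtinSchreier F L w f)
    (hv : v (f + h₀ ^ 2 + h₀) = exp 1) {P : Place k L}
    (hP : P.ring ≠ (h.simplyRamified hv).valuationSubring) :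
    (P.comap F).ring ≠ v.valuationSubring :=
  fun hc => hP ((h.translate h₀).eq_ramified one_pos odd_one hv hc)

lemma algebraMap_mem_regularAway [Algebra.IsAlgebraic F L] (h : IsArtinSchreier F L w f)
    (hv : v (f + h₀ ^ 2 + h₀) = exp 1) {a : F} (ha : a ∈ regularAway k v) :
    algebraMap F L a ∈ regularAway k (h.simplyRamified hv) :=
  fun P hP => ha (P.comap F) (h.comap_ring_ne hv hP)

lemma coords_mem_regularAway_iff (h : IsArtinSchreier F L w f) (hf : f ∈ regularAway k v)
    (hv : v (f + h₀ ^ 2 + h₀) = exp 1) {a b : F} :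
    algebraMap F L a + algebraMap F L b * w ∈ regularAway k (h.simplyRamified hv) ↔
      a ∈ regularAway k v ∧ b ∈ regularAway k v := by
  have := h.isAlgebraic
  constructor
  · intro hz
    have hab (P : Place k F) (hP : P.ring ≠ v.valuationSubring) : a ∈ P.ring ∧ b ∈ P.ring := by
      refine h.coords_mem (hf P hP) fun U hU => ?_
      obtain ⟨Q, rfl, rfl⟩ := Place.exists_ring_eq hU
      refine hz Q fun hQ => hP ?_
      rw [← hU, hQ, (h.translate h₀).comap_ramified]
    exact ⟨fun P hP => (hab P hP).1, fun P hP => (hab P hP).2⟩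
  · rintro ⟨ha, hb⟩
    refine add_mem (h.algebraMap_mem_regularAway hv ha)
      (mul_mem (h.algebraMap_mem_regularAway hv hb) fun P hP => ?_)
    exact h.gen_mem_iff.2 (h.algebraMap_mem_regularAway hv hf P hP)

lemma card_poleSpace_simplyRamified (h : IsArtinSchreier F L w f) (hf : f ∈ regularAway k v)
    (hv : v (f + h₀ ^ 2 + h₀) = exp 1) {M : ℤ}
    (happrox : ∀ z, ∃ r ∈ regularAway k v, v (z - r) ≤ exp (M / 2)) :
    Nat.card (poleSpace k (h.simplyRamified hv) M) =
      Nat.card (poleSpace k v ((M - 1) / 2)) * Nat.card (poleSpace k v (M / 2)) := by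
  choose s hs hsv using fun b : F => happrox (b * h₀)
  have hmem {a b : F} : algebraMap F L (a + s b) + algebraMap F L b * w ∈
      poleSpace k (h.simplyRamified hv) M ↔
        b ∈ poleSpace k v ((M - 1) / 2) ∧ a ∈ poleSpace k v (M / 2) := by
    have hle : v (a + s b - b * h₀) ≤ exp (M / 2) ↔ v a ≤ exp (M / 2) := by
      refine ⟨fun ha => ?_, fun ha => ?_⟩
      · simpa using v.map_add_le ha (hsv b)
      · simpa [sub_sub_eq_add_sub] using v.map_sub_le ha (hsv b)
    simp only [mem_poleSpace, h.coords_mem_regularAway_iff hf hv, h.simplyRamified_le_exp_iff,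
      add_mem_cancel_right (hs b), hle]
    tauto
  let φ : poleSpace k v ((M - 1) / 2) × poleSpace k v (M / 2) →
      poleSpace k (h.simplyRamified hv) M := fun p =>
    ⟨algebraMap F L (p.2.1 + s p.1.1) + algebraMap F L p.1.1 * w, hmem.2 ⟨p.1.2, p.2.2⟩⟩
  have hφ : Function.Bijective φ := by
    constructor
    · rintro ⟨⟨b, hb⟩, ⟨a, ha⟩⟩ ⟨⟨b', hb'⟩, ⟨a', ha'⟩⟩ he
      obtain ⟨has, rfl⟩ : a + s b = a' + s b' ∧ b = b' :=
        h.coords_unique (congrArg Subtype.val he)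
      obtain rfl := add_right_cancel has
      rfl
    · rintro ⟨z, hz⟩
      obtain ⟨a, b, rfl⟩ := h.exists_coords z
      rw [← sub_add_cancel a (s b)] at hz
      exact ⟨(⟨b, (hmem.1 hz).1⟩, ⟨a - s b, (hmem.1 hz).2⟩), Subtype.ext (by simp [φ])⟩
  rw [← Nat.card_congr (Equiv.ofBijective φ hφ), Nat.card_prod]

lemma exists_regularAway_simplyRamified_sub_le (h : IsArtinSchreier F L w f)
    (hf : f ∈ regularAway k v) (hv : v (f + h₀ ^ 2 + h₀) = exp 1) {m : ℤ}
    (happrox : ∀ z, ∃ r ∈ regularAway k v, v (z - r) ≤ exp m) (z : L) :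
    ∃ r ∈ regularAway k (h.simplyRamified hv), h.simplyRamified hv (z - r) ≤ exp (2 * m + 1) := by
  obtain ⟨a, b, rfl⟩ := h.exists_coords z
  obtain ⟨s, hs, hsv⟩ := happrox b
  obtain ⟨r, hr, hrv⟩ := happrox (a - (b - s) * h₀)
  refine ⟨_, (h.coords_mem_regularAway_iff hf hv).2 ⟨hr, hs⟩, ?_⟩
  rw [add_sub_add_comm, ← sub_mul, ← map_sub, ← map_sub, h.simplyRamified_le_exp_iff,
    sub_right_comm]
  exact ⟨hrv.trans (by rw [exp_le_exp]; omega), hsv.trans (by rw [exp_le_exp]; omega)⟩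

end PoleSpace

end IsArtinSchreier

/-! ### Towers of Artin–Schreier extensions -/

section Level

variable {K F L : Type*} [Field K] [Field F] [Field L] [Algebra K F] [Algebra K L] [Algebra F L]
  [IsScalarTower K F L] [Algebra (ZMod 2) K] [Algebra (ZMod 2) F] [Algebra (ZMod 2) L]
  [IsScalarTower (ZMod 2) F L]
  {S R R' : Submodule (ZMod 2) K} {D : Derivation (ZMod 2) F F} {D' : Derivation (ZMod 2) L L}
  {v : Valuation F ℤᵐ⁰} {e : ℤ} {g h N : ℕ}

/-- The invariants of the field `F` obtained from `K` by adjoining the roots of `T² + T + r` for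
`r ∈ R`, in a tower of quadratic extensions which are totally ramified at one place, with
valuation `v`, and unramified elsewhere, and in which the rational places split. The elements of
`S` are available for further extensions. The derivation `D` has its only pole at `v`, of order
`e`; the spaces of functions with a pole of order at most `e` and `e + 1` at `v` have dimension
`g` and `h`, and there are `N` rational places. -/
structure IsLevel (S R : Submodule (ZMod 2) K) (D : Derivation (ZMod 2) F F)
    (v : Valuation F ℤᵐ⁰) (e : ℤ) (g h N : ℕ) : Prop where
  hasPoleOfOrder : HasPoleOfOrder D v e
  isInvertibleAt : ∀ P : Place (ZMod 2) F, P.ring ≠ v.valuationSubring → IsInvertibleAt D P.ring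
  perfect : ∀ c, v c ≤ 1 → ∃ γ, v (γ ^ 2 - c) < 1
  exists_simple_pole : ∀ r ∈ S, r ∉ R → ∃ h, v (algebraMap K F r + h ^ 2 + h) = exp 1
  regular : ∀ r ∈ S, algebraMap K F r ∈ regularAway (ZMod 2) v
  card_poleSpace : Nat.card (poleSpace (ZMod 2) v e) = 2 ^ g
  card_poleSpace_succ : Nat.card (poleSpace (ZMod 2) v (e + 1)) = 2 ^ h
  approx : ∀ z, ∃ r ∈ regularAway (ZMod 2) v, v (z - r) ≤ exp (e + 1)
  numRationalPoints_eq : numRationalPoints (ZMod 2) F = N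
  vanish : ∀ P : Place (ZMod 2) F, P.IsRational → ∀ r ∈ S, P.ring.valuation (algebraMap K F r) < 1

namespace IsLevel

theorem step (hl : IsLevel S R D v e g h N) {w : L} {f : K}
    (hAS : IsArtinSchreier F L w (algebraMap K F f))
    (hD : ∀ a, D' (algebraMap F L a) = algebraMap F L (D a)) (hfS : f ∈ S) (hfR : f ∉ R)
    (hRR' : R ≤ R') (hfR' : f ∈ R') :
    ∃ v' : Valuation L ℤᵐ⁰, IsLevel S R' D' v' (2 * e + 2) (g + h) (2 * h) (2 * N) := by
  have := hAS.isAlgebraic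
  obtain ⟨h₀, hv⟩ := hl.exists_simple_pole f hfS hfR
  have hcard {m M : ℤ} (hm : (M - 1) / 2 = m) (hM : M / 2 = e + 1) :
      Nat.card (poleSpace (ZMod 2) (hAS.simplyRamified hv) M) =
        Nat.card (poleSpace (ZMod 2) v m) * 2 ^ h := by
    rw [hAS.card_poleSpace_simplyRamified (hl.regular f hfS) hv (hM ▸ hl.approx), hm, hM,
      hl.card_poleSpace_succ]
  refine ⟨hAS.simplyRamified hv, ?_, ?_, ?_, ?_, ?_, ?_, ?_, ?_, ?_, ?_⟩
  · exact (hAS.translate h₀).hasPoleOfOrder_ramified hv hl.hasPoleOfOrder hD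
  · exact fun P hP => hAS.isInvertibleAt_of_comap hD
      (hAS.algebraMap_mem_regularAway hv (hl.regular f hfS) P hP)
      (hl.isInvertibleAt (P.comap F) (hAS.comap_ring_ne hv hP))
  · exact fun c => hAS.exists_simplyRamified_sq_sub_lt_one hv hl.perfect
  · intro r hr hrR'
    have hrf : r + f ∉ R := fun hmem => hrR' ((add_mem_cancel_right hfR').1 (hRR' hmem))
    obtain ⟨h₁, hh₁⟩ := hl.exists_simple_pole r hr fun hmem => hrR' (hRR' hmem)
    obtain ⟨h₂, hh₂⟩ := hl.exists_simple_pole (r + f) (add_mem hr hfS) hrf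
    rw [IsScalarTower.algebraMap_apply K F L]
    exact hAS.exists_simple_pole_simplyRamified hv hl.perfect hh₁ (by rwa [← map_add])
  · intro r hr
    rw [IsScalarTower.algebraMap_apply K F L]
    exact hAS.algebraMap_mem_regularAway hv (hl.regular r hr)
  · rw [hcard (m := e) (by omega) (by omega), hl.card_poleSpace, pow_add]
  · rw [hcard (m := e + 1) (by omega) (by omega), hl.card_poleSpace_succ, two_mul, pow_add]
  · intro z
    obtain ⟨r, hr, hle⟩ :=
      hAS.exists_regularAway_simplyRamified_sub_le (hl.regular f hfS) hv hl.approx z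
    exact ⟨r, hr, hle.trans (by rw [exp_le_exp]; omega)⟩
  · rw [hAS.numRationalPoints_eq_two_mul fun P hP => hl.vanish P hP f hfS,
      hl.numRationalPoints_eq]
  · intro P hP r hr
    rw [IsScalarTower.algebraMap_apply K F L, ← Place.valuation_comap_lt_one_iff]
    exact hl.vanish _ hP.comap r hr

end IsLevel

end Level

open IsDedekindDomain

lemma valuation_valuationSubring_lt_one_iff {F : Type*} [Field F] {v : Valuation F ℤᵐ⁰} {z : F} :
    v.valuationSubring.valuation z < 1 ↔ v z < 1 :=
  v.isEquiv_valuation_valuationSubring.lt_one_iff_lt_one.symm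

instance Place.isTrivialOn {k F : Type*} [Field k] [Field F] [Algebra k F] (P : Place k F) :
    P.ring.valuation.IsTrivialOn k where
  eq_one c hc := by
    have hle (d : k) : P.ring.valuation (algebraMap k F d) ≤ 1 :=
      (P.ring.valuation_le_one_iff _).2 (P.algebraMap_mem d)
    have hpos : 0 < P.ring.valuation (algebraMap k F c) := by simpa [zero_lt_iff] using hc
    refine (hle c).antisymm ((inv_le_one₀ hpos).1 ?_)
    rw [← map_inv₀, ← map_inv₀]
    exact hle c⁻¹

/-! ### The places of the projective line -/

section RationalFunctions

variable {k : Type*} [Field k] {q : k[X]}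

/-- The normalized valuation of `k(X)` at an irreducible polynomial. -/
noncomputable def adicValuation (hq : Irreducible q) : Valuation (RatFunc k) ℤᵐ⁰ :=
  (HeightOneSpectrum.ofPrime (Ideal.prime_span_singleton_iff.2 hq.prime)).valuation (RatFunc k)

lemma adicValuation_self (hq : Irreducible q) : adicValuation hq (algebraMap _ _ q) = exp (-1) := by
  rw [adicValuation, HeightOneSpectrum.valuation_of_algebraMap]
  exact HeightOneSpectrum.intValuation_singleton _ hq.ne_zero rfl

lemma adicValuation_le_one (hq : Irreducible q) (a : k[X]) :
    adicValuation hq (algebraMap _ _ a) ≤ 1 :=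
  HeightOneSpectrum.valuation_le_one _ a

lemma adicValuation_lt_one_iff (hq : Irreducible q) {a : k[X]} :
    adicValuation hq (algebraMap _ _ a) < 1 ↔ q ∣ a :=
  (HeightOneSpectrum.valuation_lt_one_iff_mem _ a).trans Ideal.mem_span_singleton

lemma adicValuation_eq_one_iff (hq : Irreducible q) {a : k[X]} :
    adicValuation hq (algebraMap _ _ a) = 1 ↔ ¬ q ∣ a :=
  (HeightOneSpectrum.valuation_eq_one_iff_notMem _).trans Ideal.mem_span_singleton.not

lemma exists_valuation_sub_polynomial_lt_one (hq : Irreducible q) {a : RatFunc k}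
    (ha : adicValuation hq a ≤ 1) :
    ∃ b : k[X], adicValuation hq (a - algebraMap _ _ b) < 1 := by
  obtain ⟨b, hb⟩ := HeightOneSpectrum.exists_valuation_sub_lt_of_integer _ ha 1
  exact ⟨b, by rwa [Valuation.map_sub_swap]⟩

lemma exists_polynomial_of_adicValuation_le_one {a : RatFunc k}
    (ha : ∀ (q : k[X]) (hq : Irreducible q), adicValuation hq a ≤ 1) :
    ∃ b : k[X], algebraMap _ _ b = a := by
  refine HeightOneSpectrum.mem_integers_of_valuation_le_one _ a fun P => ?_
  obtain ⟨q, hq⟩ := IsPrincipalIdealRing.principal P.asIdeal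
  have hprime : Prime (Ideal.span {q}) := by
    rw [← Ideal.submodule_span_eq, ← hq]
    exact P.prime
  have hP : P = HeightOneSpectrum.ofPrime hprime := HeightOneSpectrum.ext hq
  rw [hP]
  exact ha q (Ideal.prime_span_singleton_iff.1 hprime).irreducible

lemma adicValuation_valuationSubring_ne_top (hq : Irreducible q) :
    (adicValuation hq).valuationSubring ≠ ⊤ := by
  intro htop
  have hmem : (algebraMap _ _ q)⁻¹ ∈ (adicValuation hq).valuationSubring :=
    htop ▸ ValuationSubring.mem_top _
  rw [Valuation.mem_valuationSubring_iff, map_inv₀, adicValuation_self, ← exp_neg, ← exp_zero,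
    exp_le_exp] at hmem
  exact absurd hmem (by decide)

/-- The place of the projective line at an irreducible polynomial. -/
noncomputable def adicPlace (hq : Irreducible q) : Place k (RatFunc k) where
  ring := (adicValuation hq).valuationSubring
  algebraMap_mem c := by
    rw [IsScalarTower.algebraMap_apply k k[X] (RatFunc k)]
    exact adicValuation_le_one hq _
  ne_top := adicValuation_valuationSubring_ne_top hq

lemma adicPlace_lt_one_iff (hq : Irreducible q) {a : k[X]} :
    (adicPlace hq).ring.valuation (algebraMap _ _ a) < 1 ↔ q ∣ a :=
  valuation_valuationSubring_lt_one_iff.trans (adicValuation_lt_one_iff hq)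

namespace Place

variable {P : Place k (RatFunc k)}

lemma algebraMap_polynomial_mem (hX : algebraMap k[X] (RatFunc k) X ∈ P.ring) (a : k[X]) :
    algebraMap k[X] (RatFunc k) a ∈ P.ring :=
  (P.ring.valuation_le_one_iff _).1 <|
    valuation_le_one_of_valuation_X_le_one _
      ((P.ring.valuation_le_one_iff _).2 (RatFunc.algebraMap_X (K := k) ▸ hX)) a

lemma valuation_eq_one_of_isCoprime (hX : algebraMap k[X] (RatFunc k) X ∈ P.ring) {a b : k[X]}
    (hab : IsCoprime a b) (ha : P.ring.valuation (algebraMap _ _ a) < 1) :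
    P.ring.valuation (algebraMap _ _ b) = 1 := by
  have hlt {c d : k[X]} (hd : P.ring.valuation (algebraMap _ _ d) < 1) :
      P.ring.valuation (algebraMap _ _ (c * d)) < 1 := by
    rw [map_mul, map_mul]
    exact mul_lt_one_of_nonneg_of_lt_one_right
      ((P.ring.valuation_le_one_iff _).2 (algebraMap_polynomial_mem hX c)) zero_le hd
  obtain ⟨s, t, hst⟩ := hab
  refine ((P.ring.valuation_le_one_iff _).2 (algebraMap_polynomial_mem hX b)).antisymm ?_
  by_contra! hb
  have hsum := P.ring.valuation.map_add_lt (hlt (c := s) ha) (hlt (c := t) hb)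
  rw [← map_add, hst, map_one, map_one] at hsum
  exact lt_irrefl _ hsum

lemma valuation_denom_eq_one (hX : algebraMap k[X] (RatFunc k) X ∈ P.ring) {z : RatFunc k}
    (hz : z ∈ P.ring) : P.ring.valuation (algebraMap _ _ z.denom) = 1 := by
  refine ((P.ring.valuation_le_one_iff _).2 (algebraMap_polynomial_mem hX _)).antisymm ?_
  by_contra! hlt
  have hnum := valuation_eq_one_of_isCoprime hX z.isCoprime_num_denom.symm hlt
  rw [(div_eq_iff (by simpa using z.denom_ne_zero)).1 z.num_div_denom, map_mul] at hnum
  exact (mul_lt_one_of_nonneg_of_lt_one_right ((P.ring.valuation_le_one_iff _).2 hz) zero_le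
    hlt).ne hnum

lemma eq_adicPlace (hq : Irreducible q) (hX : algebraMap k[X] (RatFunc k) X ∈ P.ring)
    (hP : P.ring.valuation (algebraMap _ _ q) < 1) : P = adicPlace hq := by
  refine ext_ring (valuationSubring_eq_of_le_of_ne_top (fun z hz => ?_) P.ne_top).symm
  obtain ⟨n, ⟨d, hd⟩, hnd⟩ := HeightOneSpectrum.exists_primeCompl_mul_eq_of_integer _ z hz
  have hqd : IsCoprime q d :=
    hq.coprime_iff_not_dvd.2 fun hdvd => hd (Ideal.mem_span_singleton.2 hdvd)
  rw [← mul_mem_iff_of_valuation_eq_one (valuation_eq_one_of_isCoprime hX hqd hP)]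
  exact hnd ▸ algebraMap_polynomial_mem hX n

end Place

/-- The place of the projective line at a rational point different from infinity. -/
noncomputable def pointPlace (c : k) : Place k (RatFunc k) :=
  adicPlace (irreducible_X_sub_C c)

lemma pointPlace_lt_one_iff {c : k} {a : k[X]} :
    (pointPlace c).ring.valuation (algebraMap _ _ a) < 1 ↔ a.eval c = 0 := by
  rw [pointPlace, adicPlace_lt_one_iff, dvd_iff_isRoot, IsRoot.def]

lemma X_mem_pointPlace (c : k) : algebraMap k[X] (RatFunc k) X ∈ (pointPlace c).ring :=
  adicValuation_le_one _ X

lemma pointPlace_injective : Function.Injective (pointPlace : k → Place k (RatFunc k)) := by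
  intro c d hcd
  have hd : (pointPlace d).ring.valuation (algebraMap _ _ (X - C c)) < 1 :=
    hcd ▸ pointPlace_lt_one_iff.2 (by simp)
  simpa [sub_eq_zero, eq_comm] using pointPlace_lt_one_iff.1 hd

lemma isRational_pointPlace (c : k) : (pointPlace c).IsRational := by
  intro a ha
  obtain ⟨b, hb⟩ := exists_valuation_sub_polynomial_lt_one (irreducible_X_sub_C c) ha
  refine ⟨b.eval c, ?_⟩
  have hbc : (pointPlace c).ring.valuation (algebraMap _ _ (b - C (b.eval c))) < 1 :=
    pointPlace_lt_one_iff.2 (by simp)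
  have hsum := Valuation.map_add_lt _ (valuation_valuationSubring_lt_one_iff.2 hb) hbc
  rwa [map_sub, sub_add_sub_cancel] at hsum

lemma Place.IsRational.exists_pointPlace_eq {P : Place k (RatFunc k)} (hP : P.IsRational)
    (hX : algebraMap k[X] (RatFunc k) X ∈ P.ring) : ∃ c, pointPlace c = P := by
  obtain ⟨c, hc⟩ := hP _ hX
  refine ⟨c, (eq_adicPlace (irreducible_X_sub_C c) hX ?_).symm⟩
  rwa [map_sub]

open scoped Classical in
/-- The normalized valuation of `k(X)` at infinity. It is Mathlib's `RatFunc.inftyValuation`, with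
the decidability of equality chosen classically. -/
noncomputable def infinityValuation (k : Type*) [Field k] : Valuation (RatFunc k) ℤᵐ⁰ :=
  RatFunc.inftyValuation k

lemma infinityValuation_polynomial {a : k[X]} (ha : a ≠ 0) :
    infinityValuation k (algebraMap _ _ a) = exp (a.natDegree : ℤ) := by
  classical exact RatFunc.inftyValuation.polynomial k ha

lemma infinityValuation_div_le {a d : k[X]} {n : ℤ} (hd : d ≠ 0)
    (ha : a.natDegree ≤ n + d.natDegree) :
    infinityValuation k (algebraMap _ _ a / algebraMap _ _ d) ≤ exp n := by
  obtain rfl | ha0 := eq_or_ne a 0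
  · simp
  · rw [map_div₀, infinityValuation_polynomial ha0, infinityValuation_polynomial hd, ← exp_sub,
      exp_le_exp]
    omega

lemma infinityValuation_num_eq (a : RatFunc k) :
    infinityValuation k (algebraMap _ _ a.num) =
      infinityValuation k a * infinityValuation k (algebraMap _ _ a.denom) := by
  rw [← map_mul]
  congr 1
  exact (div_eq_iff (by simpa using a.denom_ne_zero)).1 a.num_div_denom

lemma Place.ring_eq_infinity {P : Place k (RatFunc k)}
    (hX : algebraMap k[X] (RatFunc k) X ∉ P.ring) :
    P.ring = (infinityValuation k).valuationSubring := by
  classical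
  have hlt : 1 < P.ring.valuation (RatFunc.X : RatFunc k) := by
    rwa [RatFunc.algebraMap_X, ← P.ring.valuation_le_one_iff, not_le] at hX
  have hequiv := (Valuation.isEquiv_iff_valuationSubring _ _).1
    (RatFunc.valuation_isEquiv_inftyValuation_of_one_lt_valuation_X hlt)
  rw [P.ring.valuationSubring_valuation] at hequiv
  rw [hequiv, infinityValuation]

/-- The constant is the quotient of the leading coefficients, or zero. -/
lemma exists_infinityValuation_sub_lt_one {a : RatFunc k} (ha : infinityValuation k a ≤ 1) :
    ∃ c : k, infinityValuation k (a - algebraMap k (RatFunc k) c) < 1 := by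
  obtain hlt | h1 := ha.lt_or_eq
  · exact ⟨0, by simpa using hlt⟩
  have hd := a.denom_ne_zero
  have hd' : algebraMap k[X] (RatFunc k) a.denom ≠ 0 := by simpa using hd
  have hn : a.num ≠ 0 := fun h0 => by simp [RatFunc.num_eq_zero_iff.1 h0] at h1
  have hdeg : a.num.natDegree = a.denom.natDegree := by
    have heq := infinityValuation_num_eq a
    rw [h1, one_mul, infinityValuation_polynomial hn, infinityValuation_polynomial hd] at heq
    exact_mod_cast exp_injective heq
  set c := a.num.leadingCoeff / a.denom.leadingCoeff
  have hc : c ≠ 0 := div_ne_zero (leadingCoeff_ne_zero.2 hn) (leadingCoeff_ne_zero.2 hd)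
  have hsub : a - algebraMap k (RatFunc k) c =
      algebraMap _ _ (a.num - C c * a.denom) / algebraMap _ _ a.denom := by
    rw [map_sub, map_mul, sub_div, mul_div_cancel_right₀ _ hd', a.num_div_denom]
    rfl
  refine ⟨c, ?_⟩
  rw [hsub, map_div₀, infinityValuation_polynomial hd, div_lt_one₀ exp_pos]
  obtain h0 | h0 := eq_or_ne (a.num - C c * a.denom) 0
  · rw [h0, map_zero, map_zero]; exact exp_pos
  · rw [infinityValuation_polynomial h0, exp_lt_exp, ← hdeg, Nat.cast_lt]
    refine natDegree_lt_natDegree h0 (degree_sub_lt_left ?_ hn ?_)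
    · rw [degree_C_mul hc, degree_eq_natDegree hn, degree_eq_natDegree hd, hdeg]
    · rw [leadingCoeff_mul, leadingCoeff_C, div_mul_cancel₀ _ (leadingCoeff_ne_zero.2 hd)]

lemma infinityValuation_derivative_le (a : k[X]) :
    infinityValuation k (algebraMap _ _ (derivative a)) ≤
      infinityValuation k (algebraMap _ _ a) * exp (-1) := by
  obtain h0 | h0 := eq_or_ne (derivative a) 0
  · rw [h0, map_zero, map_zero]; exact zero_le
  have ha : a ≠ 0 := by rintro rfl; simp at h0
  have hlt := natDegree_derivative_lt fun hdeg => h0 (derivative_of_natDegree_zero hdeg)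
  rw [infinityValuation_polynomial h0, infinityValuation_polynomial ha, ← exp_add, exp_le_exp]
  omega

section Derivation

variable {D : Derivation k (RatFunc k) (RatFunc k)}

lemma derivation_mul_denom (hD : ∀ a : k[X], D (algebraMap _ _ a) = algebraMap _ _ (derivative a))
    (a : RatFunc k) :
    D a * algebraMap _ _ a.denom =
      algebraMap _ _ (derivative a.num) - a * algebraMap _ _ (derivative a.denom) := by
  have hnum : algebraMap k[X] (RatFunc k) a.num = a * algebraMap _ _ a.denom :=
    (div_eq_iff (by simpa using a.denom_ne_zero)).1 a.num_div_denom
  rw [← hD, ← hD, hnum, D.leibniz, smul_eq_mul, smul_eq_mul]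
  ring

lemma infinityValuation_derivation_le
    (hD : ∀ a : k[X], D (algebraMap _ _ a) = algebraMap _ _ (derivative a)) (a : RatFunc k) :
    infinityValuation k (D a) ≤ infinityValuation k a * exp (-1) := by
  have hd : 0 < infinityValuation k (algebraMap _ _ a.denom) := by
    simpa [zero_lt_iff] using a.denom_ne_zero
  refine le_of_mul_le_mul_right ?_ hd
  rw [← map_mul, derivation_mul_denom hD]
  refine (infinityValuation k).map_sub_le ?_ ?_
  · rw [mul_right_comm, ← infinityValuation_num_eq]
    exact infinityValuation_derivative_le _
  · rw [map_mul, mul_assoc, mul_comm (exp (-1))]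
    exact mul_le_mul_right (infinityValuation_derivative_le _) _

lemma Place.derivation_mem {P : Place k (RatFunc k)}
    (hD : ∀ a : k[X], D (algebraMap _ _ a) = algebraMap _ _ (derivative a))
    (hX : algebraMap k[X] (RatFunc k) X ∈ P.ring) {z : RatFunc k} (hz : z ∈ P.ring) :
    D z ∈ P.ring := by
  rw [← mul_mem_iff_of_valuation_eq_one (valuation_denom_eq_one hX hz), derivation_mul_denom hD]
  exact sub_mem (algebraMap_polynomial_mem hX _)
    (P.ring.mul_mem _ _ hz (algebraMap_polynomial_mem hX _))

end Derivation

end RationalFunctions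

namespace IsArtinSchreier

variable {F L : Type*} [Field F] [Field L] [Algebra F L] {w : L} {f : F}

lemma exists_valuation_algebraMap_eq (h : IsArtinSchreier F L w f) {V : ValuationSubring L}
    (hw : w ∈ V) (z : L) : ∃ s : F, V.valuation (algebraMap F L s) = V.valuation z := by
  obtain ⟨a, b, rfl⟩ := h.exists_coords z
  have hbw : V.valuation (algebraMap F L b * w) ≤ V.valuation (algebraMap F L b) := by
    rw [map_mul]
    exact mul_le_of_le_one_right' ((V.valuation_le_one_iff _).2 hw)
  obtain hlt | hle := lt_or_ge (V.valuation (algebraMap F L b)) (V.valuation (algebraMap F L a))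
  · exact ⟨a, (Valuation.map_add_eq_of_lt_left _ (hbw.trans_lt hlt)).symm⟩
  obtain hlt | heq := (V.valuation.map_add_le hle hbw).lt_or_eq
  swap
  · exact ⟨b, heq.symm⟩
  -- Now `z` is smaller than `b`, so that the conjugate `z + b` has the value of `b`.
  have hb0 : algebraMap F L b ≠ 0 := fun h0 => by simp [h0] at hlt
  refine ⟨(a ^ 2 + a * b + b ^ 2 * f) / b, ?_⟩
  have hnorm : algebraMap F L ((a ^ 2 + a * b + b ^ 2 * f) / b) * algebraMap F L b =
      (algebraMap F L a + algebraMap F L b * w) *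
        (algebraMap F L a + algebraMap F L b * w + algebraMap F L b) := by
    rw [map_div₀, div_mul_cancel₀ _ hb0]
    simp only [map_add, map_mul, map_pow, ← h.eq]
    linear_combination (-algebraMap F L a * algebraMap F L b * w) * h.two_eq_zero_right
  have hVb0 : V.valuation (algebraMap F L b) ≠ 0 := (Valuation.ne_zero_iff _).2 hb0
  refine mul_right_cancel₀ hVb0 ?_
  rw [← map_mul, hnorm, map_mul, Valuation.map_add_eq_of_lt_right _ hlt]

/-- The values of `V` on `L` are attained on `F`, where they are measured by `v`. -/
lemma exists_unramified (h : IsArtinSchreier F L w f) {v : Valuation F ℤᵐ⁰}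
    {V : ValuationSubring L} (hV : V.comap (algebraMap F L) = v.valuationSubring) (hw : w ∈ V) :
    ∃ v' : Valuation L ℤᵐ⁰, v'.valuationSubring = V ∧ ∀ a, v' (algebraMap F L a) = v a := by
  have hmem (a : F) : V.valuation (algebraMap F L a) ≤ 1 ↔ v a ≤ 1 := by
    rw [V.valuation_le_one_iff, ← ValuationSubring.mem_comap, hV, v.mem_valuationSubring_iff]
  have hle (a b : F) : V.valuation (algebraMap F L a) ≤ V.valuation (algebraMap F L b) ↔
      v a ≤ v b := by
    obtain rfl | hb := eq_or_ne b 0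
    · simp
    have hVb : 0 < V.valuation (algebraMap F L b) := by simpa [zero_lt_iff] using hb
    have hvb : 0 < v b := by simpa [zero_lt_iff] using hb
    rw [← div_le_one₀ hVb, ← div_le_one₀ hvb, ← map_div₀, ← map_div₀, ← map_div₀, hmem]
  choose s hs using h.exists_valuation_algebraMap_eq hw
  have hcongr {a b : F} (hab : V.valuation (algebraMap F L a) = V.valuation (algebraMap F L b)) :
      v a = v b := le_antisymm ((hle a b).1 hab.le) ((hle b a).1 hab.ge)
  let v' : Valuation L ℤᵐ⁰ :=
    { toFun z := v (s z)
      map_zero' := by rw [← map_zero v]; exact hcongr (by simp [hs])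
      map_one' := by rw [← map_one v]; exact hcongr (by simp [hs])
      map_mul' z z' := by rw [← map_mul]; exact hcongr (by simp [hs])
      map_add_le_max' z z' := by
        rw [le_max_iff, ← hle, ← hle, hs, hs, hs, ← le_max_iff]
        exact V.valuation.map_add z z' }
  refine ⟨v', ?_, fun a => hcongr (hs _)⟩
  ext z
  rw [v'.mem_valuationSubring_iff, ← V.valuation_le_one_iff, ← hs z, hmem]
  rfl

end IsArtinSchreier

/-! ### The curve `y² + y = p(x)` -/

section QuadraticExtension

variable {k L : Type*} [Field k] [Field L] [Algebra k[X] L] [Algebra (RatFunc k) L]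
  [IsScalarTower k[X] (RatFunc k) L] {y : L} {p q B : k[X]} {v : Valuation L ℤᵐ⁰}

lemma algebraMap_polynomial_ne_zero {a : k[X]} (ha : a ≠ 0) : algebraMap k[X] L a ≠ 0 := by
  rw [IsScalarTower.algebraMap_apply k[X] (RatFunc k) L]
  simpa using ha

omit [Algebra k[X] L] [IsScalarTower k[X] (RatFunc k) L] in
lemma IsArtinSchreier.two_eq_zero_polynomial
    (h : IsArtinSchreier (RatFunc k) L y (algebraMap _ _ p)) : (2 : k[X]) = 0 :=
  FaithfulSMul.algebraMap_injective k[X] (RatFunc k) (by rw [map_ofNat, h.two_eq_zero, map_zero])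

lemma IsArtinSchreier.root_mul_conj
    (h : IsArtinSchreier (RatFunc k) L y (algebraMap _ _ p)) (B : k[X]) :
    (y + algebraMap _ L B) * (y + algebraMap _ L B + 1) = algebraMap _ L (p + B ^ 2 + B) := by
  have heq := h.eq
  rw [← IsScalarTower.algebraMap_apply] at heq
  simp only [map_add, map_pow, ← heq]
  linear_combination (y * algebraMap _ L B) * h.two_eq_zero_right

/-- The function `y` on the curve `y² + y = p(x)` is congruent to `-B(x)` at the place of `v`, which
lies above the place `q` of the `x`-line and is unramified over it. -/
structure IsValuationAt (hq : Irreducible q) (B : k[X]) (y : L) (v : Valuation L ℤᵐ⁰) : Prop where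
  map_algebraMap : ∀ a : RatFunc k, v (algebraMap _ L a) = adicValuation hq a
  map_root_lt_one : v (y + algebraMap _ L B) < 1

namespace IsValuationAt

variable {hq : Irreducible q}

lemma map_polynomial (hv : IsValuationAt hq B y v) (a : k[X]) :
    v (algebraMap _ L a) = adicValuation hq (algebraMap _ _ a) := by
  rw [IsScalarTower.algebraMap_apply k[X] (RatFunc k) L, hv.map_algebraMap]

omit [IsScalarTower k[X] (RatFunc k) L] in
lemma comap_valuationSubring (hv : IsValuationAt hq B y v) :
    v.valuationSubring.comap (algebraMap (RatFunc k) L) = (adicPlace hq).ring := by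
  ext a
  rw [ValuationSubring.mem_comap, v.mem_valuationSubring_iff, hv.map_algebraMap]
  rfl

lemma polynomial_le_one (hv : IsValuationAt hq B y v) (a : k[X]) : v (algebraMap _ L a) ≤ 1 := by
  rw [hv.map_polynomial]
  exact adicValuation_le_one hq a

lemma polynomial_lt_one_iff (hv : IsValuationAt hq B y v) {a : k[X]} :
    v (algebraMap _ L a) < 1 ↔ q ∣ a := by
  rw [hv.map_polynomial, adicValuation_lt_one_iff]

lemma polynomial_eq_one (hv : IsValuationAt hq B y v) {a : k[X]} (ha : a ≠ 0)
    (hdeg : a.natDegree < q.natDegree) : v (algebraMap _ L a) = 1 := by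
  rw [hv.map_polynomial, adicValuation_eq_one_iff]
  exact fun hdvd => hdeg.not_ge (natDegree_le_of_dvd hdvd ha)

lemma uniformizer (hv : IsValuationAt hq B y v) : v (algebraMap _ L q) = exp (-1) := by
  rw [hv.map_polynomial, adicValuation_self]

lemma root_lt_one (hv : IsValuationAt hq B y v) {C : k[X]} (hC : q ∣ C - B) :
    v (y + algebraMap _ L C) < 1 := by
  have hsplit : y + algebraMap _ L C = y + algebraMap _ L B + algebraMap _ L (C - B) := by
    rw [map_sub]; ring
  rw [hsplit]
  exact v.map_add_lt hv.map_root_lt_one (hv.polynomial_lt_one_iff.2 hC)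

lemma root_le (hv : IsValuationAt hq B y v)
    (h : IsArtinSchreier (RatFunc k) L y (algebraMap _ _ p)) {C e : k[X]} {m : ℕ}
    (hC : q ∣ C - B) (he : p + C ^ 2 + C = q ^ m * e) :
    v (y + algebraMap _ L C) ≤ exp (-m : ℤ) := by
  have hconj : v (y + algebraMap _ L C + 1) = 1 := by
    rw [add_comm]
    exact v.map_one_add_of_lt (hv.root_lt_one hC)
  have hmul := congrArg v (h.root_mul_conj C)
  rw [map_mul, hconj, mul_one, he, map_mul, map_mul, map_pow, map_pow, hv.uniformizer,
    ← exp_nsmul] at hmul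
  rw [hmul]
  simpa using mul_le_of_le_one_right' (a := exp (m • (-1 : ℤ))) (hv.polynomial_le_one e)

lemma exists_polynomial_sub_lt_one (hv : IsValuationAt hq B y v)
    (h : IsArtinSchreier (RatFunc k) L y (algebraMap _ _ p)) {z : L} (hz : v z ≤ 1) :
    ∃ b : k[X], b.natDegree < q.natDegree ∧ v (z - algebraMap _ L b) < 1 := by
  have hw : v.valuationSubring.valuation (y + algebraMap (RatFunc k) L (algebraMap _ _ B)) < 1 := by
    rw [valuation_valuationSubring_lt_one_iff, ← IsScalarTower.algebraMap_apply]
    exact hv.map_root_lt_one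
  obtain ⟨a, ha⟩ := (h.translate (algebraMap _ _ B)).exists_valuation_sub_lt_one hw hz
  rw [valuation_valuationSubring_lt_one_iff] at ha
  have hale : adicValuation hq a ≤ 1 := by
    rw [← hv.map_algebraMap, ← sub_sub_cancel z (algebraMap _ L a)]
    exact v.map_sub_le hz ha.le
  obtain ⟨b, hb⟩ := exists_valuation_sub_polynomial_lt_one hq hale
  rw [← hv.map_algebraMap, map_sub, ← IsScalarTower.algebraMap_apply] at hb
  refine ⟨b % q, natDegree_mod_lt b hq.natDegree_pos.ne', ?_⟩
  have hmod : v (algebraMap _ L (b - b % q)) < 1 :=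
    hv.polynomial_lt_one_iff.2 ⟨b / q, by
      rw [sub_eq_iff_eq_add, EuclideanDomain.div_add_mod]⟩
  have hsum := v.map_add_lt (v.map_add_lt ha hb) hmod
  rwa [map_sub, sub_add_sub_cancel, sub_add_sub_cancel] at hsum

end IsValuationAt

section Place

variable [Algebra k L] [IsScalarTower k (RatFunc k) L] [Algebra.IsAlgebraic (RatFunc k) L]
  {P : Place k L}

namespace Place

lemma X_mem_comap_iff : algebraMap k[X] (RatFunc k) X ∈ (P.comap (RatFunc k)).ring ↔
    algebraMap k[X] L X ∈ P.ring := by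
  rw [mem_comap_ring, ← IsScalarTower.algebraMap_apply]

lemma polynomial_mem (hX : algebraMap k[X] L X ∈ P.ring) (a : k[X]) :
    algebraMap k[X] L a ∈ P.ring := by
  rw [IsScalarTower.algebraMap_apply k[X] (RatFunc k) L, ← mem_comap_ring]
  exact algebraMap_polynomial_mem (X_mem_comap_iff.2 hX) a

lemma comap_eq_adicPlace (hq : Irreducible q) (hX : algebraMap k[X] L X ∈ P.ring)
    (hP : P.ring.valuation (algebraMap _ L q) < 1) : P.comap (RatFunc k) = adicPlace hq := by
  refine eq_adicPlace hq (X_mem_comap_iff.2 hX) ?_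
  rwa [valuation_comap_lt_one_iff, ← IsScalarTower.algebraMap_apply]

end Place

lemma IsArtinSchreier.gen_mem_of_X_mem (h : IsArtinSchreier (RatFunc k) L y (algebraMap _ _ p))
    (hX : algebraMap k[X] L X ∈ P.ring) : y ∈ P.ring := by
  rw [h.gen_mem_iff, ← IsScalarTower.algebraMap_apply]
  exact Place.polynomial_mem hX p

lemma IsArtinSchreier.exists_isValuationAt
    (h : IsArtinSchreier (RatFunc k) L y (algebraMap _ _ p)) (hq : Irreducible q)
    (hB : q ∣ p + B ^ 2 + B) : ∃ v, IsValuationAt hq B y v := by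
  have hlt : (adicPlace hq).ring.valuation (algebraMap k[X] (RatFunc k) p +
      algebraMap _ _ B ^ 2 + algebraMap _ _ B) < 1 := by
    rw [← map_pow, ← map_add, ← map_add, adicPlace_lt_one_iff]
    exact hB
  have hB' := h.translate (algebraMap _ _ B)
  obtain ⟨Q, hQ, hroot⟩ := hB'.exists_place_comap_eq_and_lt_one hlt
  obtain ⟨v, hv, hmap⟩ := hB'.exists_unramified (congrArg Place.ring hQ)
    (mem_of_valuation_lt_one hroot)
  refine ⟨v, hmap, ?_⟩
  rwa [← valuation_valuationSubring_lt_one_iff, hv, IsScalarTower.algebraMap_apply k[X] (RatFunc k)]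

namespace IsValuationAt

variable {hq : Irreducible q}

lemma ring_eq (hv : IsValuationAt hq B y v)
    (h : IsArtinSchreier (RatFunc k) L y (algebraMap _ _ p))
    (hX : algebraMap k[X] L X ∈ P.ring) (hP : P.ring.valuation (algebraMap _ L q) < 1) {C : k[X]}
    (hC : q ∣ C - B) (hroot : P.ring.valuation (y + algebraMap _ L C) < 1) :
    P.ring = v.valuationSubring := by
  refine (h.translate (algebraMap _ _ C)).eq_of_comap_eq ?_ ?_ ?_
  · rw [hv.comap_valuationSubring, ← Place.comap_eq_adicPlace hq hX hP]
    rfl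
  · rwa [← IsScalarTower.algebraMap_apply]
  · rw [valuation_valuationSubring_lt_one_iff, ← IsScalarTower.algebraMap_apply]
    exact hv.root_lt_one hC

/-- Where `q` vanishes, the numerator is a multiple of `q ^ m` divided by the unit `y + C`. -/
lemma conj_div_pow_mem (hv : IsValuationAt hq B y v)
    (h : IsArtinSchreier (RatFunc k) L y (algebraMap _ _ p))
    (hX : algebraMap k[X] L X ∈ P.ring) (hP : P.ring ≠ v.valuationSubring) {C e : k[X]} {m : ℕ}
    (hC : q ∣ C - B) (he : p + C ^ 2 + C = q ^ m * e) :
    (y + algebraMap _ L C + 1) / algebraMap _ L q ^ m ∈ P.ring := by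
  have hq0 : algebraMap k[X] L q ≠ 0 := algebraMap_polynomial_ne_zero hq.ne_zero
  have hmem : y + algebraMap _ L C ∈ P.ring :=
    add_mem (h.gen_mem_of_X_mem hX) (Place.polynomial_mem hX C)
  obtain hlt | hge := lt_or_ge (P.ring.valuation (algebraMap _ L q)) 1
  · have hunit : P.ring.valuation (y + algebraMap _ L C) = 1 :=
      ((P.ring.valuation_le_one_iff _).2 hmem).antisymm <| le_of_not_gt fun hroot =>
        hP (hv.ring_eq h hX hlt hC hroot)
    have hmul : (y + algebraMap _ L C + 1) / algebraMap _ L q ^ m * (y + algebraMap _ L C) =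
        algebraMap _ L e := by
      rw [div_mul_eq_mul_div, mul_comm, h.root_mul_conj, he, map_mul, map_pow,
        mul_div_cancel_left₀ _ (pow_ne_zero m hq0)]
    rw [← mul_mem_iff_of_valuation_eq_one hunit, hmul]
    exact Place.polynomial_mem hX e
  · have hunit : P.ring.valuation (algebraMap _ L q ^ m) = 1 := by
      rw [map_pow, ((P.ring.valuation_le_one_iff _).2 (Place.polynomial_mem hX q)).antisymm hge,
        one_pow]
    rw [← mul_mem_iff_of_valuation_eq_one hunit, div_mul_cancel₀ _ (pow_ne_zero m hq0)]
    exact add_mem hmem P.ring.one_mem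

end IsValuationAt

end Place

end QuadraticExtension

section Infinity

variable {k L : Type*} [Field k] [Field L] [Algebra (RatFunc k) L] {y : L} {p : k[X]}

lemma infinityValuation_C_le_one (c : k) : infinityValuation k (algebraMap k[X] _ (C c)) ≤ 1 := by
  obtain rfl | hc := eq_or_ne c 0
  · simp
  · rw [infinityValuation_polynomial (by simpa using hc), natDegree_C, Nat.cast_zero, exp_zero]

namespace IsArtinSchreier

/-- The normalized valuation at infinity of the curve `y² + y = p(x)` with `p` of odd degree, where
infinity is ramified over the `x`-line. -/
noncomputable def infinityExtension (h : IsArtinSchreier (RatFunc k) L y (algebraMap _ _ p))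
    (hp : Odd p.natDegree) : Valuation L ℤᵐ⁰ :=
  h.ramified (v := infinityValuation k) (c := p.natDegree) (mod_cast hp.pos) (mod_cast hp)
    (infinityValuation_polynomial (by rintro rfl; simp at hp))

variable (h : IsArtinSchreier (RatFunc k) L y (algebraMap _ _ p)) (hp : Odd p.natDegree)

lemma infinityExtension_le_exp_iff {a b : RatFunc k} {n : ℤ} :
    h.infinityExtension hp (algebraMap _ L a + algebraMap _ L b * y) ≤ exp n ↔
      infinityValuation k a ≤ exp (n / 2) ∧ infinityValuation k b ≤ exp ((n - p.natDegree) / 2) :=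
  h.ramified_le_exp_iff _ _ _

variable [Algebra k[X] L] [IsScalarTower k[X] (RatFunc k) L]

lemma infinityExtension_div_le_one_iff {a b d : k[X]} (hd : d ≠ 0) :
    h.infinityExtension hp ((algebraMap _ L a + algebraMap _ L b * y) / algebraMap _ L d) ≤ 1 ↔
      a.natDegree ≤ d.natDegree ∧ (b = 0 ∨ 2 * b.natDegree + p.natDegree ≤ 2 * d.natDegree) := by
  have hsplit : (algebraMap _ L a + algebraMap _ L b * y) / algebraMap k[X] L d =
      algebraMap _ L (algebraMap _ (RatFunc k) a / algebraMap _ (RatFunc k) d) +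
        algebraMap _ L (algebraMap _ (RatFunc k) b / algebraMap _ (RatFunc k) d) * y := by
    simp only [map_div₀, ← IsScalarTower.algebraMap_apply]
    ring
  have hle {a : k[X]} {n : ℤ} :
      infinityValuation k (algebraMap _ _ a / algebraMap _ _ d) ≤ exp n ↔
        a = 0 ∨ (a.natDegree : ℤ) ≤ n + d.natDegree := by
    obtain rfl | ha := eq_or_ne a 0
    · simp
    · simp [ha, infinityValuation_polynomial, hd, ← exp_sub]
  rw [hsplit, ← exp_zero, h.infinityExtension_le_exp_iff, hle, hle]
  obtain ⟨j, hj⟩ := hp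
  refine and_congr ⟨?_, fun ha => Or.inr (by omega)⟩ (or_congr Iff.rfl (by omega))
  rintro (rfl | ha)
  · simp
  · omega

lemma X_notMem_infinityExtension :
    algebraMap k[X] L X ∉ (h.infinityExtension hp).valuationSubring := by
  have hle := h.infinityExtension_div_le_one_iff hp (a := X) (b := 0) (d := 1) one_ne_zero
  simpa using hle

variable [Algebra k L] [IsScalarTower k (RatFunc k) L]

/-- The place at infinity of the curve `y² + y = p(x)` with `p` of odd degree. -/
noncomputable def infinityPlace : Place k L where
  ring := (h.infinityExtension hp).valuationSubring
  algebraMap_mem c := by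
    rw [IsScalarTower.algebraMap_apply k (RatFunc k) L, ← ValuationSubring.mem_comap,
      infinityExtension, h.comap_ramified, Valuation.mem_valuationSubring_iff,
      IsScalarTower.algebraMap_apply k k[X] (RatFunc k)]
    exact infinityValuation_C_le_one c
  ne_top htop := h.X_notMem_infinityExtension hp (htop ▸ ValuationSubring.mem_top _)

lemma isRational_infinityPlace : (h.infinityPlace hp).IsRational := by
  intro z hz
  obtain ⟨a, b, rfl⟩ := h.exists_coords z
  have hab : infinityValuation k a ≤ 1 ∧ infinityValuation k b ≤ exp ((0 - p.natDegree : ℤ) / 2) :=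
    (h.infinityExtension_le_exp_iff hp (n := 0)).1 hz
  obtain ⟨c, hc⟩ := exists_infinityValuation_sub_lt_one hab.1
  refine ⟨c, valuation_valuationSubring_lt_one_iff.2 ?_⟩
  rw [IsScalarTower.algebraMap_apply k (RatFunc k) L, add_sub_right_comm, ← map_sub,
    lt_one_iff_le_exp_neg_one, h.infinityExtension_le_exp_iff]
  obtain ⟨j, hj⟩ := hp
  exact ⟨lt_one_iff_le_exp_neg_one.1 hc, hab.2.trans (by rw [exp_le_exp]; omega)⟩

variable [Algebra.IsAlgebraic (RatFunc k) L]

lemma ring_eq_infinityExtension {P : Place k L} (hX : algebraMap k[X] L X ∉ P.ring) :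
    P.ring = (h.infinityExtension hp).valuationSubring :=
  h.eq_ramified _ _ _ (Place.ring_eq_infinity (P := P.comap (RatFunc k))
    fun hmem => hX (Place.X_mem_comap_iff.1 hmem))

lemma eq_infinityPlace {P : Place k L} (hX : algebraMap k[X] L X ∉ P.ring) :
    P = h.infinityPlace hp :=
  Place.ext_ring (h.ring_eq_infinityExtension hp hX)

include h hp in
/-- Above each of the affine rational points of the line there are two places. -/
lemma numRationalPoints_eq [Finite k] (hroot : ∀ c, p.eval c = 0) :
    numRationalPoints k L = 2 * Nat.card k + 1 := by
  have hvanish (P : Place k (RatFunc k)) (hP : P ∈ Set.range pointPlace) :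
      P.ring.valuation (algebraMap k[X] (RatFunc k) p) < 1 := by
    obtain ⟨c, rfl⟩ := hP
    exact pointPlace_lt_one_iff.2 (hroot c)
  have hset : {P : Place k L | P.IsRational} =
      insert (h.infinityPlace hp) {P | P.comap (RatFunc k) ∈ Set.range pointPlace} := by
    ext P
    constructor
    · intro hP
      by_cases hX : algebraMap k[X] L X ∈ P.ring
      · exact Or.inr (hP.comap.exists_pointPlace_eq (Place.X_mem_comap_iff.2 hX))
      · exact Or.inl (h.eq_infinityPlace hp hX)
    · rintro (rfl | hP)
      · exact h.isRational_infinityPlace hp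
      · obtain ⟨c, hc⟩ := hP
        exact (h.isRational_iff_comap (hvanish _ ⟨c, hc⟩)).2 (hc ▸ isRational_pointPlace c)
  have hcard : Nat.card {P : Place k L // P.comap (RatFunc k) ∈ Set.range pointPlace} =
      2 * Nat.card k := by
    rw [h.card_comap_mem hvanish, Nat.card_range_of_injective pointPlace_injective]
  have hnotMem : h.infinityPlace hp ∉ {P | P.comap (RatFunc k) ∈ Set.range pointPlace} := by
    rintro ⟨c, hc⟩
    exact h.X_notMem_infinityExtension hp
      (Place.X_mem_comap_iff (P := h.infinityPlace hp).1 (hc ▸ X_mem_pointPlace c))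
  have hfinite : {P : Place k L | P.comap (RatFunc k) ∈ Set.range pointPlace}.Finite :=
    Set.finite_coe_iff.1 (Nat.finite_of_card_ne_zero (by
      rw [Set.coe_ofPred, hcard]; exact mul_ne_zero two_ne_zero Nat.card_pos.ne'))
  rw [numRationalPoints, ← Set.coe_ofPred, hset, Nat.card_coe_set_eq,
    Set.ncard_insert_of_notMem hnotMem hfinite, ← Nat.card_coe_set_eq, Set.coe_ofPred, hcard]

end IsArtinSchreier

end Infinity

lemma odd_of_eq_three {n : ℕ} (hn : n = 3) : Odd n := by
  subst hn
  decide

section Derivation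

variable {k L : Type*} [Field k] [Field L] [Algebra (RatFunc k) L] {y : L} {p : k[X]}

namespace IsArtinSchreier

lemma mem_infinityExtension_iff (h : IsArtinSchreier (RatFunc k) L y (algebraMap _ _ p))
    (hp : p.natDegree = 3) {a b : RatFunc k} :
    algebraMap _ L a + algebraMap _ L b * y ∈
        (h.infinityExtension (odd_of_eq_three hp)).valuationSubring ↔
      infinityValuation k a ≤ 1 ∧ infinityValuation k b ≤ exp (-2) := by
  refine (h.infinityExtension_le_exp_iff (odd_of_eq_three hp) (n := 0)).trans ?_
  rw [hp]
  rfl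

variable [Algebra k L] {D₀ : Derivation k (RatFunc k) (RatFunc k)} {D : Derivation k L L}

lemma derivation_coords (h : IsArtinSchreier (RatFunc k) L y (algebraMap _ _ p))
    (hD₀ : ∀ a : k[X], D₀ (algebraMap _ _ a) = algebraMap _ _ (derivative a))
    (hD : ∀ a, D (algebraMap _ L a) = algebraMap _ L (D₀ a)) (a b : RatFunc k) :
    D (algebraMap _ L a + algebraMap _ L b * y) =
      algebraMap _ L (D₀ a + b * algebraMap _ _ (derivative p)) + algebraMap _ L (D₀ b) * y := by
  rw [map_add, Derivation.leibniz, hD, hD, h.derivation_gen hD, hD₀, smul_eq_mul, smul_eq_mul,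
    map_add, map_mul]
  ring

lemma derivation_mem_infinityExtension (h : IsArtinSchreier (RatFunc k) L y (algebraMap _ _ p))
    (hp : p.natDegree = 3) (hp' : infinityValuation k (algebraMap _ _ (derivative p)) = exp 2)
    (hD₀ : ∀ a : k[X], D₀ (algebraMap _ _ a) = algebraMap _ _ (derivative a))
    (hD : ∀ a, D (algebraMap _ L a) = algebraMap _ L (D₀ a)) {z : L}
    (hz : z ∈ (h.infinityExtension (odd_of_eq_three hp)).valuationSubring) :
    D z ∈ (h.infinityExtension (odd_of_eq_three hp)).valuationSubring := by
  obtain ⟨a, b, rfl⟩ := h.exists_coords z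
  obtain ⟨ha, hb⟩ := (h.mem_infinityExtension_iff hp).1 hz
  have hle (a : RatFunc k) : infinityValuation k (D₀ a) ≤ infinityValuation k a :=
    (infinityValuation_derivation_le hD₀ a).trans <| mul_le_of_le_one_right' <| by
      rw [← exp_zero, exp_le_exp]; norm_num
  have hbp : infinityValuation k (b * algebraMap _ _ (derivative p)) ≤ 1 := by
    rw [map_mul, hp']
    calc infinityValuation k b * exp 2 ≤ exp (-2) * exp 2 := by gcongr
      _ = 1 := by rw [← exp_add]; rfl
  rw [h.derivation_coords hD₀ hD, h.mem_infinityExtension_iff hp]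
  exact ⟨Valuation.map_add_le _ ((hle a).trans ha) hbp, (hle b).trans hb⟩

/-- At infinity the derivative `p' / x²` of `y / x²` is a unit. -/
lemma isInvertibleAt_infinity (h : IsArtinSchreier (RatFunc k) L y (algebraMap _ _ p))
    (hp : p.natDegree = 3) (hp' : (derivative p).natDegree = 2)
    (hD₀ : ∀ a : k[X], D₀ (algebraMap _ _ a) = algebraMap _ _ (derivative a))
    (hD : ∀ a, D (algebraMap _ L a) = algebraMap _ L (D₀ a)) :
    IsInvertibleAt D (h.infinityExtension (odd_of_eq_three hp)).valuationSubring := by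
  have hp'_val : infinityValuation k (algebraMap _ _ (derivative p)) = exp 2 := by
    rw [infinityValuation_polynomial (by rintro h0; simp [h0] at hp'), hp', Nat.cast_ofNat]
  set b : RatFunc k := (algebraMap k[X] _ X ^ 2)⁻¹ with hb
  have hb_val : infinityValuation k b = exp (-2) := by
    rw [hb, map_inv₀, map_pow, infinityValuation_polynomial X_ne_zero]
    simp [← exp_neg]
  have hDb : D₀ b = 0 := by
    rw [hb, Derivation.leibniz_inv, Derivation.leibniz_pow, nsmul_eq_mul, Nat.cast_ofNat,
      h.two_eq_zero, zero_mul, smul_zero]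
  refine ⟨fun z => h.derivation_mem_infinityExtension hp hp'_val hD₀ hD,
    algebraMap (RatFunc k) L 0 + algebraMap _ L b * y, ?_, ?_⟩
  · rw [h.mem_infinityExtension_iff hp, map_zero]
    exact ⟨zero_le, hb_val.le⟩
  · rw [h.derivation_coords hD₀ hD, hDb, map_zero, map_zero, zero_mul, add_zero, zero_add,
      ← (Valuation.isEquiv_valuation_valuationSubring _).eq_one_iff_eq_one, infinityExtension,
      ramified_algebraMap, map_mul, hb_val, hp'_val, ← exp_add]
    simp

variable [IsScalarTower k (RatFunc k) L] [Algebra k[X] L] [IsScalarTower k[X] (RatFunc k) L]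
  [Algebra.IsAlgebraic (RatFunc k) L]

lemma isInvertibleAt_of_X_mem (h : IsArtinSchreier (RatFunc k) L y (algebraMap _ _ p))
    (hD₀ : ∀ a : k[X], D₀ (algebraMap _ _ a) = algebraMap _ _ (derivative a))
    (hD : ∀ a, D (algebraMap _ L a) = algebraMap _ L (D₀ a)) {P : Place k L}
    (hX : algebraMap k[X] L X ∈ P.ring) : IsInvertibleAt D P.ring where
  map_mem z hz := by
    refine h.derivation_mem hD (fun a ha => ?_) ?_ hz
    · exact Place.derivation_mem (P := P.comap (RatFunc k)) hD₀ (Place.X_mem_comap_iff.2 hX) ha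
    · rw [← IsScalarTower.algebraMap_apply]
      exact Place.polynomial_mem hX p
  exists_valuation_eq_one := by
    refine ⟨algebraMap k[X] L X, hX, ?_⟩
    rw [IsScalarTower.algebraMap_apply k[X] (RatFunc k) L, hD, hD₀, derivative_X]
    simp only [map_one]

/-- The differential `dx` has neither zeros nor poles on an elliptic curve `y² + y = p(x)`. -/
lemma isInvertibleAt (h : IsArtinSchreier (RatFunc k) L y (algebraMap _ _ p))
    (hp : p.natDegree = 3) (hp' : (derivative p).natDegree = 2)
    (hD₀ : ∀ a : k[X], D₀ (algebraMap _ _ a) = algebraMap _ _ (derivative a))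
    (hD : ∀ a, D (algebraMap _ L a) = algebraMap _ L (D₀ a)) (P : Place k L) :
    IsInvertibleAt D P.ring := by
  by_cases hX : algebraMap k[X] L X ∈ P.ring
  · exact h.isInvertibleAt_of_X_mem hD₀ hD hX
  · rw [h.ring_eq_infinityExtension (odd_of_eq_three hp) hX]
    exact h.isInvertibleAt_infinity hp hp' hD₀ hD

end IsArtinSchreier

end Derivation

section PoleSpace

variable {k L : Type*} [Field k] [Field L] [Algebra k[X] L] [Algebra (RatFunc k) L]
  [IsScalarTower k[X] (RatFunc k) L] [Algebra k L] [IsScalarTower k (RatFunc k) L]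
  {y : L} {p q B : k[X]} {v : Valuation L ℤᵐ⁰} {hq : Irreducible q}

namespace IsValuationAt

lemma natDegree_le_of_mem_regularAway (hv : IsValuationAt hq B y v)
    (h : IsArtinSchreier (RatFunc k) L y (algebraMap _ _ p)) (hp : Odd p.natDegree)
    {a b d : k[X]} (hd : d ≠ 0)
    (hz : (algebraMap _ L a + algebraMap _ L b * y) / algebraMap _ L d ∈ regularAway k v) :
    a.natDegree ≤ d.natDegree ∧ (b = 0 ∨ 2 * b.natDegree + p.natDegree ≤ 2 * d.natDegree) := by
  have hX : algebraMap k[X] L X ∈ v.valuationSubring := hv.polynomial_le_one X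
  have hne : (h.infinityExtension hp).valuationSubring ≠ v.valuationSubring := fun hring =>
    h.X_notMem_infinityExtension hp (hring ▸ hX)
  exact (h.infinityExtension_div_le_one_iff hp hd).1 (hz (h.infinityPlace hp) hne)

variable [Algebra.IsAlgebraic (RatFunc k) L]

lemma mem_regularAway (hv : IsValuationAt hq B y v)
    (h : IsArtinSchreier (RatFunc k) L y (algebraMap _ _ p)) (hp : Odd p.natDegree)
    {a b C e : k[X]} {m : ℕ} (hC : q ∣ C - B) (he : p + C ^ 2 + C = q ^ m * e)
    (hab : q ^ m ∣ a - b * (C + 1)) (ha : a.natDegree ≤ (q ^ m).natDegree)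
    (hb : b = 0 ∨ 2 * b.natDegree + p.natDegree ≤ 2 * (q ^ m).natDegree) :
    (algebraMap _ L a + algebraMap _ L b * y) / algebraMap _ L q ^ m ∈ regularAway k v := by
  intro P hP
  have hqm0 : algebraMap k[X] L q ^ m ≠ 0 :=
    pow_ne_zero m (algebraMap_polynomial_ne_zero hq.ne_zero)
  by_cases hX : algebraMap k[X] L X ∈ P.ring
  · obtain ⟨c, hc⟩ := hab
    have hsplit : (algebraMap _ L a + algebraMap _ L b * y) / algebraMap _ L q ^ m =
        algebraMap _ L b * ((y + algebraMap _ L C + 1) / algebraMap _ L q ^ m) +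
          algebraMap _ L c := by
      rw [eq_add_of_sub_eq hc]
      simp only [map_add, map_mul, map_pow, map_one]
      field_simp
      ring
    rw [hsplit]
    exact add_mem (mul_mem (Place.polynomial_mem hX b) (hv.conj_div_pow_mem h hX hP hC he))
      (Place.polynomial_mem hX c)
  · rw [h.ring_eq_infinityExtension hp hX, Valuation.mem_valuationSubring_iff, ← map_pow,
      h.infinityExtension_div_le_one_iff hp (pow_ne_zero m hq.ne_zero)]
    exact ⟨ha, hb⟩

lemma exists_polynomial_coords (hv : IsValuationAt hq B y v)
    (h : IsArtinSchreier (RatFunc k) L y (algebraMap _ _ p)) {z : L} (hz : z ∈ regularAway k v)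
    {m : ℕ} (hzm : v z ≤ exp (m : ℤ)) :
    ∃ a b : k[X], z = (algebraMap _ L a + algebraMap _ L b * y) / algebraMap _ L q ^ m := by
  have hqm0 : algebraMap k[X] L q ^ m ≠ 0 :=
    pow_ne_zero m (algebraMap_polynomial_ne_zero hq.ne_zero)
  obtain ⟨a, b, hab⟩ := h.exists_coords (algebraMap _ L q ^ m * z)
  have hregular (r : k[X]) (hr : Irreducible r) (V : ValuationSubring L)
      (hV : V.comap (algebraMap (RatFunc k) L) = (adicPlace hr).ring) :
      algebraMap _ L q ^ m * z ∈ V := by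
    obtain ⟨P, hP, rfl⟩ := Place.exists_ring_eq hV
    by_cases hPv : P.ring = v.valuationSubring
    · rw [hPv, Valuation.mem_valuationSubring_iff, map_mul, map_pow, hv.uniformizer]
      calc exp (-1) ^ m * v z ≤ exp (-1) ^ m * exp (m : ℤ) := by gcongr
        _ = 1 := by rw [← exp_nsmul, ← exp_add, ← exp_zero]; simp
    · have hX : algebraMap k[X] L X ∈ P.ring := by
        rw [← Place.X_mem_comap_iff, hP]
        exact adicValuation_le_one hr X
      exact mul_mem (pow_mem (Place.polynomial_mem hX q) m) (hz P hPv)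
  have hcoords (r : k[X]) (hr : Irreducible r) : adicValuation hr a ≤ 1 ∧ adicValuation hr b ≤ 1 :=
    h.coords_mem (V := (adicPlace hr).ring) (adicValuation_le_one hr p) fun V hV =>
      hab ▸ hregular r hr V hV
  obtain ⟨a, rfl⟩ := exists_polynomial_of_adicValuation_le_one fun r hr => (hcoords r hr).1
  obtain ⟨b, rfl⟩ := exists_polynomial_of_adicValuation_le_one fun r hr => (hcoords r hr).2
  refine ⟨a, b, ?_⟩
  simp only [← IsScalarTower.algebraMap_apply] at hab
  rw [eq_div_iff hqm0, ← hab, mul_comm]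

lemma dvd_of_mem_regularAway (hv : IsValuationAt hq B y v)
    (h : IsArtinSchreier (RatFunc k) L y (algebraMap _ _ p)) (hB : q ∣ p + B ^ 2 + B) {a b : k[X]}
    (hz : (algebraMap _ L a + algebraMap _ L b * y) / algebraMap _ L q ∈ regularAway k v) :
    q ∣ a - b * (B + 1) := by
  have hq0 : algebraMap k[X] L q ≠ 0 := algebraMap_polynomial_ne_zero hq.ne_zero
  have hB' : q ∣ p + (B + 1) ^ 2 + (B + 1) := by
    rwa [show p + (B + 1) ^ 2 + (B + 1) = p + B ^ 2 + B by
      linear_combination (B + 1) * h.two_eq_zero_polynomial]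
  obtain ⟨w, hw⟩ := h.exists_isValuationAt hq hB'
  have hne : w.valuationSubring ≠ v.valuationSubring := by
    intro heq
    have hroot : w (y + algebraMap _ L B) < 1 := by
      rw [← valuation_valuationSubring_lt_one_iff, heq, valuation_valuationSubring_lt_one_iff]
      exact hv.map_root_lt_one
    have hone : w (y + algebraMap _ L (B + 1) - (y + algebraMap _ L B)) < 1 :=
      w.map_sub_lt hw.map_root_lt_one hroot
    simp at hone
  obtain ⟨P, -, hP⟩ := Place.exists_ring_eq (P := adicPlace hq) (V := w.valuationSubring) (by
    ext c
    rw [ValuationSubring.mem_comap, w.mem_valuationSubring_iff, hw.map_algebraMap]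
    rfl)
  have hzw : w ((algebraMap _ L a + algebraMap _ L b * y) / algebraMap _ L q) ≤ 1 := by
    rw [← w.mem_valuationSubring_iff, ← hP]
    exact hz P (hP ▸ hne)
  have hsplit : algebraMap _ L (a - b * (B + 1)) =
      algebraMap _ L q * ((algebraMap _ L a + algebraMap _ L b * y) / algebraMap _ L q) -
        algebraMap _ L b * (y + algebraMap _ L (B + 1)) := by
    rw [mul_div_cancel₀ _ hq0]
    simp only [map_sub, map_mul]
    ring
  rw [← hw.polynomial_lt_one_iff, hsplit]
  refine w.map_sub_lt ?_ ?_ <;> rw [map_mul]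
  · exact mul_lt_one_of_lt_of_le (hw.polynomial_lt_one_iff.2 dvd_rfl) hzw
  · exact mul_lt_one_of_nonneg_of_lt_one_right (hw.polynomial_le_one b) zero_le hw.map_root_lt_one

end IsValuationAt

end PoleSpace

section LeadingCoeff

variable {k L : Type*} [Field k] [Field L] [Algebra k[X] L] {y z z' : L} {p q B b b' : k[X]}
  {v : Valuation L ℤᵐ⁰} {m n : ℕ}

/-- At the place of `v`, of which `q` is a uniformizer, `z` has a pole of order at most `m`, and
the class of `b` modulo `q` is the coefficient of `q ^ (-m)` in the expansion of `z`. -/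
def HasLeadingCoeff (q : k[X]) (v : Valuation L ℤᵐ⁰) (m : ℕ) (z : L) (b : k[X]) : Prop :=
  v (algebraMap _ L q ^ m * z - algebraMap _ L b) < 1

lemma HasLeadingCoeff.add (hz : HasLeadingCoeff q v m z b) (hz' : HasLeadingCoeff q v m z' b') :
    HasLeadingCoeff q v m (z + z') (b + b') := by
  have hsum := v.map_add_lt hz hz'
  rwa [← add_sub_add_comm, ← mul_add, ← map_add] at hsum

lemma hasLeadingCoeff_one : HasLeadingCoeff q v 0 1 1 := by
  simp [HasLeadingCoeff]

variable [Algebra (RatFunc k) L] [IsScalarTower k[X] (RatFunc k) L] {hq : Irreducible q}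

lemma HasLeadingCoeff.mul (hz : HasLeadingCoeff q v m z b) (hv : IsValuationAt hq B y v)
    (hz' : HasLeadingCoeff q v n z' b') : HasLeadingCoeff q v (m + n) (z * z') (b * b') := by
  have hle : v (algebraMap _ L q ^ m * z) ≤ 1 := by
    simpa using v.map_add_le hz.le (hv.polynomial_le_one b)
  have hsplit : algebraMap _ L q ^ (m + n) * (z * z') - algebraMap _ L (b * b') =
      algebraMap _ L q ^ m * z * (algebraMap _ L q ^ n * z' - algebraMap _ L b') +
        algebraMap _ L b' * (algebraMap _ L q ^ m * z - algebraMap _ L b) := by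
    rw [map_mul]; ring
  rw [HasLeadingCoeff, hsplit]
  refine v.map_add_lt ?_ ?_ <;> rw [map_mul]
  · exact mul_lt_one_of_nonneg_of_lt_one_right hle zero_le hz'
  · exact mul_lt_one_of_nonneg_of_lt_one_right (hv.polynomial_le_one b') zero_le hz

namespace IsValuationAt

lemma map_pow_mul_le_one_iff (hv : IsValuationAt hq B y v) :
    v (algebraMap _ L q ^ m * z) ≤ 1 ↔ v z ≤ exp (m : ℤ) := by
  rw [map_mul, map_pow, hv.uniformizer, ← exp_nsmul, nsmul_eq_mul, mul_neg_one, exp_neg,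
    inv_mul_le_one₀ exp_pos]

lemma le_exp_of_hasLeadingCoeff (hv : IsValuationAt hq B y v) (hz : HasLeadingCoeff q v m z b) :
    v z ≤ exp (m : ℤ) := by
  rw [← hv.map_pow_mul_le_one_iff]
  simpa using v.map_add_le hz.le (hv.polynomial_le_one b)

lemma sub_le_exp_of_hasLeadingCoeff (hv : IsValuationAt hq B y v)
    (hz : HasLeadingCoeff q v (m + 1) z b) (hz' : HasLeadingCoeff q v (m + 1) z' b) :
    v (z - z') ≤ exp (m : ℤ) := by
  have hlt := v.map_sub_lt hz hz'
  rw [sub_sub_sub_cancel_right, ← mul_sub, lt_one_iff_le_exp_neg_one, map_mul, map_pow,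
    hv.uniformizer, ← exp_nsmul, nsmul_eq_mul, mul_neg_one, exp_neg, inv_mul_le_iff₀ exp_pos,
    ← exp_add] at hlt
  simpa using hlt

lemma exists_hasLeadingCoeff (hv : IsValuationAt hq B y v)
    (h : IsArtinSchreier (RatFunc k) L y (algebraMap _ _ p)) (hz : v z ≤ exp (m : ℤ)) :
    ∃ b : k[X], b.natDegree < q.natDegree ∧ HasLeadingCoeff q v m z b :=
  hv.exists_polynomial_sub_lt_one h (hv.map_pow_mul_le_one_iff.2 hz)

lemma exists_sq_sub_lt_one (hv : IsValuationAt hq B y v) [Finite k]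
    (h : IsArtinSchreier (RatFunc k) L y (algebraMap _ _ p)) (hz : v z ≤ 1) :
    ∃ γ, v (γ ^ 2 - z) < 1 := by
  have := Fact.mk hq
  have : Module.Finite k (AdjoinRoot q) := (AdjoinRoot.powerBasis hq.ne_zero).finite
  have : Finite (AdjoinRoot q) := Module.finite_of_finite k
  have : CharP (AdjoinRoot q) 2 := CharTwo.of_one_ne_zero_of_two_eq_zero one_ne_zero (by
    rw [← map_ofNat (AdjoinRoot.mk q), h.two_eq_zero_polynomial, map_zero])
  obtain ⟨b, -, hb⟩ := hv.exists_polynomial_sub_lt_one h hz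
  obtain ⟨s, hs⟩ := FiniteField.isSquare_of_char_two (ringChar.eq _ 2) (AdjoinRoot.mk q b)
  obtain ⟨c, rfl⟩ := AdjoinRoot.mk_surjective s
  rw [← map_mul, AdjoinRoot.mk_eq_mk, ← hv.polynomial_lt_one_iff] at hs
  refine ⟨algebraMap _ L c, ?_⟩
  rw [← Valuation.map_neg]
  simpa [sq] using v.map_add_lt hb hs

end IsValuationAt

end LeadingCoeff

section PoleFunction

variable {k L : Type*} [Field k] [Field L] [Algebra k[X] L] {y : L} {p q B b b' : k[X]}
  {v : Valuation L ℤᵐ⁰} {g : ℕ} {c c' : k}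

lemma natDegree_div (a : k[X]) (hq : q ≠ 0) : (a / q).natDegree = a.natDegree - q.natDegree := by
  have hlead : q.leadingCoeff⁻¹ ≠ 0 := inv_ne_zero (leadingCoeff_ne_zero.2 hq)
  rw [div_def, natDegree_C_mul hlead, natDegree_divByMonic _ (monic_mul_leadingCoeff_inv hq),
    natDegree_mul_C hlead]

lemma mem_degreeLT_sub_iff (hp : p.natDegree = 2 * g + 1) :
    b ∈ degreeLT k (q.natDegree - g) ↔
      b = 0 ∨ 2 * b.natDegree + p.natDegree ≤ 2 * q.natDegree := by
  obtain rfl | hb := eq_or_ne b 0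
  · simp
  · rw [mem_degreeLT, ← natDegree_lt_iff_degree_lt hb, or_iff_right hb]
    omega

/-- The function with at most a simple pole at the place of the curve `y² + y = p(x)` where `q`
and `y + B` vanish, and with leading coefficient `b` there. Reducing the constant term modulo `q`
fixes the additive constant and keeps the pole at infinity away. -/
noncomputable def poleFunction (q B : k[X]) (y : L) (b : k[X]) : L :=
  (algebraMap _ L (b * (B + 1) % q) + algebraMap _ L b * y) / algebraMap _ L q

lemma poleFunction_zero : poleFunction q B y 0 = 0 := by
  simp [poleFunction]

variable [Algebra (RatFunc k) L] [IsScalarTower k[X] (RatFunc k) L] {hq : Irreducible q}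

lemma IsValuationAt.hasLeadingCoeff_poleFunction (hv : IsValuationAt hq B y v) (b : k[X]) :
    HasLeadingCoeff q v 1 (poleFunction q B y b) b := by
  have hq0 : algebraMap k[X] L q ≠ 0 := algebraMap_polynomial_ne_zero hq.ne_zero
  have hsplit : algebraMap _ L q ^ 1 * poleFunction q B y b - algebraMap _ L b =
      algebraMap _ L b * (y + algebraMap _ L B) -
        algebraMap _ L (q * (b * (B + 1) / q)) := by
    have hmod := congrArg (algebraMap k[X] L) (EuclideanDomain.div_add_mod (b * (B + 1)) q)
    rw [poleFunction, pow_one, mul_div_cancel₀ _ hq0]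
    simp only [map_add, map_mul, map_one] at hmod ⊢
    linear_combination hmod
  rw [HasLeadingCoeff, hsplit]
  refine v.map_sub_lt ?_ (hv.polynomial_lt_one_iff.2 (dvd_mul_right _ _))
  rw [map_mul]
  exact mul_lt_one_of_nonneg_of_lt_one_right (hv.polynomial_le_one b) zero_le hv.map_root_lt_one

variable [Algebra k L] [IsScalarTower k (RatFunc k) L]

lemma algebraMap_polynomial_C (c : k) : algebraMap k[X] L (C c) = algebraMap k L c := by
  rw [IsScalarTower.algebraMap_apply k[X] (RatFunc k) L,
    IsScalarTower.algebraMap_apply k (RatFunc k) L, IsScalarTower.algebraMap_apply k k[X],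
    algebraMap_eq]

lemma poleFunction_add_algebraMap_inj (hq : Irreducible q)
    (h : IsArtinSchreier (RatFunc k) L y (algebraMap _ _ p))
    (heq : poleFunction q B y b + algebraMap k L c = poleFunction q B y b' + algebraMap k L c') :
    b = b' ∧ c = c' := by
  have hq0 : algebraMap k[X] (RatFunc k) q ≠ 0 := by simpa using hq.ne_zero
  have hcoords (b : k[X]) (c : k) : poleFunction q B y b + algebraMap k L c =
      algebraMap (RatFunc k) L (algebraMap _ _ (b * (B + 1) % q) / algebraMap _ _ q +
          algebraMap k _ c) +
        algebraMap (RatFunc k) L (algebraMap _ _ b / algebraMap _ _ q) * y := by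
    simp only [poleFunction, map_add, map_div₀, ← IsScalarTower.algebraMap_apply]
    ring
  rw [hcoords, hcoords] at heq
  obtain ⟨hfst, hsnd⟩ := h.coords_unique heq
  obtain rfl : b = b' := RatFunc.algebraMap_injective _ ((div_left_inj' hq0).1 hsnd)
  exact ⟨rfl, (algebraMap k (RatFunc k)).injective (add_left_cancel hfst)⟩

variable [Algebra.IsAlgebraic (RatFunc k) L]

namespace IsValuationAt

lemma poleFunction_mem (hv : IsValuationAt hq B y v)
    (h : IsArtinSchreier (RatFunc k) L y (algebraMap _ _ p)) (hp : p.natDegree = 2 * g + 1)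
    (hB : q ∣ p + B ^ 2 + B) (hb : b ∈ degreeLT k (q.natDegree - g)) :
    poleFunction q B y b ∈ regularAway k v := by
  obtain ⟨e, he⟩ := hB
  have hmem := hv.mem_regularAway h ⟨g, hp⟩ (a := b * (B + 1) % q) (b := b) (C := B) (e := e)
    (m := 1) (by simp) (by simpa using he)
    (by
      rw [pow_one, ← dvd_neg, neg_sub]
      exact ⟨_, sub_eq_iff_eq_add.2 (EuclideanDomain.div_add_mod _ q).symm⟩)
    (by simpa using (natDegree_mod_lt _ hq.natDegree_pos.ne').le)
    (by simpa using (mem_degreeLT_sub_iff hp).1 hb)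
  simpa [poleFunction] using hmem

lemma exists_eq_poleFunction_add (hv : IsValuationAt hq B y v)
    (h : IsArtinSchreier (RatFunc k) L y (algebraMap _ _ p)) (hp : p.natDegree = 2 * g + 1)
    (hB : q ∣ p + B ^ 2 + B) {z : L} (hz : z ∈ poleSpace k v 1) :
    ∃ b ∈ degreeLT k (q.natDegree - g), ∃ c, z = poleFunction q B y b + algebraMap k L c := by
  have hq0 : algebraMap k[X] L q ≠ 0 := algebraMap_polynomial_ne_zero hq.ne_zero
  obtain ⟨a, b, rfl⟩ := hv.exists_polynomial_coords h hz.1 (m := 1) hz.2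
  rw [pow_one] at hz ⊢
  obtain ⟨ha, hb⟩ := hv.natDegree_le_of_mem_regularAway h ⟨g, hp⟩ hq.ne_zero hz.1
  have hmod : a % q = b * (B + 1) % q := by
    rw [← sub_eq_zero, ← sub_mod, EuclideanDomain.mod_eq_zero]
    exact hv.dvd_of_mem_regularAway h hB hz.1
  have hdiv : a / q = C ((a / q).coeff 0) := by
    apply eq_C_of_natDegree_le_zero
    rw [natDegree_div a hq.ne_zero]
    omega
  refine ⟨b, (mem_degreeLT_sub_iff hp).2 hb, (a / q).coeff 0, ?_⟩
  rw [poleFunction, ← hmod, ← algebraMap_polynomial_C, ← hdiv, div_add' _ _ _ hq0]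
  congr 1
  have hsplit := congrArg (algebraMap k[X] L) (EuclideanDomain.div_add_mod a q)
  rw [map_add, map_mul] at hsplit
  linear_combination -hsplit

/-- The Riemann–Roch formula `#L(P) = #k ^ (deg P + 1 - g)`. -/
lemma card_poleSpace_one (hv : IsValuationAt hq B y v)
    (h : IsArtinSchreier (RatFunc k) L y (algebraMap _ _ p)) (hp : p.natDegree = 2 * g + 1)
    (hB : q ∣ p + B ^ 2 + B) :
    Nat.card (poleSpace k v 1) = Nat.card k ^ (q.natDegree - g + 1) := by
  let φ (x : degreeLT k (q.natDegree - g) × k) : poleSpace k v 1 :=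
    ⟨poleFunction q B y x.1 + algebraMap k L x.2,
      add_mem (hv.poleFunction_mem h hp hB x.1.2) (Subalgebra.algebraMap_mem _ _),
      v.map_add_le (hv.le_exp_of_hasLeadingCoeff (hv.hasLeadingCoeff_poleFunction x.1)) (by
        rw [← algebraMap_polynomial_C]
        exact (hv.polynomial_le_one _).trans (by rw [← exp_zero, exp_le_exp]; exact zero_le_one))⟩
  have hφ : Function.Bijective φ := by
    refine ⟨fun x x' hx => ?_, fun ⟨z, hz⟩ => ?_⟩
    · obtain ⟨hfst, hsnd⟩ := poleFunction_add_algebraMap_inj hq h (congrArg Subtype.val hx)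
      exact Prod.ext (Subtype.ext hfst) hsnd
    · obtain ⟨b, hb, c, rfl⟩ := hv.exists_eq_poleFunction_add h hp hB hz
      exact ⟨(⟨b, hb⟩, c), rfl⟩
  rw [← Nat.card_congr (Equiv.ofBijective φ hφ), Nat.card_prod,
    Nat.card_congr (degreeLTEquiv k _).toEquiv, Nat.card_fun, Nat.card_fin, pow_succ]

lemma poleSpace_zero (hv : IsValuationAt hq B y v)
    (h : IsArtinSchreier (RatFunc k) L y (algebraMap _ _ p)) (hp : p.natDegree = 2 * g + 1)
    (hB : q ∣ p + B ^ 2 + B) : poleSpace k v 0 = Set.range (algebraMap k L) := by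
  have hconst (c : k) : v (algebraMap k L c) ≤ 1 := by
    rw [← algebraMap_polynomial_C]
    exact hv.polynomial_le_one _
  ext z
  refine ⟨fun hz => ?_, ?_⟩
  · have hz1 : v z ≤ exp 1 := hz.2.trans (by rw [exp_le_exp]; exact zero_le_one)
    obtain ⟨b, hb, c, rfl⟩ := hv.exists_eq_poleFunction_add h hp hB ⟨hz.1, hz1⟩
    have hle : v (poleFunction q B y b) ≤ 1 := by
      simpa using v.map_sub_le hz.2 (hconst c)
    have hlt : v (algebraMap _ L b) < 1 := by
      have hqz : v (algebraMap _ L q ^ 1 * poleFunction q B y b) < 1 := by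
        rw [pow_one, map_mul]
        exact mul_lt_one_of_lt_of_le (hv.polynomial_lt_one_iff.2 dvd_rfl) hle
      simpa using v.map_sub_lt hqz (hv.hasLeadingCoeff_poleFunction b)
    obtain rfl : b = 0 := by
      refine eq_zero_of_dvd_of_degree_lt (hv.polynomial_lt_one_iff.1 hlt) ?_
      rw [degree_eq_natDegree hq.ne_zero]
      exact (mem_degreeLT.1 hb).trans_le (mod_cast Nat.sub_le _ _)
    exact ⟨c, by rw [poleFunction_zero, zero_add]⟩
  · rintro ⟨c, rfl⟩
    exact ⟨Subalgebra.algebraMap_mem _ c, hconst c⟩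

lemma card_poleSpace_zero (hv : IsValuationAt hq B y v)
    (h : IsArtinSchreier (RatFunc k) L y (algebraMap _ _ p)) (hp : p.natDegree = 2 * g + 1)
    (hB : q ∣ p + B ^ 2 + B) : Nat.card (poleSpace k v 0) = Nat.card k := by
  rw [hv.poleSpace_zero h hp hB, Nat.card_range_of_injective (algebraMap k L).injective]

end IsValuationAt

end PoleFunction

namespace IsValuationAt

variable {k L : Type*} [Field k] [Field L] [Algebra k[X] L] [Algebra (RatFunc k) L]
  [IsScalarTower k[X] (RatFunc k) L] [Algebra k L] [IsScalarTower k (RatFunc k) L]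
  [Algebra.IsAlgebraic (RatFunc k) L] {y : L} {p q B : k[X]} {v : Valuation L ℤᵐ⁰}
  {hq : Irreducible q} {g : ℕ}

lemma exists_mem_regularAway_hasLeadingCoeff_one (hv : IsValuationAt hq B y v)
    (h : IsArtinSchreier (RatFunc k) L y (algebraMap _ _ p)) (hp : p.natDegree = 2 * g + 1)
    (hB : q ∣ p + B ^ 2 + B) (hg : g < q.natDegree) (m : ℕ) :
    ∃ r ∈ regularAway k v, HasLeadingCoeff q v m r 1 := by
  induction m with
  | zero => exact ⟨1, one_mem _, hasLeadingCoeff_one⟩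
  | succ m ih =>
    obtain ⟨r, hr, hrv⟩ := ih
    have hone : (1 : k[X]) ∈ degreeLT k (q.natDegree - g) := by
      rw [mem_degreeLT, degree_one]
      exact_mod_cast Nat.sub_pos_of_lt hg
    refine ⟨r * poleFunction q B y 1, mul_mem hr (hv.poleFunction_mem h hp hB hone), ?_⟩
    simpa using hrv.mul hv (hv.hasLeadingCoeff_poleFunction 1)

/-- A polynomial of degree less than `deg q` need not be the leading coefficient of a function with
a simple pole, but it is the sum of such a leading coefficient and a product of two. -/
lemma exists_mem_regularAway_hasLeadingCoeff (hv : IsValuationAt hq B y v)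
    (h : IsArtinSchreier (RatFunc k) L y (algebraMap _ _ p)) (hp : p.natDegree = 2 * g + 1)
    (hB : q ∣ p + B ^ 2 + B) (hg : 2 * g < q.natDegree) (m : ℕ) {b : k[X]}
    (hb : b.natDegree < q.natDegree) :
    ∃ r ∈ regularAway k v, HasLeadingCoeff q v (m + 2) r b := by
  obtain ⟨r₁, hr₁, hlead₁⟩ :=
    hv.exists_mem_regularAway_hasLeadingCoeff_one h hp hB (by omega) (m + 1)
  obtain ⟨r₂, hr₂, hlead₂⟩ := hv.exists_mem_regularAway_hasLeadingCoeff_one h hp hB (by omega) m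
  set M : k[X] := X ^ (q.natDegree - g - 1)
  have hM0 : M ≠ 0 := pow_ne_zero _ X_ne_zero
  have hdegM : M.natDegree = q.natDegree - g - 1 := natDegree_X_pow _
  have hmem {a : k[X]} (ha : a.natDegree < q.natDegree - g) :
      poleFunction q B y a ∈ regularAway k v :=
    hv.poleFunction_mem h hp hB
      (mem_degreeLT.2 (degree_le_natDegree.trans_lt (mod_cast ha)))
  have hrem : poleFunction q B y (b % M) ∈ regularAway k v :=
    hv.poleFunction_mem h hp hB (mem_degreeLT.2 ((degree_mod_lt b hM0).trans_le (by
      rw [degree_eq_natDegree hM0, hdegM]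
      exact_mod_cast Nat.sub_le _ 1)))
  have hquot : poleFunction q B y (b / M) ∈ regularAway k v :=
    hmem (by rw [natDegree_div b hM0]; omega)
  refine ⟨r₁ * poleFunction q B y (b % M) +
      r₂ * (poleFunction q B y M * poleFunction q B y (b / M)),
    add_mem (mul_mem hr₁ hrem) (mul_mem hr₂ (mul_mem (hmem (by omega)) hquot)), ?_⟩
  have hlead := (hlead₁.mul hv (hv.hasLeadingCoeff_poleFunction (b % M))).add (hlead₂.mul hv
    ((hv.hasLeadingCoeff_poleFunction M).mul hv (hv.hasLeadingCoeff_poleFunction (b / M))))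
  rwa [one_mul, one_mul, EuclideanDomain.mod_add_div] at hlead

lemma exists_mem_regularAway_sub_le (hv : IsValuationAt hq B y v)
    (h : IsArtinSchreier (RatFunc k) L y (algebraMap _ _ p)) (hp : p.natDegree = 2 * g + 1)
    (hB : q ∣ p + B ^ 2 + B) (hg : 2 * g < q.natDegree) (z : L) :
    ∃ r ∈ regularAway k v, v (z - r) ≤ exp 1 := by
  suffices hpole : ∀ (m : ℕ) (z : L), v z ≤ exp ((m + 1 : ℕ) : ℤ) →
      ∃ r ∈ regularAway k v, v (z - r) ≤ exp 1 by
    refine hpole (log (v z)).toNat z ?_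
    obtain hz | hz := eq_or_ne (v z) 0
    · rw [hz]; exact zero_le
    · rw [← log_le_iff_le_exp hz]
      omega
  intro m
  induction m with
  | zero => exact fun z hz => ⟨0, zero_mem _, by simpa using hz⟩
  | succ m ih =>
    intro z hz
    obtain ⟨b, hb, hlead⟩ := hv.exists_hasLeadingCoeff h hz
    obtain ⟨r, hr, hrlead⟩ := hv.exists_mem_regularAway_hasLeadingCoeff h hp hB hg m hb
    obtain ⟨s, hs, hsle⟩ := ih _ (hv.sub_le_exp_of_hasLeadingCoeff hlead hrlead)
    exact ⟨r + s, add_mem hr hs, by rwa [← sub_sub]⟩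

end IsValuationAt

lemma Place.IsRational.valuation_pow_card_sub_self_lt_one {k F : Type*} [Field k] [Finite k]
    [Field F] [Algebra k F] {P : Place k F} (hP : P.IsRational) {z : F} (hz : z ∈ P.ring) :
    P.ring.valuation (z ^ Nat.card k - z) < 1 := by
  obtain ⟨c, hc⟩ := hP z hz
  have hcard : algebraMap k F c ^ Nat.card k = algebraMap k F c := by
    have := Fintype.ofFinite k
    rw [← map_pow, Nat.card_eq_fintype_card, FiniteField.pow_card]
  have hsum : ∑ i ∈ Finset.range (Nat.card k), z ^ i * algebraMap k F c ^ (Nat.card k - 1 - i) ∈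
      P.ring :=
    sum_mem fun i _ => mul_mem (pow_mem hz _) (pow_mem (P.algebraMap_mem c) _)
  have hsplit : z ^ Nat.card k - z =
      (∑ i ∈ Finset.range (Nat.card k), z ^ i * algebraMap k F c ^ (Nat.card k - 1 - i)) *
        (z - algebraMap k F c) - (z - algebraMap k F c) := by
    rw [(Commute.all z _).geom_sum₂_mul, hcard]
    ring
  rw [hsplit]
  refine P.ring.valuation.map_sub_lt ?_ hc
  rw [map_mul]
  exact mul_lt_one_of_nonneg_of_lt_one_right ((P.ring.valuation_le_one_iff _).2 hsum) zero_le hc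

section PolarPart

variable {k L : Type*} [Field k] [Field L] [Algebra k[X] L] [Algebra (RatFunc k) L]
  [IsScalarTower k[X] (RatFunc k) L] {y : L} {p q B a b : k[X]} {v : Valuation L ℤᵐ⁰}

namespace IsArtinSchreier

variable (h : IsArtinSchreier (RatFunc k) L y (algebraMap _ _ p))
include h

lemma infinityExtension_div_lt_one (hp : Odd p.natDegree) {d : k[X]}
    (hb : b.natDegree < d.natDegree) (ha : 2 * a.natDegree + p.natDegree < 2 * d.natDegree) :
    h.infinityExtension hp
      ((algebraMap _ L b + algebraMap _ L a * y) / algebraMap _ L d) < 1 := by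
  have hd : d ≠ 0 := by rintro rfl; simp at hb
  have hsplit : (algebraMap _ L b + algebraMap _ L a * y) / algebraMap _ L d =
      algebraMap (RatFunc k) L (algebraMap _ _ b / algebraMap _ _ d) +
        algebraMap (RatFunc k) L (algebraMap _ _ a / algebraMap _ _ d) * y := by
    simp only [map_div₀, ← IsScalarTower.algebraMap_apply]
    ring
  rw [hsplit, lt_one_iff_le_exp_neg_one, h.infinityExtension_le_exp_iff]
  obtain ⟨j, hj⟩ := hp
  exact ⟨infinityValuation_div_le hd (by omega), infinityValuation_div_le hd (by omega)⟩

variable [Algebra k L] [IsScalarTower k (RatFunc k) L] [Algebra.IsAlgebraic (RatFunc k) L]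

lemma valuation_div_lt_one_of_isRational [Finite k] (hp : Odd p.natDegree) {d : k[X]}
    (hd : X ^ Nat.card k - X ∣ d - 1) (hXa : X ^ Nat.card k - X ∣ a)
    (hXb : X ^ Nat.card k - X ∣ b) (hb : b.natDegree < d.natDegree)
    (ha : 2 * a.natDegree + p.natDegree < 2 * d.natDegree) {P : Place k L} (hP : P.IsRational) :
    P.ring.valuation ((algebraMap _ L b + algebraMap _ L a * y) / algebraMap _ L d) < 1 := by
  by_cases hX : algebraMap k[X] L X ∈ P.ring
  · have hvanish {c : k[X]} (hc : X ^ Nat.card k - X ∣ c) :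
        P.ring.valuation (algebraMap _ L c) < 1 := by
      obtain ⟨e, rfl⟩ := hc
      rw [map_mul, map_mul, map_sub, map_pow, mul_comm]
      exact mul_lt_one_of_nonneg_of_lt_one_right
        ((P.ring.valuation_le_one_iff _).2 (Place.polynomial_mem hX e)) zero_le
        (hP.valuation_pow_card_sub_self_lt_one hX)
    have hunit : P.ring.valuation (algebraMap _ L d) = 1 := by
      have := P.ring.valuation.map_one_add_of_lt (hvanish hd)
      rwa [map_sub, map_one, add_sub_cancel] at this
    rw [map_div₀, hunit, div_one]
    refine P.ring.valuation.map_add_lt (hvanish hXb) ?_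
    rw [map_mul, mul_comm]
    exact mul_lt_one_of_nonneg_of_lt_one_right
      ((P.ring.valuation_le_one_iff _).2 (h.gen_mem_of_X_mem hX)) zero_le (hvanish hXa)
  · rw [h.eq_infinityPlace hp hX]
    exact valuation_valuationSubring_lt_one_iff.2 (h.infinityExtension_div_lt_one hp hb ha)

end IsArtinSchreier

namespace IsValuationAt

variable {hq : Irreducible q}

lemma div_sub_div_le_one (hv : IsValuationAt hq B y v)
    (h : IsArtinSchreier (RatFunc k) L y (algebraMap _ _ p)) {C e : k[X]} {m : ℕ}
    (hC : q ∣ C - B) (he : p + C ^ 2 + C = q ^ m * e) (hab : q ^ m ∣ b - a * (C + 1)) :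
    v ((algebraMap _ L b + algebraMap _ L a * y) / algebraMap _ L q ^ m -
      algebraMap _ L a / algebraMap _ L q ^ m) ≤ 1 := by
  obtain ⟨c, hc⟩ := hab
  have hqm0 : algebraMap k[X] L q ^ m ≠ 0 :=
    pow_ne_zero m (algebraMap_polynomial_ne_zero hq.ne_zero)
  have hsplit : (algebraMap _ L b + algebraMap _ L a * y) / algebraMap _ L q ^ m -
      algebraMap _ L a / algebraMap _ L q ^ m =
        algebraMap _ L a * ((y + algebraMap _ L C) / algebraMap _ L q ^ m) + algebraMap _ L c := by
    rw [eq_add_of_sub_eq hc]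
    simp only [map_add, map_mul, map_pow, map_one]
    field_simp
    ring
  have hroot : v ((y + algebraMap _ L C) / algebraMap _ L q ^ m) ≤ 1 := by
    rw [map_div₀, map_pow, hv.uniformizer, ← exp_nsmul]
    refine div_le_one_of_le₀ ((hv.root_le h hC he).trans_eq ?_) zero_le
    simp
  rw [hsplit]
  refine v.map_add_le ?_ (hv.polynomial_le_one c)
  rw [map_mul]
  exact mul_le_one' (hv.polynomial_le_one a) hroot

end IsValuationAt

/-- Up to functions regular at `v` and functions `g² + g`, the function `z` is `a / q`. The
Artin–Schreier extension of equation `w² + w = z` only depends on such data near `v`. -/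
def HasReducedPolarPart (q : k[X]) (v : Valuation L ℤᵐ⁰) (z : L) (a : k[X]) : Prop :=
  ∃ g, v (z + g ^ 2 + g - algebraMap _ L a / algebraMap _ L q) ≤ 1

namespace HasReducedPolarPart

omit [Algebra (RatFunc k) L] [IsScalarTower k[X] (RatFunc k) L]

lemma zero : HasReducedPolarPart q v 0 0 :=
  ⟨0, by simp⟩

lemma add (h2 : (2 : L) = 0) {z z' : L} (hz : HasReducedPolarPart q v z a)
    (hz' : HasReducedPolarPart q v z' b) : HasReducedPolarPart q v (z + z') (a + b) := by
  obtain ⟨g, hg⟩ := hz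
  obtain ⟨g', hg'⟩ := hz'
  refine ⟨g + g', ?_⟩
  have hsplit : z + z' + (g + g') ^ 2 + (g + g') - algebraMap _ L (a + b) / algebraMap _ L q =
      (z + g ^ 2 + g - algebraMap _ L a / algebraMap _ L q) +
        (z' + g' ^ 2 + g' - algebraMap _ L b / algebraMap _ L q) := by
    rw [map_add]
    linear_combination g * g' * h2
  rw [hsplit]
  exact v.map_add_le hg hg'

end HasReducedPolarPart

lemma HasReducedPolarPart.exists_simple_pole {hq : Irreducible q} {z : L}
    (hz : HasReducedPolarPart q v z a) (hv : IsValuationAt hq B y v) (ha : a ≠ 0)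
    (hdeg : a.natDegree < q.natDegree) : ∃ g, v (z + g ^ 2 + g) = exp 1 := by
  obtain ⟨g, hg⟩ := hz
  have hpole : v (algebraMap _ L a / algebraMap _ L q) = exp 1 := by
    rw [map_div₀, hv.polynomial_eq_one ha hdeg, hv.uniformizer, one_div, ← exp_neg, neg_neg]
  refine ⟨g, ?_⟩
  rw [← hpole, ← sub_add_cancel (z + g ^ 2 + g) (algebraMap _ L a / algebraMap _ L q)]
  refine v.map_add_eq_of_lt_right (hg.trans_lt ?_)
  rw [hpole, ← exp_zero, exp_lt_exp]
  exact zero_lt_one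

end PolarPart

namespace IsArtinSchreier

variable {F L : Type*} [Field F] [Field L] [Algebra F L] {w : L} {f : F}

lemma of_adjoin_eq_top (h2 : (2 : F) = 0) (hw : w ^ 2 + w = algebraMap F L f)
    (hne : ∀ a, algebraMap F L a ≠ w) (htop : IntermediateField.adjoin F {w} = ⊤) :
    IsArtinSchreier F L w f where
  two_eq_zero := h2
  eq := hw
  exists_coords z := by
    have hint : IsIntegral F w := by
      refine ⟨X ^ 2 + (X - C f), monic_X_pow_add (by rw [degree_X_sub_C]; decide), ?_⟩
      simp [← hw]
    have hz : z ∈ Algebra.adjoin F {w} := by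
      rw [← IntermediateField.adjoin_simple_toSubalgebra_of_isAlgebraic hint.isAlgebraic, htop]
      exact Algebra.mem_top
    induction hz using Algebra.adjoin_induction with
    | mem z hz => exact ⟨0, 1, by rw [Set.mem_singleton_iff.1 hz]; simp⟩
    | algebraMap a => exact ⟨a, 0, by simp⟩
    | add z z' _ _ hz hz' =>
      obtain ⟨a, b, rfl⟩ := hz
      obtain ⟨a', b', rfl⟩ := hz'
      exact ⟨a + a', b + b', by simp only [map_add]; ring⟩
    | mul z z' _ _ hz hz' =>
      obtain ⟨a, b, rfl⟩ := hz
      obtain ⟨a', b', rfl⟩ := hz'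
      refine ⟨a * a' + b * b' * f, a * b' + b * a' - b * b', ?_⟩
      simp only [map_add, map_sub, map_mul, ← hw]
      ring
  ne_algebraMap := hne

lemma of_surjective {L' : Type*} [Field L'] [Algebra F L'] [Algebra L L'] [IsScalarTower F L L']
    (h : IsArtinSchreier F L w f) (hs : Function.Surjective (algebraMap L L')) :
    IsArtinSchreier F L' (algebraMap L L' w) f where
  two_eq_zero := h.two_eq_zero
  eq := by rw [← map_pow, ← map_add, h.eq, ← IsScalarTower.algebraMap_apply]
  exists_coords z := by
    obtain ⟨z, rfl⟩ := hs z
    obtain ⟨a, b, rfl⟩ := h.exists_coords z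
    exact ⟨a, b, by simp only [map_add, map_mul, ← IsScalarTower.algebraMap_apply]⟩
  ne_algebraMap a ha := h.ne_algebraMap a <| (algebraMap L L').injective <| by
    rw [← IsScalarTower.algebraMap_apply, ha]

end IsArtinSchreier

section UnramifiedPlace

variable {k L : Type*} [Field k] [Field L] [Algebra k L] [Algebra k[X] L] [Algebra (RatFunc k) L]
  [IsScalarTower k[X] (RatFunc k) L] [IsScalarTower k (RatFunc k) L]
  [Algebra.IsAlgebraic (RatFunc k) L] {y : L} {p q B : k[X]} {v : Valuation L ℤᵐ⁰}
  {hq : Irreducible q} {D₀ : Derivation k (RatFunc k) (RatFunc k)} {D : Derivation k L L}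

lemma IsValuationAt.hasPoleOfOrder_zero (hv : IsValuationAt hq B y v)
    (h : IsArtinSchreier (RatFunc k) L y (algebraMap _ _ p)) (hq' : derivative q ≠ 0)
    (hD₀ : ∀ a : k[X], D₀ (algebraMap _ _ a) = algebraMap _ _ (derivative a))
    (hD : ∀ a, D (algebraMap _ L a) = algebraMap _ L (D₀ a)) : HasPoleOfOrder D v 0 where
  map_le z hz := by
    obtain ⟨Q, -, hQ⟩ := Place.exists_ring_eq (P := adicPlace hq) hv.comap_valuationSubring
    have hX : algebraMap k[X] L X ∈ Q.ring := by
      rw [hQ]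
      exact hv.polynomial_le_one X
    have hDz := (h.isInvertibleAt_of_X_mem hD₀ hD hX).map_mem z (by rwa [hQ])
    rwa [hQ] at hDz
  exists_uniformizer := by
    refine ⟨algebraMap _ L q, hv.uniformizer, ?_⟩
    rw [IsScalarTower.algebraMap_apply k[X] (RatFunc k) L, hD, hD₀,
      ← IsScalarTower.algebraMap_apply, exp_zero]
    exact hv.polynomial_eq_one hq' (natDegree_derivative_lt hq.natDegree_pos.ne')

end UnramifiedPlace

/-- Every irreducible polynomial of degree `d` divides `X ^ (#k) ^ d - X`. -/
lemma irreducible_of_isCoprime_X_pow_card_pow_sub_X {k : Type*} [Field k] [Finite k] {q : k[X]}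
    (hq : q.Monic) (hq1 : q ≠ 1)
    (hcop : ∀ d, 0 < d → d ≤ q.natDegree / 2 → IsCoprime q (X ^ Nat.card k ^ d - X)) :
    Irreducible q := by
  rw [hq.irreducible_iff_lt_natDegree_lt hq1]
  intro a ha hdeg hdvd
  rw [Finset.mem_Ioc] at hdeg
  have hunit : ¬IsUnit a := fun hunit => by
    rw [ha.isUnit_iff.1 hunit, natDegree_one] at hdeg
    exact hdeg.1.false
  obtain ⟨r, hr, hra⟩ := WfDvdMonoid.exists_irreducible_factor hunit ha.ne_zero
  exact hr.not_isUnit <| (hcop r.natDegree hr.natDegree_pos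
      ((natDegree_le_of_dvd hra ha.ne_zero).trans hdeg.2)).isUnit_of_dvd' (hra.trans hdvd) <|
    hr.natDegree_dvd_iff_dvd_X_pow_card_pow_sub_X.1 dvd_rfl

lemma HasReducedPolarPart.smul {L : Type*} [Field L] [Algebra (ZMod 2)[X] L] [Algebra (ZMod 2) L]
    {q a : (ZMod 2)[X]} {v : Valuation L ℤᵐ⁰} {z : L} (hz : HasReducedPolarPart q v z a)
    (c : ZMod 2) : HasReducedPolarPart q v (c • z) (c • a) := by
  obtain rfl | rfl : c = 0 ∨ c = 1 := by decide +revert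
  · rw [zero_smul, zero_smul]
    exact .zero
  · rwa [one_smul, one_smul]

/-! ### Differentials and the genus -/

section CoordDerivation

variable (k F : Type*) [Field k] [Field F] [Algebra k F] [Algebra k[X] F] [IsScalarTower k k[X] F]
  [Algebra.FormallyEtale k[X] F]

/-- The differentials of an étale extension of `k[X]` are the multiples of `dX`. -/
noncomputable def kaehlerEquiv : Ω[F⁄k] ≃ₗ[F] F :=
  (KaehlerDifferential.tensorKaehlerEquivOfFormallyEtale k k[X] F).symm ≪≫ₗ
    TensorProduct.AlgebraTensorModule.congr (LinearEquiv.refl F F)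
      (KaehlerDifferential.polynomialEquiv k) ≪≫ₗ TensorProduct.AlgebraTensorModule.rid k[X] F F

/-- The derivation `d / dX` on an étale extension of `k[X]`. -/
noncomputable def coordDerivation : Derivation k F F :=
  (kaehlerEquiv k F).toLinearMap.compDer (KaehlerDifferential.D k F)

variable {k F}

lemma kaehlerEquiv_D (z : F) :
    kaehlerEquiv k F (KaehlerDifferential.D k F z) = coordDerivation k F z := rfl

lemma coordDerivation_algebraMap (a : k[X]) :
    coordDerivation k F (algebraMap k[X] F a) = algebraMap k[X] F (derivative a) := by
  rw [← kaehlerEquiv_D, kaehlerEquiv, LinearEquiv.trans_apply, LinearEquiv.trans_apply,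
    KaehlerDifferential.tensorKaehlerEquivOfFormallyEtale_symm_D_algebraMap]
  simp [Algebra.smul_def]

lemma derivation_eq_coordDerivation_smul {M : Type*} [AddCommGroup M] [Module k M] [Module F M]
    [IsScalarTower k F M] (δ : Derivation k F M) (z : F) :
    δ z = coordDerivation k F z • δ (algebraMap k[X] F X) := by
  have hD : KaehlerDifferential.D k F z =
      coordDerivation k F z • KaehlerDifferential.D k F (algebraMap k[X] F X) := by
    apply (kaehlerEquiv k F).injective
    rw [map_smul, kaehlerEquiv_D, kaehlerEquiv_D, coordDerivation_algebraMap, derivative_X,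
      map_one, smul_eq_mul, mul_one]
  rw [← δ.liftKaehlerDifferential_comp_D z, hD, map_smul, δ.liftKaehlerDifferential_comp_D]

lemma coordDerivation_algebraMap_field {L : Type*} [Field L] [Algebra k L] [Algebra k[X] L]
    [IsScalarTower k k[X] L] [Algebra.FormallyEtale k[X] L] [Algebra F L] [IsScalarTower k[X] F L]
    [IsScalarTower k F L] (z : F) :
    coordDerivation k L (algebraMap F L z) = algebraMap F L (coordDerivation k F z) := by
  have h := derivation_eq_coordDerivation_smul ((coordDerivation k L).compAlgebraMap F) z
  rwa [Derivation.compAlgebraMap_apply, Derivation.compAlgebraMap_apply,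
    ← IsScalarTower.algebraMap_apply, coordDerivation_algebraMap, derivative_X, map_one,
    Algebra.smul_def, mul_one] at h

end CoordDerivation

section RegularDifferentials

variable {k F : Type*} [Field k] [Field F] [Algebra k F] {D : Derivation k F F}
  {e : Ω[F⁄k] ≃ₗ[F] F} {P : Place k F} {v : Valuation F ℤᵐ⁰} {c : ℤ}

lemma Place.mem_regularDifferentials_iff (he : ∀ z, e (KaehlerDifferential.D k F z) = D z)
    {A : Submodule k F} (hA : ∀ a ∈ P.ring, ∀ b ∈ P.ring, a * D b ∈ A) {b : F} (hb : b ∈ P.ring)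
    (hDb : D b ≠ 0) (hAb : ∀ z ∈ A, z * (D b)⁻¹ ∈ P.ring) {ω : Ω[F⁄k]} :
    ω ∈ P.regularDifferentials ↔ e ω ∈ A := by
  constructor
  · suffices P.regularDifferentials ≤ A.comap (e.restrictScalars k).toLinearMap from fun h => this h
    refine Submodule.span_le.2 ?_
    rintro _ ⟨a, ha, b, hb, rfl⟩
    change e (a • KaehlerDifferential.D k F b) ∈ A
    rw [map_smul, he]
    exact hA a ha b hb
  · intro hω
    refine Submodule.subset_span ⟨_, hAb _ hω, b, hb, e.injective ?_⟩
    rw [map_smul, he, smul_eq_mul, inv_mul_cancel_right₀ hDb]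

lemma HasPoleOfOrder.mem_regularDifferentials_iff (hD : HasPoleOfOrder D v c)
    (he : ∀ z, e (KaehlerDifferential.D k F z) = D z) (hP : P.ring = v.valuationSubring)
    {ω : Ω[F⁄k]} : ω ∈ P.regularDifferentials ↔ v (e ω) ≤ exp c := by
  have hmem {z : F} : z ∈ P.ring ↔ v z ≤ 1 := by rw [hP, Valuation.mem_valuationSubring_iff]
  obtain ⟨π, hπ, hDπ⟩ := hD.exists_uniformizer
  let A : Submodule k F :=
    { carrier := {z | v z ≤ exp c}
      add_mem' := v.map_add_le
      zero_mem' := by simp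
      smul_mem' := fun r z hz => by
        rw [Set.mem_ofPred_eq, Algebra.smul_def, map_mul]
        exact mul_le_of_le_one_of_le (hmem.1 (P.algebraMap_mem r)) hz }
  refine Place.mem_regularDifferentials_iff he (A := A) (b := π) (fun a ha b hb => ?_)
    (hmem.2 ?_) (ne_zero_of_valuation_eq_exp hDπ) fun z hz => hmem.2 ?_
  · change v (a * D b) ≤ exp c
    rw [map_mul]
    exact mul_le_of_le_one_of_le (hmem.1 ha) (hD.map_le b (hmem.1 hb))
  · rw [hπ, ← exp_zero, exp_le_exp]
    norm_num
  · rw [map_mul, map_inv₀, hDπ]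
    exact (mul_le_mul_left hz _).trans (mul_inv_cancel₀ exp_ne_zero).le

lemma IsInvertibleAt.mem_regularDifferentials_iff (hD : IsInvertibleAt D P.ring)
    (he : ∀ z, e (KaehlerDifferential.D k F z) = D z) {ω : Ω[F⁄k]} :
    ω ∈ P.regularDifferentials ↔ e ω ∈ P.ring := by
  obtain ⟨b, hb, hDb⟩ := hD.exists_valuation_eq_one
  let A : Submodule k F :=
    { P.ring.toSubring.toAddSubgroup with
      smul_mem' := fun r z hz => by
        rw [Algebra.smul_def]
        exact P.ring.mul_mem _ _ (P.algebraMap_mem r) hz }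
  refine Place.mem_regularDifferentials_iff he (A := A)
    (fun a ha b hb => P.ring.mul_mem _ _ ha (hD.map_mem b hb)) hb ?_
    fun z hz => P.ring.mul_mem _ _ hz ?_
  · exact (Valuation.ne_zero_iff _).1 (hDb ▸ one_ne_zero)
  · rw [← ValuationSubring.valuation_le_one_iff, map_inv₀, hDb, inv_one]

end RegularDifferentials

section Genus

variable {K F : Type*} [Field K] [Field F] [Algebra K F] [Algebra (ZMod 2) K] [Algebra (ZMod 2) F]
  {S R : Submodule (ZMod 2) K} {D : Derivation (ZMod 2) F F} {v : Valuation F ℤᵐ⁰} {c : ℤ}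
  {g h N : ℕ} {e : Ω[F⁄ZMod 2] ≃ₗ[F] F}

lemma HasPoleOfOrder.exists_place_ring_eq (hD : HasPoleOfOrder D v c) :
    ∃ P : Place (ZMod 2) F, P.ring = v.valuationSubring := by
  refine ⟨⟨v.valuationSubring, fun c => ?_, fun htop => ?_⟩, rfl⟩
  · obtain rfl | rfl : c = 0 ∨ c = 1 := by decide +revert
    · rw [map_zero]
      exact zero_mem _
    · rw [map_one]
      exact one_mem _
  · obtain ⟨π, hπ, -⟩ := hD.exists_uniformizer
    have hinv : π⁻¹ ∈ v.valuationSubring := htop ▸ ValuationSubring.mem_top _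
    rw [Valuation.mem_valuationSubring_iff, map_inv₀, hπ, ← exp_neg, ← exp_zero,
      exp_le_exp] at hinv
    norm_num at hinv

namespace IsLevel

lemma mem_iInf_regularDifferentials (hl : IsLevel S R D v c g h N)
    (he : ∀ z, e (KaehlerDifferential.D (ZMod 2) F z) = D z) {ω : Ω[F⁄ZMod 2]} :
    ω ∈ (⨅ P : Place (ZMod 2) F, P.regularDifferentials) ↔ e ω ∈ poleSpace (ZMod 2) v c := by
  rw [Submodule.mem_iInf, mem_poleSpace, mem_regularAway]
  constructor
  · intro hω
    obtain ⟨P₀, hP₀⟩ := hl.hasPoleOfOrder.exists_place_ring_eq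
    exact ⟨fun P hP => ((hl.isInvertibleAt P hP).mem_regularDifferentials_iff he).1 (hω P),
      (hl.hasPoleOfOrder.mem_regularDifferentials_iff he hP₀).1 (hω P₀)⟩
  · rintro ⟨haway, hv⟩ P
    by_cases hP : P.ring = v.valuationSubring
    · exact (hl.hasPoleOfOrder.mem_regularDifferentials_iff he hP).2 hv
    · exact ((hl.isInvertibleAt P hP).mem_regularDifferentials_iff he).2 (haway P hP)

lemma genus_eq (hl : IsLevel S R D v c g h N)
    (he : ∀ z, e (KaehlerDifferential.D (ZMod 2) F z) = D z) : genus (ZMod 2) F = g := by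
  have hcard : Nat.card (⨅ P : Place (ZMod 2) F, P.regularDifferentials :
      Submodule (ZMod 2) (Ω[F⁄ZMod 2])) = 2 ^ g := by
    rw [← hl.card_poleSpace]
    exact Nat.card_congr (e.toEquiv.subtypeEquiv fun _ => hl.mem_iInf_regularDifferentials he)
  have := Nat.finite_of_card_ne_zero (hcard.trans_ne (by positivity))
  rw [Module.natCard_eq_pow_finrank (K := ZMod 2), Nat.card_zmod] at hcard
  exact Nat.pow_right_injective le_rfl hcard

end IsLevel

end Genus

/-! ### Absolute irreducibility -/

section AbsolutelyIrreducible

lemma exists_div_mem {F ι : Type*} [Field F] (V : ValuationSubring F) {s : Finset ι} {g : ι → F}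
    (hg : ∃ i ∈ s, g i ≠ 0) : ∃ j ∈ s, g j ≠ 0 ∧ ∀ i ∈ s, g i / g j ∈ V := by
  obtain ⟨i₀, hi₀, hgi₀⟩ := hg
  obtain ⟨j, hj, hmax⟩ := s.exists_max_image (fun i => V.valuation (g i)) ⟨i₀, hi₀⟩
  refine ⟨j, hj, fun hgj => hgi₀ ?_, fun i hi => ?_⟩
  · simpa only [hgj, map_zero, le_zero_iff, map_eq_zero] using hmax i₀ hi₀
  · rw [← V.valuation_le_one_iff, map_div₀]
    exact div_le_one_of_le₀ (hmax i hi) zero_le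

variable {k A F L ι : Type*} [Field k] [Field A] [Algebra k A] [Algebra.IsAlgebraic k A] [Field F]
  [Algebra k F] [Field L] [Algebra k L]

lemma Place.algHom_mem_ring (P : Place k L) (φ : A →ₐ[k] L) (a : A) : φ a ∈ P.ring := by
  let ι : k →+* P.ring := (algebraMap k L).codRestrict P.ring.toSubring P.algebraMap_mem
  have hint : IsIntegral P.ring (φ a) := by
    obtain ⟨p, hp, hpa⟩ := (Algebra.IsIntegral.isIntegral (R := k) a).map φ
    refine ⟨p.map ι, hp.map _, ?_⟩
    rw [Polynomial.eval₂_map, ← hpa]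
    rfl
  obtain ⟨b, hb⟩ := IsIntegrallyClosed.isIntegral_iff.1 hint
  exact hb ▸ b.2

lemma Place.eq_zero_of_valuation_algHom_lt_one (P : Place k L) (φ : A →ₐ[k] L) {a : A}
    (ha : P.ring.valuation (φ a) < 1) : a = 0 := by
  by_contra h0
  have hinv : P.ring.valuation (φ a⁻¹) ≤ 1 :=
    (P.ring.valuation_le_one_iff _).2 (P.algHom_mem_ring φ _)
  have hlt : P.ring.valuation (φ a * φ a⁻¹) < 1 := by
    rw [map_mul]
    exact mul_lt_one_of_nonneg_of_lt_one_left zero_le ha hinv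
  rw [← map_mul, mul_inv_cancel₀ h0, map_one, map_one] at hlt
  exact lt_irrefl _ hlt

variable [Algebra F L] [IsScalarTower k F L] [Algebra.IsAlgebraic F L]

lemma Place.IsRational.valuation_lt_one_of_sum_eq_zero {Q : Place k L}
    (hQ : (Q.comap F).IsRational) (φ : A →ₐ[k] L) {b : ι → A} (hb : LinearIndependent k b)
    {s : Finset ι} {g : ι → F} (hg : ∀ i ∈ s, g i ∈ (Q.comap F).ring)
    (hsum : ∑ i ∈ s, g i • φ (b i) = 0) {j : ι} (hj : j ∈ s) :
    (Q.comap F).ring.valuation (g j) < 1 := by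
  choose! c hc using fun i hi => hQ (g i) (hg i hi)
  have hcomb : φ (∑ i ∈ s, c i • b i) =
      -∑ i ∈ s, algebraMap F L (g i - algebraMap k F (c i)) * φ (b i) := by
    simp only [map_sub, sub_mul, Finset.sum_sub_distrib, ← Algebra.smul_def, hsum, zero_sub,
      neg_neg, map_sum, map_smul, ← IsScalarTower.algebraMap_apply]
  have hlt : Q.ring.valuation (φ (∑ i ∈ s, c i • b i)) < 1 := by
    rw [hcomb, Valuation.map_neg]
    refine Valuation.map_sum_lt _ one_ne_zero fun i hi => ?_
    rw [map_mul]
    exact mul_lt_one_of_nonneg_of_lt_one_left zero_le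
      (Place.valuation_comap_lt_one_iff.1 (hc i hi))
      ((Q.ring.valuation_le_one_iff _).2 (Q.algHom_mem_ring φ _))
  have hcj := linearIndependent_iff'.1 hb s c (Q.eq_zero_of_valuation_algHom_lt_one φ hlt) j hj
  simpa only [hcj, map_zero, sub_zero] using hc j hj

lemma Place.IsRational.linearIndependent_algHom {P : Place k F} (hP : P.IsRational)
    (φ : A →ₐ[k] L) {b : ι → A} (hb : LinearIndependent k b) :
    LinearIndependent F fun i => φ (b i) := by
  obtain ⟨Q, rfl⟩ := P.exists_comap_eq L
  rw [linearIndependent_iff']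
  intro s g hg
  by_contra! hne
  obtain ⟨j, hj, hgj, hmem⟩ := exists_div_mem (Q.comap F).ring hne
  have hsum : ∑ i ∈ s, (g i / g j) • φ (b i) = 0 := by
    simp only [div_eq_inv_mul, mul_smul, ← Finset.smul_sum, hg, smul_zero]
  have hlt := hP.valuation_lt_one_of_sum_eq_zero φ hb hmem hsum hj
  rw [div_self hgj, map_one] at hlt
  exact lt_irrefl _ hlt

theorem Place.IsRational.isAbsolutelyIrreducible {P : Place k F} (hP : P.IsRational) :
    IsAbsolutelyIrreducible k F := by
  let φ : AlgebraicClosure k →ₐ[k] AlgebraicClosure F := IsAlgClosed.lift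
  let b := Module.Basis.ofVectorSpace k (AlgebraicClosure k)
  have hdisj : φ.fieldRange.LinearDisjoint F :=
    .of_basis_left (b.map (AlgEquiv.ofInjectiveField φ).toLinearEquiv)
      (hP.linearIndependent_algHom φ b.linearIndependent)
  have : IsDomain (φ.range ⊗[k] F) := hdisj.isDomain
  exact (Algebra.TensorProduct.congr (AlgEquiv.ofInjectiveField φ)
    (AlgEquiv.refl (R := k) (A₁ := F))).toMulEquiv.isDomain _

end AbsolutelyIrreducible

section ArtinSchreier

variable {F L : Type*} [Field F] [Field L] [Algebra F L] {w : L} {f : F}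

lemma isSeparable_of_sq_add_self (h2 : (2 : F) = 0) (hw : w ^ 2 + w = algebraMap F L f) :
    IsSeparable F w := by
  have hderiv : derivative (X ^ 2 + X - C f : F[X]) = 1 := by
    rw [derivative_sub, derivative_add, derivative_X_pow, derivative_X, derivative_C,
      Nat.cast_ofNat, h2, map_zero, zero_mul, zero_add, sub_zero]
  have hsep : (X ^ 2 + X - C f : F[X]).Separable := by
    rw [separable_def, hderiv]
    exact isCoprime_one_right
  exact hsep.of_dvd (minpoly.dvd F w (by simp [hw]))

lemma IsArtinSchreier.isSeparable (h : IsArtinSchreier F L w f) : Algebra.IsSeparable F L := by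
  refine ⟨fun z => ?_⟩
  obtain ⟨a, b, rfl⟩ := h.exists_coords z
  exact Field.isSeparable_add (isSeparable_algebraMap a) (Field.isSeparable_mul
    (isSeparable_algebraMap b) (isSeparable_of_sq_add_self h.two_eq_zero h.eq))

lemma sq_add_self_add (h2 : (2 : F) = 0) (a b : F) :
    (a + b) ^ 2 + (a + b) = (a ^ 2 + a) + (b ^ 2 + b) := by
  linear_combination a * b * h2

lemma eq_or_eq_add_one_of_sq_add_self_eq (h2 : (2 : F) = 0) {a b : F}
    (h : a ^ 2 + a = b ^ 2 + b) : a = b ∨ a = b + 1 := by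
  have hmul : (a - b) * (a - (b + 1)) = 0 := by
    linear_combination h - (a + a * b - b - b ^ 2) * h2
  exact (mul_eq_zero.1 hmul).imp sub_eq_zero.1 sub_eq_zero.1

lemma exists_sq_add_self_eq [IsAlgClosed F] (f : F) : ∃ w, w ^ 2 + w = f := by
  have hdeg : (X ^ 2 + X - C f).degree = 2 := by compute_degree!
  obtain ⟨w, hw⟩ := IsAlgClosed.exists_root (X ^ 2 + X - C f) (hdeg.trans_ne two_ne_zero)
  exact ⟨w, sub_eq_zero.1 (by simpa using hw)⟩

lemma IsArtinSchreier.exists_sq_add_self_eq_or (h : IsArtinSchreier F L w f) {g : F} {z : L}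
    (hz : z ^ 2 + z = algebraMap F L g) : ∃ a : F, a ^ 2 + a = g ∨ a ^ 2 + a = g + f := by
  have h2 := h.two_eq_zero
  obtain ⟨a, b, rfl⟩ := h.exists_coords z
  have hcoords : algebraMap F L (a ^ 2 + a + b ^ 2 * f) + algebraMap F L (b ^ 2 + b) * w =
      algebraMap F L g + algebraMap F L 0 * w := by
    rw [map_zero, zero_mul, add_zero, ← hz]
    simp only [map_add, map_mul, map_pow, ← h.eq]
    linear_combination (algebraMap F L b ^ 2 * w - algebraMap F L a * algebraMap F L b * w) *
      h.two_eq_zero_right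
  obtain ⟨hg, hb⟩ := h.coords_unique hcoords
  rcases eq_or_eq_add_one_of_sq_add_self_eq h2 (b := 0) (hb.trans (by ring)) with rfl | rfl
  · exact ⟨a, Or.inl (by linear_combination hg)⟩
  · exact ⟨a, Or.inr (by linear_combination hg - f * h2)⟩

end ArtinSchreier

/-! ### Roots of `T² + T + r` -/

section Root

open IntermediateField

variable {K Ω : Type*} [Field K] [Field Ω] [Algebra K Ω]

lemma adjoin_simple_eq_top_of_forall_mem {L : Type*} [Field L] [Algebra K L] [Algebra L Ω]
    [IsScalarTower K L Ω] {w : L} (h : ∀ z, algebraMap L Ω z ∈ K⟮algebraMap L Ω w⟯) :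
    K⟮w⟯ = ⊤ := by
  refine eq_top_iff.2 fun z _ => ?_
  have hz : algebraMap L Ω z ∈ K⟮w⟯.map (IsScalarTower.toAlgHom K L Ω) := by
    rw [adjoin_map, Set.image_singleton]
    exact h z
  obtain ⟨z', hz', hzz'⟩ := hz
  rwa [← (algebraMap L Ω).injective hzz']

variable {M N : IntermediateField K Ω} {f r : K} {w z : Ω}

lemma mem_sup_adjoin_simple : w ∈ M ⊔ K⟮w⟯ :=
  le_sup_right (a := M) (mem_adjoin_simple_self K w)

lemma isArtinSchreier_of_eq_sup (h2 : (2 : K) = 0) (hw : w ^ 2 + w = algebraMap K Ω f)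
    (hwM : w ∉ M) [Algebra M N] [IsScalarTower M N Ω] (hN : N = M ⊔ K⟮w⟯) :
    IsArtinSchreier M N ⟨w, hN ▸ mem_sup_adjoin_simple⟩ (algebraMap K M f) := by
  have hcoe (a : M) : (algebraMap M N a : Ω) = a := (IsScalarTower.algebraMap_apply M N Ω a).symm
  refine .of_adjoin_eq_top ?_ (Subtype.ext ?_) (fun a ha => hwM ?_)
    (adjoin_simple_eq_top_of_forall_mem (Ω := Ω) fun z => ?_)
  · rw [← map_ofNat (algebraMap K M), h2, map_zero]
  · rw [hcoe]
    exact hw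
  · rw [← show (algebraMap M N a : Ω) = w from congrArg Subtype.val ha, hcoe]
    exact a.2
  · have hz : (z : Ω) ∈ M ⊔ K⟮w⟯ := hN ▸ z.2
    rwa [← restrictScalars_adjoin_eq_sup] at hz

lemma relfinrank_sup_adjoin_simple (h2 : (2 : K) = 0) (hw : w ^ 2 + w = algebraMap K Ω f)
    (hwM : w ∉ M) : relfinrank M (M ⊔ K⟮w⟯) = 2 := by
  let _ := (inclusion (le_sup_left : M ≤ M ⊔ K⟮w⟯)).toAlgebra
  have : IsScalarTower M (M ⊔ K⟮w⟯ : IntermediateField K Ω) Ω := .of_algebraMap_eq fun _ => rfl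
  rw [relfinrank_eq_finrank_of_le le_sup_left]
  exact (isArtinSchreier_of_eq_sup h2 hw hwM rfl).finrank_eq_two

lemma exists_sq_add_self_eq_or_of_mem_sup (h2 : (2 : K) = 0) (hw : w ^ 2 + w = algebraMap K Ω f)
    (hwM : w ∉ M) (hz : z ∈ M ⊔ K⟮w⟯) (hzr : z ^ 2 + z = algebraMap K Ω r) :
    ∃ a ∈ M, a ^ 2 + a = algebraMap K Ω r ∨ a ^ 2 + a = algebraMap K Ω (r + f) := by
  let _ := (inclusion (le_sup_left : M ≤ M ⊔ K⟮w⟯)).toAlgebra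
  have : IsScalarTower M (M ⊔ K⟮w⟯ : IntermediateField K Ω) Ω := .of_algebraMap_eq fun _ => rfl
  obtain ⟨a, ha⟩ := (isArtinSchreier_of_eq_sup h2 hw hwM rfl).exists_sq_add_self_eq_or
    (g := algebraMap K M r) (z := ⟨z, hz⟩) (Subtype.ext hzr)
  refine ⟨a, a.2, ha.imp (congrArg Subtype.val) fun ha => ?_⟩
  rw [map_add]
  exact congrArg Subtype.val ha

/-- The elements `r` of `V` for which `T ^ 2 + T + r` has its zeros in `M`. -/
def rootSpace [Algebra (ZMod 2) K] (V : Submodule (ZMod 2) K) (M : IntermediateField K Ω) :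
    Submodule (ZMod 2) K where
  carrier := {r | r ∈ V ∧ ∃ w ∈ M, w ^ 2 + w = algebraMap K Ω r}
  add_mem' := by
    rintro r s ⟨hr, u, hu, hur⟩ ⟨hs, w, hw, hws⟩
    refine ⟨add_mem hr hs, u + w, add_mem hu hw, ?_⟩
    have := charP_of_injective_algebraMap (algebraMap (ZMod 2) K).injective 2
    have := charP_of_injective_algebraMap (algebraMap K Ω).injective 2
    rw [map_add, ← hur, ← hws, sq_add_self_add CharTwo.two_eq_zero]
  zero_mem' := ⟨zero_mem _, 0, zero_mem _, by simp⟩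
  smul_mem' := by
    rintro c r ⟨hr, hr'⟩
    obtain rfl | rfl : c = 0 ∨ c = 1 := by decide +revert
    · rw [zero_smul]
      exact ⟨zero_mem _, 0, zero_mem _, by simp⟩
    · rw [one_smul]
      exact ⟨hr, hr'⟩

variable [Algebra (ZMod 2) K] {V : Submodule (ZMod 2) K}

lemma rootSpace_le : rootSpace V M ≤ V := fun _ hr => hr.1

lemma rootSpace_mono (hMN : M ≤ N) : rootSpace V M ≤ rootSpace V N :=
  fun _ ⟨hr, w, hw, hwr⟩ => ⟨hr, w, hMN hw, hwr⟩

lemma rootSpace_sup_adjoin_simple (hw : w ^ 2 + w = algebraMap K Ω f) (hf : f ∈ V)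
    (hwM : w ∉ M) :
    rootSpace V (M ⊔ K⟮w⟯) = rootSpace V M ⊔ Submodule.span (ZMod 2) {f} := by
  have h2 : (2 : K) = 0 := by
    have := charP_of_injective_algebraMap (algebraMap (ZMod 2) K).injective 2
    exact CharTwo.two_eq_zero
  refine le_antisymm ?_ (sup_le (rootSpace_mono le_sup_left)
    ((Submodule.span_singleton_le_iff_mem _ _).2 ⟨hf, w, mem_sup_adjoin_simple, hw⟩))
  rintro r ⟨hr, z, hz, hzr⟩
  obtain ⟨a, haM, ha | ha⟩ := exists_sq_add_self_eq_or_of_mem_sup h2 hw hwM hz hzr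
  · exact Submodule.mem_sup_left ⟨hr, a, haM, ha⟩
  · rw [← add_sub_cancel_right r f]
    exact sub_mem (Submodule.mem_sup_left ⟨add_mem hr hf, a, haM, ha⟩)
      (Submodule.mem_sup_right (Submodule.mem_span_singleton_self f))

end Root

section Subspaces

variable {k M : Type*}

lemma natCard_sup_span_singleton [Field k] [AddCommGroup M] [Module k M] {R : Submodule k M} {f : M}
    (hf : f ∉ R) :
    Nat.card (R ⊔ Submodule.span k {f} : Submodule k M) = Nat.card R * Nat.card k := by
  have hf0 : f ≠ 0 := fun h => hf (h ▸ R.zero_mem)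
  let φ : (R × k) →ₗ[k] M := R.subtype.coprod (LinearMap.toSpanSingleton k M f)
  have hker : LinearMap.ker φ = ⊥ := by
    rw [LinearMap.ker_coprod_of_disjoint_range, R.ker_subtype,
      LinearMap.ker_toSpanSingleton k hf0, Submodule.prod_bot]
    rw [R.range_subtype, LinearMap.range_toSpanSingleton]
    exact (Submodule.disjoint_span_singleton' hf0).2 hf
  have hrange : LinearMap.range φ = R ⊔ Submodule.span k {f} := by
    rw [LinearMap.range_coprod, R.range_subtype, LinearMap.range_toSpanSingleton]
  rw [← hrange, ← Nat.card_prod]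
  exact Nat.card_congr (LinearEquiv.ofInjective φ (LinearMap.ker_eq_bot.1 hker)).symm.toEquiv

lemma sup_span_singleton_induction [Semiring k] [AddCommMonoid M] [Module k M]
    {R₀ R : Submodule k M} (hR : R.FG) (hle : R₀ ≤ R) {Q : Submodule k M → Prop} (base : Q R₀)
    (step : ∀ T f, R₀ ≤ T → T ≤ R → f ∈ R → f ∉ T → Q T → Q (T ⊔ Submodule.span k {f})) :
    Q R := by
  classical
  obtain ⟨t, rfl⟩ := hR
  suffices key : ∀ s ⊆ t, Q (R₀ ⊔ Submodule.span k s) by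
    simpa only [sup_eq_right.2 hle] using key t subset_rfl
  intro s
  induction s using Finset.induction_on with
  | empty => simpa using base
  | insert f s _ ih =>
    intro hs
    obtain ⟨hf, hs⟩ := Finset.insert_subset_iff.1 hs
    rw [Finset.coe_insert, Submodule.span_insert, sup_comm (Submodule.span k {f}), ← sup_assoc]
    by_cases hmem : f ∈ R₀ ⊔ Submodule.span k s
    · rw [sup_eq_left.2 ((Submodule.span_singleton_le_iff_mem _ _).2 hmem)]
      exact ih hs
    · exact step _ f le_sup_left (sup_le hle (Submodule.span_mono (by exact_mod_cast hs)))
        (Submodule.subset_span hf) hmem (ih hs)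

end Subspaces

end FunctionFieldCurve

namespace SerreCurve

open FunctionFieldCurve IntermediateField Polynomial WithZero WeierstrassCurve.Affine

lemma E_coeffs : E.a₁ = 0 ∧ E.a₂ = 0 ∧ E.a₃ = 1 ∧ E.a₄ = 1 ∧ E.a₆ = 0 :=
  ⟨rfl, rfl, rfl, rfl, rfl⟩

noncomputable instance algebraRatFunc : Algebra (RatFunc (ZMod 2)) K :=
  RatFunc.liftAlgebra (ZMod 2) K

lemma algebraMap_X : algebraMap (ZMod 2)[X] K X = x := rfl

lemma algebraMap_smul_basis (a b : (ZMod 2)[X]) :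
    algebraMap E.CoordinateRing K (a • 1 + b • CoordinateRing.mk E X) =
      algebraMap _ K a + algebraMap _ K b * y := by
  rw [CoordinateRing.smul, CoordinateRing.smul, mul_one, map_add, map_mul]
  rfl

lemma y_sq_add_y : y ^ 2 + y = algebraMap (ZMod 2)[X] K (X ^ 3 + X) := by
  have h := congrArg (algebraMap E.CoordinateRing K)
    (CoordinateRing.smul_basis_mul_Y (W' := E) 0 1)
  obtain ⟨h₁, h₂, h₃, h₄, h₆⟩ := E_coeffs
  rw [map_mul, algebraMap_smul_basis, algebraMap_smul_basis, h₁, h₂, h₃, h₄, h₆] at h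
  change (_ + _ * y) * y = _ at h
  simp only [map_zero, map_one, map_add, map_sub, map_mul, map_pow] at h ⊢
  linear_combination h

lemma algebraMap_ratFunc_ne_y (a : RatFunc (ZMod 2)) : algebraMap _ K a ≠ y := by
  intro ha
  obtain ⟨n, d, hd, rfl⟩ := IsFractionRing.div_surjective (A := (ZMod 2)[X]) a
  have hd0 := nonZeroDivisors.ne_zero hd
  rw [map_div₀, ← IsScalarTower.algebraMap_apply, ← IsScalarTower.algebraMap_apply,
    div_eq_iff (algebraMap_polynomial_ne_zero hd0)] at ha
  refine hd0 (CoordinateRing.smul_basis_eq_zero (W' := E) (p := -n) (q := d)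
    (IsFractionRing.injective _ K ?_)).2
  rw [algebraMap_smul_basis, map_zero, map_neg, ha]
  ring

lemma adjoin_y_eq_top : IntermediateField.adjoin (RatFunc (ZMod 2)) {y} = ⊤ := by
  have hmem (c : E.CoordinateRing) :
      algebraMap _ K c ∈ IntermediateField.adjoin (RatFunc (ZMod 2)) {y} := by
    obtain ⟨a, b, rfl⟩ := CoordinateRing.exists_smul_basis_eq c
    rw [algebraMap_smul_basis, IsScalarTower.algebraMap_apply _ (RatFunc (ZMod 2)) K a,
      IsScalarTower.algebraMap_apply _ (RatFunc (ZMod 2)) K b]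
    exact add_mem (IntermediateField.algebraMap_mem _ _) <| mul_mem
      (IntermediateField.algebraMap_mem _ _) (IntermediateField.mem_adjoin_simple_self _ _)
  refine eq_top_iff.2 fun z _ => ?_
  obtain ⟨c, d, -, rfl⟩ := IsFractionRing.div_surjective (A := E.CoordinateRing) z
  exact div_mem (hmem c) (hmem d)

lemma isArtinSchreier_K :
    IsArtinSchreier (RatFunc (ZMod 2)) K y (algebraMap (ZMod 2)[X] _ (X ^ 3 + X)) :=
  .of_adjoin_eq_top CharTwo.two_eq_zero (by rw [y_sq_add_y, ← IsScalarTower.algebraMap_apply])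
    algebraMap_ratFunc_ne_y adjoin_y_eq_top

lemma two_eq_zero : (2 : (ZMod 2)[X]) = 0 := CharTwo.two_eq_zero

/-- The polynomial whose zero on the `x`-line lies below the only place of `𝔽₂(E)` that ramifies in
the fields `𝔽₂(X_R)`. -/
noncomputable def branchPolynomial : (ZMod 2)[X] := X ^ 7 + X + 1

/-- The value of `y` at the ramified place, as a polynomial in `x`. -/
noncomputable def branchRoot : (ZMod 2)[X] := X ^ 6 + X ^ 5 + X ^ 2 + X

/-- The lift of `branchRoot` to a root of `T² + T + X³ + X` modulo the square of
`branchPolynomial`. -/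
noncomputable def branchRootLift : (ZMod 2)[X] := X ^ 12 + X ^ 10 + X ^ 4 + X ^ 3 + X ^ 2 + X

lemma branchPolynomial_monic : branchPolynomial.Monic := by
  unfold branchPolynomial
  monicity!

lemma natDegree_branchPolynomial : branchPolynomial.natDegree = 7 := by
  unfold branchPolynomial
  compute_degree!

lemma derivative_branchPolynomial_ne_zero : derivative branchPolynomial ≠ 0 := by
  intro h
  have := congrArg (coeff · 0) h
  simp [branchPolynomial] at this

lemma irreducible_branchPolynomial : Irreducible branchPolynomial := by
  refine irreducible_of_isCoprime_X_pow_card_pow_sub_X branchPolynomial_monic ?_ fun d hd hd' => ?_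
  · intro h
    simpa [h] using natDegree_branchPolynomial
  rw [natDegree_branchPolynomial] at hd'
  rw [Nat.card_zmod, branchPolynomial]
  interval_cases d
  · exact ⟨1, X ^ 5 + X ^ 4 + X ^ 3 + X ^ 2 + X + 1, by
      linear_combination (X ^ 7 : (ZMod 2)[X]) * two_eq_zero⟩
  · exact ⟨1, X ^ 3 + 1, by linear_combination (X ^ 7 : (ZMod 2)[X]) * two_eq_zero⟩
  · exact ⟨X ^ 7 + X ^ 6 + 1, X ^ 6 + X ^ 5 + 1, by
      linear_combination (X ^ 14 + X ^ 13 + X ^ 8 + X ^ 7 : (ZMod 2)[X]) * two_eq_zero⟩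

lemma natDegree_X_pow_three_add_X : (X ^ 3 + X : (ZMod 2)[X]).natDegree = 3 := by
  compute_degree!

lemma natDegree_derivative_X_pow_three_add_X :
    (derivative (X ^ 3 + X : (ZMod 2)[X])).natDegree = 2 := by
  have h : derivative (X ^ 3 + X : (ZMod 2)[X]) = X ^ 2 + 1 := by
    simp only [derivative_add, derivative_X_pow, derivative_X, Nat.cast_ofNat, map_ofNat]
    linear_combination X ^ 2 * two_eq_zero
  rw [h]
  compute_degree!

lemma branchRoot_equation :
    X ^ 3 + X + branchRoot ^ 2 + branchRoot = branchPolynomial * (X ^ 5 + X ^ 3) := by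
  unfold branchRoot branchPolynomial
  linear_combination
    (X ^ 11 + X ^ 8 + 2 * X ^ 7 + X ^ 6 + X ^ 3 + X ^ 2 + X : (ZMod 2)[X]) * two_eq_zero

lemma branchRootLift_equation : X ^ 3 + X + branchRootLift ^ 2 + branchRootLift =
    branchPolynomial ^ 2 * (X ^ 10 + X ^ 6) := by
  unfold branchRootLift branchPolynomial
  linear_combination (X ^ 22 - X ^ 18 - X ^ 17 + X ^ 16 + X ^ 15 + X ^ 14 + X ^ 13 + X ^ 12 +
    X ^ 6 + 2 * X ^ 5 + 2 * X ^ 4 + 2 * X ^ 3 + X ^ 2 + X : (ZMod 2)[X]) * two_eq_zero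

lemma branchPolynomial_dvd_branchRootLift_sub :
    branchPolynomial ∣ branchRootLift - branchRoot := by
  refine ⟨X ^ 5 + X ^ 3, ?_⟩
  unfold branchPolynomial branchRootLift branchRoot
  linear_combination (-X ^ 6 - X ^ 5 : (ZMod 2)[X]) * two_eq_zero

lemma X_sq_sub_X_dvd_of_eq {a c : (ZMod 2)[X]} (h : a = (X ^ 2 + X) * c) : X ^ 2 - X ∣ a :=
  ⟨c, by linear_combination h + X * c * two_eq_zero⟩

lemma X_sq_sub_X_dvd_branchPolynomial_pow_sub_one (m : ℕ) :
    X ^ 2 - X ∣ branchPolynomial ^ m - 1 := by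
  have h : X ^ 2 - X ∣ branchPolynomial - 1 := by
    refine X_sq_sub_X_dvd_of_eq (c := X ^ 5 + X ^ 4 + X ^ 3 + X ^ 2 + X + 1) ?_
    unfold branchPolynomial
    linear_combination (-X ^ 6 - X ^ 5 - X ^ 4 - X ^ 3 - X ^ 2 : (ZMod 2)[X]) * two_eq_zero
  simpa using h.trans (sub_dvd_pow_sub_pow branchPolynomial 1 m)

/-- The function `f = (b + a y) / q ^ m` on `E`, with `q = branchPolynomial`, is regular away from
the place where `q` and `y + branchRoot` vanish, and vanishes at the rational places. -/
structure IsPolarForm (f : K) (m : ℕ) (a b : (ZMod 2)[X]) : Prop where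
  eq_div : f = (algebraMap _ K b + algebraMap _ K a * y) / algebraMap _ K branchPolynomial ^ m
  exists_root : ∃ C e, branchPolynomial ∣ C - branchRoot ∧
    X ^ 3 + X + C ^ 2 + C = branchPolynomial ^ m * e ∧ branchPolynomial ^ m ∣ b - a * (C + 1)
  dvd_left : X ^ 2 - X ∣ a
  dvd_right : X ^ 2 - X ∣ b
  natDegree_left : 2 * a.natDegree + 3 < 2 * (7 * m)
  natDegree_right : b.natDegree < 7 * m

lemma isPolarForm_f₁ : IsPolarForm f₁ 1 (X ^ 5 + X) (X ^ 2 + X) where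
  eq_div := by
    simp only [f₁, branchPolynomial, map_add, map_pow, map_one, algebraMap_X, pow_one]
    ring
  exists_root := by
    refine ⟨branchRoot, X ^ 5 + X ^ 3, by simp, by rw [pow_one, branchRoot_equation],
      X ^ 4 + X ^ 3, ?_⟩
    unfold branchPolynomial branchRoot
    linear_combination
      -(X ^ 11 + X ^ 10 + X ^ 7 + X ^ 6 + X ^ 5 + X ^ 4 + X ^ 3 : (ZMod 2)[X]) * two_eq_zero
  dvd_left := X_sq_sub_X_dvd_of_eq (c := X ^ 3 + X ^ 2 + X + 1) <| by
    linear_combination -(X ^ 4 + X ^ 3 + X ^ 2 : (ZMod 2)[X]) * two_eq_zero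
  dvd_right := X_sq_sub_X_dvd_of_eq (mul_one _).symm
  natDegree_left := by
    rw [show (X ^ 5 + X : (ZMod 2)[X]).natDegree = 5 by compute_degree!]
    norm_num
  natDegree_right := by
    rw [show (X ^ 2 + X : (ZMod 2)[X]).natDegree = 2 by compute_degree!]
    norm_num

lemma isPolarForm_f₂ : IsPolarForm f₂ 1 (X ^ 5 + X ^ 4 + X ^ 3 + X) (X ^ 6 + X ^ 4) where
  eq_div := by
    simp only [f₂, branchPolynomial, map_add, map_pow, map_one, algebraMap_X, pow_one]
    ring
  exists_root := by
    refine ⟨branchRoot, X ^ 5 + X ^ 3, by simp, by rw [pow_one, branchRoot_equation],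
      X ^ 4 + X, ?_⟩
    unfold branchPolynomial branchRoot
    linear_combination -(X ^ 11 + X ^ 10 + X ^ 9 + X ^ 8 + X ^ 7 + X ^ 6 + 2 * X ^ 5 + X ^ 4 +
      X ^ 3 + X ^ 2 + X : (ZMod 2)[X]) * two_eq_zero
  dvd_left := X_sq_sub_X_dvd_of_eq (c := X ^ 3 + X + 1) <| by
    linear_combination -(X ^ 2 : (ZMod 2)[X]) * two_eq_zero
  dvd_right := X_sq_sub_X_dvd_of_eq (c := X ^ 4 + X ^ 3) <| by
    linear_combination -(X ^ 5 : (ZMod 2)[X]) * two_eq_zero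
  natDegree_left := by
    rw [show (X ^ 5 + X ^ 4 + X ^ 3 + X : (ZMod 2)[X]).natDegree = 5 by compute_degree!]
    norm_num
  natDegree_right := by
    rw [show (X ^ 6 + X ^ 4 : (ZMod 2)[X]).natDegree = 6 by compute_degree!]
    norm_num

lemma isPolarForm_f₃ : IsPolarForm f₃ 2 (X ^ 6 + X ^ 5) (X ^ 10 + X ^ 6 + X ^ 2 + X) where
  eq_div := by
    have hsq : x ^ 14 + x ^ 2 + 1 = (x ^ 7 + x + 1) ^ 2 := by
      linear_combination (-x ^ 8 - x ^ 7 - x) * isArtinSchreier_K.two_eq_zero_right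
    simp only [f₃, branchPolynomial, map_add, map_pow, map_one, algebraMap_X, hsq]
    ring
  exists_root := by
    refine ⟨branchRootLift, X ^ 10 + X ^ 6, branchPolynomial_dvd_branchRootLift_sub,
      branchRootLift_equation, X ^ 4 + X ^ 3 + X ^ 2 + X, ?_⟩
    unfold branchPolynomial branchRootLift
    linear_combination -(X ^ 18 + X ^ 17 + X ^ 16 + X ^ 15 + X ^ 12 + 2 * X ^ 11 + 2 * X ^ 10 +
      3 * X ^ 9 + 2 * X ^ 8 + X ^ 7 + X ^ 6 + 2 * X ^ 5 + 2 * X ^ 4 + 2 * X ^ 3 + X ^ 2 :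
        (ZMod 2)[X]) * two_eq_zero
  dvd_left := X_sq_sub_X_dvd_of_eq (c := X ^ 4) (by ring)
  dvd_right := X_sq_sub_X_dvd_of_eq (c := X ^ 8 + X ^ 7 + X ^ 6 + X ^ 5 + 1) <| by
    linear_combination -(X ^ 9 + X ^ 8 + X ^ 7 : (ZMod 2)[X]) * two_eq_zero
  natDegree_left := by
    rw [show (X ^ 6 + X ^ 5 : (ZMod 2)[X]).natDegree = 6 by compute_degree!]
    norm_num
  natDegree_right := by
    rw [show (X ^ 10 + X ^ 6 + X ^ 2 + X : (ZMod 2)[X]).natDegree = 10 by compute_degree!]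
    norm_num

namespace IsPolarForm

variable {L : Type*} [Field L] [Algebra K L] [Algebra (ZMod 2)[X] L]
  [IsScalarTower (ZMod 2)[X] K L] {f : K} {m : ℕ} {a b : (ZMod 2)[X]}
  {v : Valuation L ℤᵐ⁰}

lemma algebraMap_eq_div (hf : IsPolarForm f m a b) : algebraMap K L f =
    (algebraMap _ L b + algebraMap _ L a * algebraMap K L y) /
      algebraMap _ L branchPolynomial ^ m := by
  simp only [hf.eq_div, map_div₀, map_add, map_mul, map_pow, ← IsScalarTower.algebraMap_apply]

variable [Algebra (RatFunc (ZMod 2)) L] [IsScalarTower (ZMod 2)[X] (RatFunc (ZMod 2)) L]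
  (h : IsArtinSchreier (RatFunc (ZMod 2)) L (algebraMap K L y)
    (algebraMap (ZMod 2)[X] _ (X ^ 3 + X)))
include h

lemma sub_div_le_one (hf : IsPolarForm f m a b)
    (hv : IsValuationAt irreducible_branchPolynomial branchRoot (algebraMap K L y) v) :
    v (algebraMap K L f - algebraMap _ L a / algebraMap _ L branchPolynomial ^ m) ≤ 1 := by
  obtain ⟨C, e, hC, he, hab⟩ := hf.exists_root
  rw [hf.algebraMap_eq_div]
  exact hv.div_sub_div_le_one h hC he hab

variable [Algebra (ZMod 2) L] [IsScalarTower (ZMod 2) (RatFunc (ZMod 2)) L]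
  [Algebra.IsAlgebraic (RatFunc (ZMod 2)) L]

lemma mem_regularAway (hf : IsPolarForm f m a b)
    (hv : IsValuationAt irreducible_branchPolynomial branchRoot (algebraMap K L y) v) :
    algebraMap K L f ∈ regularAway (ZMod 2) v := by
  obtain ⟨C, e, hC, he, hab⟩ := hf.exists_root
  have ha := hf.natDegree_left
  have hb := hf.natDegree_right
  rw [hf.algebraMap_eq_div]
  refine hv.mem_regularAway h (odd_of_eq_three natDegree_X_pow_three_add_X) hC he hab ?_
    (Or.inr ?_) <;>
    simp only [natDegree_pow, natDegree_branchPolynomial, natDegree_X_pow_three_add_X] <;> omega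

lemma valuation_lt_one_of_isRational (hf : IsPolarForm f m a b) {P : Place (ZMod 2) L}
    (hP : P.IsRational) : P.ring.valuation (algebraMap K L f) < 1 := by
  have ha := hf.natDegree_left
  have hb := hf.natDegree_right
  rw [hf.algebraMap_eq_div, ← map_pow]
  refine h.valuation_div_lt_one_of_isRational (odd_of_eq_three natDegree_X_pow_three_add_X)
    ?_ ?_ ?_ ?_ ?_ hP
  · rw [Nat.card_zmod]
    exact X_sq_sub_X_dvd_branchPolynomial_pow_sub_one m
  · rw [Nat.card_zmod]
    exact hf.dvd_left
  · rw [Nat.card_zmod]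
    exact hf.dvd_right
  · rw [natDegree_pow, natDegree_branchPolynomial]
    omega
  · rw [natDegree_pow, natDegree_branchPolynomial, natDegree_X_pow_three_add_X]
    omega

end IsPolarForm

section PolarParts

lemma natDegree_polarPart_lt (a b c : ZMod 2) :
    (a • (X ^ 5 + X) + b • (X ^ 5 + X ^ 4 + X ^ 3 + X) + c • (X ^ 6 + X ^ 5) :
      (ZMod 2)[X]).natDegree < branchPolynomial.natDegree := by
  rw [natDegree_branchPolynomial, Nat.lt_succ_iff]
  compute_degree

lemma eq_zero_of_polarPart_eq_zero {a b c : ZMod 2} (h : (a • (X ^ 5 + X) +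
    b • (X ^ 5 + X ^ 4 + X ^ 3 + X) + c • (X ^ 6 + X ^ 5) : (ZMod 2)[X]) = 0) :
    a = 0 ∧ b = 0 ∧ c = 0 := by
  have h₄ := congrArg (coeff · 4) h
  have h₅ := congrArg (coeff · 5) h
  have h₆ := congrArg (coeff · 6) h
  simp [coeff_X_pow, coeff_X] at h₄ h₅ h₆
  simp_all

variable {L : Type*} [Field L] [Algebra K L] [Algebra (ZMod 2)[X] L]
  [IsScalarTower (ZMod 2)[X] K L] [Algebra (RatFunc (ZMod 2)) L]
  [IsScalarTower (ZMod 2)[X] (RatFunc (ZMod 2)) L] {v : Valuation L ℤᵐ⁰}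
  (h : IsArtinSchreier (RatFunc (ZMod 2)) L (algebraMap K L y)
    (algebraMap (ZMod 2)[X] _ (X ^ 3 + X)))
  (hv : IsValuationAt irreducible_branchPolynomial branchRoot (algebraMap K L y) v)
include h hv

lemma hasReducedPolarPart_f₁ :
    HasReducedPolarPart branchPolynomial v (algebraMap K L f₁) (X ^ 5 + X) :=
  ⟨0, by simpa using isPolarForm_f₁.sub_div_le_one h hv⟩

lemma hasReducedPolarPart_f₂ :
    HasReducedPolarPart branchPolynomial v (algebraMap K L f₂) (X ^ 5 + X ^ 4 + X ^ 3 + X) :=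
  ⟨0, by simpa using isPolarForm_f₂.sub_div_le_one h hv⟩

/-- Adding `g² + g` with `g = X⁶ / q` removes the double pole, as `X¹² + X⁶ + X⁵ = X⁵ q`. -/
lemma hasReducedPolarPart_f₃ :
    HasReducedPolarPart branchPolynomial v (algebraMap K L f₃) (X ^ 6 + X ^ 5) := by
  have hpole := isPolarForm_f₃.sub_div_le_one h hv
  refine ⟨algebraMap (ZMod 2)[X] L (X ^ 6) / algebraMap _ L branchPolynomial, ?_⟩
  have hq0 : algebraMap (ZMod 2)[X] L branchPolynomial ≠ 0 :=
    algebraMap_polynomial_ne_zero irreducible_branchPolynomial.ne_zero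
  have hcancel : algebraMap (ZMod 2)[X] L (X ^ 12 + X ^ 6 + X ^ 5) =
      algebraMap (ZMod 2)[X] L (X ^ 5) * algebraMap _ L branchPolynomial := by
    rw [← map_mul, branchPolynomial]
    ring_nf
  convert hpole using 2
  simp only [map_add, map_pow] at hcancel ⊢
  field_simp
  linear_combination hcancel

variable [Algebra (ZMod 2) L]

lemma exists_simple_pole {a b c : ZMod 2} (habc : ¬(a = 0 ∧ b = 0 ∧ c = 0)) :
    ∃ g, v (algebraMap K L (a • f₁ + b • f₂ + c • f₃) + g ^ 2 + g) = exp 1 := by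
  have hsum := (((hasReducedPolarPart_f₁ h hv).smul a).add h.two_eq_zero_right
    ((hasReducedPolarPart_f₂ h hv).smul b)).add h.two_eq_zero_right
    ((hasReducedPolarPart_f₃ h hv).smul c)
  rw [map_add, map_add, ZMod.map_smul, ZMod.map_smul, ZMod.map_smul]
  exact hsum.exists_simple_pole hv (fun h0 => habc (eq_zero_of_polarPart_eq_zero h0))
    (natDegree_polarPart_lt a b c)

variable [IsScalarTower (ZMod 2) (RatFunc (ZMod 2)) L] [Algebra.IsAlgebraic (RatFunc (ZMod 2)) L]

lemma mem_regularAway_of_mem_S {r : K} (hr : r ∈ S) :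
    algebraMap K L r ∈ regularAway (ZMod 2) v := by
  obtain ⟨a, b, c, rfl⟩ := Submodule.mem_span_triple.1 hr
  rw [map_add, map_add, ZMod.map_smul, ZMod.map_smul, ZMod.map_smul]
  exact add_mem (add_mem (Subalgebra.smul_mem _ (isPolarForm_f₁.mem_regularAway h hv) a)
    (Subalgebra.smul_mem _ (isPolarForm_f₂.mem_regularAway h hv) b))
    (Subalgebra.smul_mem _ (isPolarForm_f₃.mem_regularAway h hv) c)

omit hv in
lemma valuation_lt_one_of_mem_S {r : K} (hr : r ∈ S) {P : Place (ZMod 2) L} (hP : P.IsRational) :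
    P.ring.valuation (algebraMap K L r) < 1 := by
  induction hr using Submodule.span_induction with
  | mem r hr =>
    obtain rfl | rfl | rfl := hr
    · exact isPolarForm_f₁.valuation_lt_one_of_isRational h hP
    · exact isPolarForm_f₂.valuation_lt_one_of_isRational h hP
    · exact isPolarForm_f₃.valuation_lt_one_of_isRational h hP
  | zero => simp
  | add r s _ _ hr hs =>
    rw [map_add]
    exact P.ring.valuation.map_add_lt hr hs
  | smul c r _ hr =>
    obtain rfl | rfl : c = 0 ∨ c = 1 := by decide +revert
    · simp
    · rwa [one_smul]

omit hv in
lemma exists_isLevel_bot {D₀ : Derivation (ZMod 2) (RatFunc (ZMod 2)) (RatFunc (ZMod 2))}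
    {D : Derivation (ZMod 2) L L}
    (hD₀ : ∀ a : (ZMod 2)[X], D₀ (algebraMap _ _ a) = algebraMap _ _ (derivative a))
    (hD : ∀ a, D (algebraMap _ L a) = algebraMap _ L (D₀ a)) :
    ∃ v : Valuation L ℤᵐ⁰, IsLevel S ⊥ D v 0 1 7 5 := by
  have hp : (X ^ 3 + X : (ZMod 2)[X]).natDegree = 2 * 1 + 1 := natDegree_X_pow_three_add_X
  have hroot : branchPolynomial ∣ X ^ 3 + X + branchRoot ^ 2 + branchRoot :=
    ⟨_, branchRoot_equation⟩
  obtain ⟨v, hv⟩ := h.exists_isValuationAt irreducible_branchPolynomial hroot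
  refine ⟨v, hv.hasPoleOfOrder_zero h derivative_branchPolynomial_ne_zero hD₀ hD,
    fun P _ => h.isInvertibleAt hp ?_ hD₀ hD P, fun c hc => hv.exists_sq_sub_lt_one h hc,
    fun r hr hr0 => ?_, fun r hr => mem_regularAway_of_mem_S h hv hr, ?_, ?_,
    hv.exists_mem_regularAway_sub_le h hp hroot (by simp [natDegree_branchPolynomial]), ?_,
    fun P hP r hr => valuation_lt_one_of_mem_S h hr hP⟩
  · exact natDegree_derivative_X_pow_three_add_X
  · obtain ⟨a, b, c, rfl⟩ := Submodule.mem_span_triple.1 hr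
    exact exists_simple_pole h hv (by rintro ⟨rfl, rfl, rfl⟩; simp at hr0)
  · rw [hv.card_poleSpace_zero h hp hroot, Nat.card_zmod, pow_one]
  · rw [zero_add, hv.card_poleSpace_one h hp hroot, Nat.card_zmod, natDegree_branchPolynomial]
  · rw [h.numRationalPoints_eq (hp ▸ odd_two_mul_add_one 1) (fun c => ?_), Nat.card_zmod]
    rw [eval_add, eval_pow, eval_X]
    decide +revert

end PolarParts

lemma linearIndependent_f : LinearIndependent (ZMod 2) ![f₁, f₂, f₃] := by
  rw [Fintype.linearIndependent_iff]
  intro c hc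
  simp only [Fin.sum_univ_three, Matrix.cons_val] at hc
  by_contra! hne
  have := isArtinSchreier_K.isAlgebraic
  obtain ⟨v, hv⟩ := isArtinSchreier_K.exists_isValuationAt irreducible_branchPolynomial
    ⟨_, branchRoot_equation⟩
  obtain ⟨g, hg⟩ := exists_simple_pole (L := K) isArtinSchreier_K hv (a := c 0) (b := c 1)
    (c := c 2) fun h0 => hne.elim fun i hi => hi (by fin_cases i <;> simp [h0])
  rw [Algebra.algebraMap_self_apply, hc, zero_add] at hg
  exact valuation_sq_add_self_ne_exp_one g hg

local notation "Ω" => AlgebraicClosure K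

instance charP_K : CharP K 2 :=
  charP_of_injective_algebraMap (algebraMap (ZMod 2) K).injective 2

instance charP_algebraicClosure : CharP Ω 2 :=
  charP_of_injective_algebraMap (algebraMap (ZMod 2) Ω).injective 2

lemma mem_adjoinRoots {A : Set K} {r : K} (hr : r ∈ A) {w : Ω}
    (hw : w ^ 2 + w = algebraMap K Ω r) : w ∈ adjoinRoots A :=
  subset_adjoin _ _ ⟨r, hr, CharTwo.add_eq_zero.2 hw⟩

lemma adjoinRoots_le_iff {A : Set K} {M : IntermediateField K Ω} :
    adjoinRoots A ≤ M ↔ ∀ r ∈ A, ∃ w ∈ M, w ^ 2 + w = algebraMap K Ω r := by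
  constructor
  · intro hle r hr
    obtain ⟨w, hw⟩ := exists_sq_add_self_eq (algebraMap K Ω r)
    exact ⟨w, hle (mem_adjoinRoots hr hw), hw⟩
  · intro h
    refine adjoin_le_iff.2 ?_
    rintro u ⟨r, hr, hu⟩
    obtain ⟨w, hwM, hw⟩ := h r hr
    obtain rfl | rfl := eq_or_eq_add_one_of_sq_add_self_eq CharTwo.two_eq_zero
      ((CharTwo.add_eq_zero.1 hu).trans hw.symm)
    exacts [hwM, M.add_mem hwM M.one_mem]

section Subfields

variable {V R R' : Submodule (ZMod 2) K} {M : IntermediateField K Ω} {f : K} {w : Ω}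

lemma FX_le_iff_le_rootSpace (hR : R ≤ V) : FX R ≤ M ↔ R ≤ rootSpace V M :=
  adjoinRoots_le_iff.trans ⟨fun h r hr => ⟨hR hr, h r hr⟩, fun h _ hr => (h hr).2⟩

lemma FX_rootSpace_le : FX (rootSpace V M) ≤ M :=
  (FX_le_iff_le_rootSpace rootSpace_le).2 le_rfl

lemma rootSpace_FX_rootSpace : rootSpace V (FX (rootSpace V M)) = rootSpace V M :=
  (rootSpace_mono FX_rootSpace_le).antisymm
    ((FX_le_iff_le_rootSpace rootSpace_le).1 (le_refl (FX (rootSpace V M))))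

lemma FX_mono (h : R ≤ R') : FX R ≤ FX R' :=
  adjoin.mono _ _ _ fun _ ⟨r, hr, hw⟩ => ⟨r, h hr, hw⟩

lemma FX_bot : FX ⊥ = ⊥ :=
  eq_bot_iff.2 ((FX_le_iff_le_rootSpace le_rfl).2 bot_le)

lemma adjoinRoots_eq_FX_span (A : Set K) : adjoinRoots A = FX (Submodule.span (ZMod 2) A) := by
  refine le_antisymm (adjoin.mono _ _ _ fun w ⟨r, hr, hw⟩ => ⟨r, Submodule.subset_span hr, hw⟩)
    ((FX_le_iff_le_rootSpace le_rfl).2 (Submodule.span_le.2 fun r hr => ?_))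
  exact ⟨Submodule.subset_span hr, adjoinRoots_le_iff.1 le_rfl r hr⟩

lemma FX_sup_span (hw : w ^ 2 + w = algebraMap K Ω f) :
    FX (R ⊔ Submodule.span (ZMod 2) {f}) = FX R ⊔ K⟮w⟯ := by
  refine le_antisymm ((FX_le_iff_le_rootSpace (V := ⊤) le_top).2 (sup_le ?_ ?_))
    (sup_le (FX_mono le_sup_left) (adjoin_simple_le_iff.2 ?_))
  · exact (FX_le_iff_le_rootSpace le_top).1 le_sup_left
  · exact (Submodule.span_singleton_le_iff_mem _ _).2
      ⟨Submodule.mem_top, w, mem_sup_adjoin_simple, hw⟩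
  · exact mem_adjoinRoots
      (Submodule.mem_sup_right (Submodule.mem_span_singleton_self f)) hw

section Correspondence

variable [Finite V]

lemma rootSpace_sup_FX (hMR : rootSpace V M ≤ R) (hR : R ≤ V) : rootSpace V (M ⊔ FX R) = R := by
  have : Finite R := Finite.of_injective _ (Submodule.inclusion_injective hR)
  refine sup_span_singleton_induction (Q := fun T => rootSpace V (M ⊔ FX T) = T)
    .of_finite hMR ?_ ?_
  · rw [sup_eq_left.2 FX_rootSpace_le]
  · intro T f _ _ hf hfT ih
    obtain ⟨w, hw⟩ := exists_sq_add_self_eq (algebraMap K Ω f)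
    have hwM : w ∉ M ⊔ FX T := fun hwM => hfT (ih ▸ ⟨hR hf, w, hwM, hw⟩)
    rw [FX_sup_span hw, ← sup_assoc, rootSpace_sup_adjoin_simple hw (hR hf) hwM, ih]

lemma relfinrank_sup_FX_mul_card (hMR : rootSpace V M ≤ R) (hR : R ≤ V) :
    relfinrank M (M ⊔ FX R) * Nat.card (rootSpace V M) = Nat.card R := by
  have : Finite R := Finite.of_injective _ (Submodule.inclusion_injective hR)
  refine sup_span_singleton_induction (Q := fun T => relfinrank M (M ⊔ FX T) *
    Nat.card (rootSpace V M) = Nat.card T) .of_finite hMR ?_ ?_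
  · rw [sup_eq_left.2 FX_rootSpace_le, relfinrank_self, one_mul]
  · intro T f hMT hTR hf hfT ih
    obtain ⟨w, hw⟩ := exists_sq_add_self_eq (algebraMap K Ω f)
    have hwM : w ∉ M ⊔ FX T := fun hwM =>
      hfT (rootSpace_sup_FX hMT (hTR.trans hR) ▸ ⟨hR hf, w, hwM, hw⟩)
    rw [FX_sup_span hw, ← sup_assoc, natCard_sup_span_singleton hfT, Nat.card_zmod, ← ih,
      ← relfinrank_mul_relfinrank le_sup_left le_sup_left,
      relfinrank_sup_adjoin_simple CharTwo.two_eq_zero hw hwM]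
    ring

lemma relfinrank_mul_card_rootSpace (hM : M ≤ FX V) :
    relfinrank M (FX V) * Nat.card (rootSpace V M) = Nat.card V := by
  have h := relfinrank_sup_FX_mul_card (M := M) rootSpace_le (le_refl V)
  rwa [sup_eq_right.2 hM] at h

lemma FX_rootSpace (hM : M ≤ FX V) : FX (rootSpace V M) = M := by
  refine le_antisymm FX_rootSpace_le (relfinrank_eq_one_iff.1 ?_)
  have hrank := relfinrank_mul_card_rootSpace (FX_mono (R := rootSpace V M) rootSpace_le)
  rw [rootSpace_FX_rootSpace, ← relfinrank_mul_card_rootSpace hM, ← relfinrank_mul_relfinrank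
    FX_rootSpace_le hM, mul_assoc, relfinrank_mul_card_rootSpace hM] at hrank
  exact Nat.eq_of_mul_eq_mul_right Nat.card_pos (hrank.trans (one_mul _).symm)

variable (hbot : rootSpace V (⊥ : IntermediateField K Ω) = ⊥)
include hbot

lemma rootSpace_FX (hR : R ≤ V) : rootSpace V (FX R) = R := by
  simpa only [bot_sup_eq] using rootSpace_sup_FX (hbot.trans_le bot_le) hR

lemma FX_le_FX_iff (hR : R ≤ V) (hR' : R' ≤ V) : FX R ≤ FX R' ↔ R ≤ R' := by
  rw [FX_le_iff_le_rootSpace hR, rootSpace_FX hbot hR']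

lemma relfinrank_FX (h : R ≤ R') (hR' : R' ≤ V) :
    relfinrank (FX R) (FX R') = Nat.card (R' ⧸ R.submoduleOf R') := by
  have hroot := rootSpace_FX hbot (h.trans hR')
  have : Finite R := Finite.of_injective _ (Submodule.inclusion_injective (h.trans hR'))
  have hcard := relfinrank_sup_FX_mul_card (hroot.trans_le h) hR'
  rw [sup_eq_right.2 (FX_mono h), hroot, Submodule.card_eq_card_quotient_mul_card
    (R.submoduleOf R'), Nat.card_congr (Submodule.submoduleOfEquivOfLe h).toEquiv,
    mul_comm (Nat.card R)] at hcard
  exact Nat.eq_of_mul_eq_mul_right Nat.card_pos hcard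

/-- The correspondence between the subspaces of `V` and the fields between `K` and `FX V`. -/
noncomputable def subspaceOrderIso : {R : Submodule (ZMod 2) K // R ≤ V} ≃o
    {F : IntermediateField K Ω // F ≤ FX V} where
  toFun R := ⟨FX R.1, FX_mono R.2⟩
  invFun F := ⟨rootSpace V F.1, rootSpace_le⟩
  left_inv R := Subtype.ext (rootSpace_FX hbot R.2)
  right_inv F := Subtype.ext (FX_rootSpace F.2)
  map_rel_iff' {R R'} := FX_le_FX_iff hbot R.2 R'.2

end Correspondence

end Subfields

section Levels

variable {R : Submodule (ZMod 2) K} {f : K}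

instance isScalarTower_ratFunc_intermediateField (M : IntermediateField K Ω) :
    IsScalarTower (ZMod 2)[X] (RatFunc (ZMod 2)) M :=
  .of_algebraMap_eq fun a => by
    rw [IsScalarTower.algebraMap_apply (ZMod 2)[X] K M,
      IsScalarTower.algebraMap_apply (RatFunc (ZMod 2)) K M,
      IsScalarTower.algebraMap_apply (ZMod 2)[X] (RatFunc (ZMod 2)) K]

instance formallyEtale_ratFunc : Algebra.FormallyEtale (ZMod 2)[X] (RatFunc (ZMod 2)) :=
  .of_isLocalization (nonZeroDivisors (ZMod 2)[X])

instance isSeparable_FX : Algebra.IsSeparable (RatFunc (ZMod 2)) (FX R) := by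
  have := isArtinSchreier_K.isSeparable
  have : Algebra.IsSeparable K (FX R) := by
    refine (isSeparable_adjoin_iff_isSeparable K _).2 ?_
    rintro w ⟨r, -, hw⟩
    exact isSeparable_of_sq_add_self CharTwo.two_eq_zero (CharTwo.add_eq_zero.1 hw)
  exact .trans (RatFunc (ZMod 2)) K (FX R)

instance formallyEtale_FX : Algebra.FormallyEtale (ZMod 2)[X] (FX R) :=
  have := Algebra.FormallyEtale.of_isSeparable (RatFunc (ZMod 2)) (FX R)
  .comp (ZMod 2)[X] (RatFunc (ZMod 2)) (FX R)

lemma exists_isLevel_FX_bot :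
    ∃ v : Valuation (FX ⊥) ℤᵐ⁰, IsLevel S ⊥ (coordDerivation (ZMod 2) (FX ⊥)) v 0 1 7 5 := by
  have hs : Function.Surjective (algebraMap K (FX ⊥)) := by
    rintro ⟨z, hz⟩
    rw [FX_bot, mem_bot] at hz
    obtain ⟨a, rfl⟩ := hz
    exact ⟨a, rfl⟩
  exact exists_isLevel_bot (isArtinSchreier_K.of_surjective hs)
    (D₀ := coordDerivation (ZMod 2) (RatFunc (ZMod 2))) coordDerivation_algebraMap
    coordDerivation_algebraMap_field

lemma rootSpace_S_bot : rootSpace S (⊥ : IntermediateField K Ω) = ⊥ := by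
  obtain ⟨v, hl⟩ := exists_isLevel_FX_bot
  refine eq_bot_iff.2 fun r ⟨hr, w, hw, hwr⟩ => ?_
  by_contra hr0
  obtain ⟨h, hh⟩ := hl.exists_simple_pole r hr hr0
  rw [← FX_bot] at hw
  exact sq_add_self_ne_of_simple_pole CharTwo.two_eq_zero hh ⟨w, hw⟩ (Subtype.ext hwr)

instance finite_S : Finite S :=
  have : Module.Finite (ZMod 2) S := .span_of_finite _ (by simp)
  Module.finite_of_finite (ZMod 2)

lemma exists_isLevel_FX_sup_span {v : Valuation (FX R) ℤᵐ⁰} {e : ℤ} {g h N : ℕ} (hRS : R ≤ S)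
    (hfS : f ∈ S) (hfR : f ∉ R)
    (hl : IsLevel S R (coordDerivation (ZMod 2) (FX R)) v e g h N) :
    ∃ v' : Valuation (FX (R ⊔ Submodule.span (ZMod 2) {f})) ℤᵐ⁰,
      IsLevel S (R ⊔ Submodule.span (ZMod 2) {f}) (coordDerivation (ZMod 2) _) v'
        (2 * e + 2) (g + h) (2 * h) (2 * N) := by
  obtain ⟨w, hw⟩ := exists_sq_add_self_eq (algebraMap K Ω f)
  have hle : FX R ≤ FX (R ⊔ Submodule.span (ZMod 2) {f}) := FX_mono le_sup_left
  let _ := (inclusion hle).toAlgebra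
  let _ : Module (FX R) (FX (R ⊔ Submodule.span (ZMod 2) {f})) := Algebra.toModule
  have : IsScalarTower (FX R) (FX (R ⊔ Submodule.span (ZMod 2) {f})) Ω :=
    .of_algebraMap_eq fun _ => rfl
  have : IsScalarTower K (FX R) (FX (R ⊔ Submodule.span (ZMod 2) {f})) :=
    .of_algebraMap_eq fun _ => rfl
  have : IsScalarTower (ZMod 2)[X] (FX R) (FX (R ⊔ Submodule.span (ZMod 2) {f})) :=
    .of_algebraMap_eq fun _ => rfl
  have hwR : w ∉ FX R := fun hwR =>
    hfR (rootSpace_FX rootSpace_S_bot hRS ▸ ⟨hfS, w, hwR, hw⟩)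
  have hAS := isArtinSchreier_of_eq_sup CharTwo.two_eq_zero hw hwR (FX_sup_span hw)
  exact hl.step hAS coordDerivation_algebraMap_field hfS hfR le_sup_left
    (Submodule.mem_sup_right (Submodule.mem_span_singleton_self f))

lemma exists_isLevel_FX (hR : R ≤ S) :
    ∃ v : Valuation (FX R) ℤᵐ⁰, IsLevel S R (coordDerivation (ZMod 2) (FX R)) v
      (2 * (Nat.card R - 1)) (1 + 7 * (Nat.card R - 1)) (7 * Nat.card R) (5 * Nat.card R) := by
  have : Finite R := .of_injective _ (Submodule.inclusion_injective hR)
  refine sup_span_singleton_induction (Q := fun T => ∃ v : Valuation (FX T) ℤᵐ⁰,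
    IsLevel S T (coordDerivation (ZMod 2) (FX T)) v (2 * (Nat.card T - 1))
      (1 + 7 * (Nat.card T - 1)) (7 * Nat.card T) (5 * Nat.card T)) .of_finite bot_le ?_ ?_
  · simpa using exists_isLevel_FX_bot
  · rintro T f - hTR hf hfT ⟨v, hl⟩
    have : Finite T := .of_injective _ (Submodule.inclusion_injective (hTR.trans hR))
    have hpos : 0 < Nat.card T := Nat.card_pos
    obtain ⟨v', hl'⟩ := exists_isLevel_FX_sup_span (hTR.trans hR) (hR hf) hfT hl
    refine ⟨v', ?_⟩
    rw [natCard_sup_span_singleton hfT, Nat.card_zmod]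
    convert hl' using 1 <;> omega

end Levels

section Invariants

variable {R : Submodule (ZMod 2) K} (hR : R ≤ S)
include hR

lemma genus_FX : genus (ZMod 2) (FX R) = 1 + 7 * (Nat.card R - 1) :=
  have ⟨_, hl⟩ := exists_isLevel_FX hR
  hl.genus_eq kaehlerEquiv_D

lemma numRationalPoints_FX : numRationalPoints (ZMod 2) (FX R) = 5 * Nat.card R :=
  have ⟨_, hl⟩ := exists_isLevel_FX hR
  hl.numRationalPoints_eq

lemma isAbsolutelyIrreducible_FX : IsAbsolutelyIrreducible (ZMod 2) (FX R) := by
  have : Finite R := .of_injective _ (Submodule.inclusion_injective hR)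
  have hcard : numRationalPoints (ZMod 2) (FX R) ≠ 0 := by
    rw [numRationalPoints_FX hR]
    exact mul_ne_zero (by norm_num) Nat.card_pos.ne'
  have ⟨⟨_, hP⟩⟩ := (Nat.card_ne_zero.1 hcard).1
  exact hP.isAbsolutelyIrreducible

end Invariants

lemma natCard_span_singleton {f : K} (hf : f ∈ ({f₁, f₂, f₃} : Set K)) :
    Nat.card (Submodule.span (ZMod 2) {f}) = 2 := by
  have hne : f ≠ 0 := by
    rcases hf with rfl | rfl | rfl
    exacts [linearIndependent_f.ne_zero 0, linearIndependent_f.ne_zero 1,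
      linearIndependent_f.ne_zero 2]
  rw [← bot_sup_eq (Submodule.span (ZMod 2) {f}),
    natCard_sup_span_singleton ((Submodule.mem_bot _).not.2 hne), Nat.card_zmod, Nat.card_unique]

lemma natCard_span_pair : Nat.card (Submodule.span (ZMod 2) {f₁, f₂}) = 4 := by
  have hf : f₂ ∉ Submodule.span (ZMod 2) {f₁} := fun h => by
    refine linearIndependent_f.notMem_span_image (s := {0}) (x := 1) (by simp) ?_
    simpa using h
  rw [Set.insert_eq, Submodule.span_union, natCard_sup_span_singleton hf, Nat.card_zmod,
    natCard_span_singleton (by simp)]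

end SerreCurve

open FunctionFieldCurve SerreCurve in
theorem mainTheorem2 :
    -- the subspaces of `S` correspond to the fields between `𝔽₂(E)` and `𝔽₂(X_{123})`,
    -- compatibly with inclusion
    (∃ e : {R : Submodule (ZMod 2) K // R ≤ S} ≃o
          {F : IntermediateField K (AlgebraicClosure K) // F ≤ FX₁₂₃},
        ∀ R, (e R : IntermediateField K (AlgebraicClosure K)) = FX R.1) ∧
    FX ⊥ = ⊥ ∧ FX S = FX₁₂₃ ∧
    -- degrees
    (∀ R R' : Submodule (ZMod 2) K, R ≤ R' → R' ≤ S →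
      IntermediateField.relfinrank (FX R) (FX R') = Nat.card (R' ⧸ R.submoduleOf R')) ∧
    -- the curves `X_R`
    (∀ R : Submodule (ZMod 2) K, R ≤ S →
      IsAbsolutelyIrreducible (ZMod 2) (FX R) ∧
      (genus (ZMod 2) (FX R) : ℤ) = 1 + 7 * ((Nat.card R : ℤ) - 1) ∧
      numRationalPoints (ZMod 2) (FX R) = 5 * Nat.card R) ∧
    -- the curves `X_j`
    (∀ f ∈ ({f₁, f₂, f₃} : Set K),
      genus (ZMod 2) (adjoinRoots {f}) = 8 ∧
      numRationalPoints (ZMod 2) (adjoinRoots {f}) = 10) ∧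
    -- the curve `X_{12}`
    genus (ZMod 2) FX₁₂ = 22 ∧ numRationalPoints (ZMod 2) FX₁₂ = 20 := by
  have h123 : FX₁₂₃ = FX S := adjoinRoots_eq_FX_span _
  have h12 : FX₁₂ = FX (Submodule.span (ZMod 2) {f₁, f₂}) := adjoinRoots_eq_FX_span _
  refine ⟨?_, FX_bot, h123.symm, fun R R' h hR' => relfinrank_FX rootSpace_S_bot h hR',
    fun R hR => ⟨isAbsolutelyIrreducible_FX hR, ?_, numRationalPoints_FX hR⟩, fun f hf => ?_, ?_⟩
  · rw [h123]
    exact ⟨subspaceOrderIso rootSpace_S_bot, fun R => rfl⟩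
  · have : Finite R := .of_injective _ (Submodule.inclusion_injective hR)
    have hpos : 0 < Nat.card R := Nat.card_pos
    rw [genus_FX hR]
    omega
  · have hle : Submodule.span (ZMod 2) {f} ≤ S := Submodule.span_mono (by simpa using hf)
    rw [adjoinRoots_eq_FX_span, genus_FX hle, numRationalPoints_FX hle, natCard_span_singleton hf]
    exact ⟨rfl, rfl⟩
  · have hle : Submodule.span (ZMod 2) {f₁, f₂} ≤ S := Submodule.span_mono (by grind)
    rw [h12, genus_FX hle, numRationalPoints_FX hle, natCard_span_pair]
    exact ⟨rfl, rfl⟩
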